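/- **Setting.** Let $\mathcal H\subset\mathbb R^4$ be the set of row vectors $(x^0,x^1,x^2,x^3)$ with $-x^0x^0-x^1x^1+x^2x^2+x^3x^3<0$, taken up to positive factors, and let $\widetilde{\mathcal H}=\widetilde{\mathrm{SL}}_2\mathbf R$ be its universal cover, with coordinates $(\varphi;r,\theta)$ given by $$x^0=\cosh r\cos\varphi,\quad x^1=\cosh r\sin\varphi,\quad x^2=\sinh r\cos(\theta-\varphi),\quad x^3=\sinh r\sin(\theta-\varphi),$$ where $\varphi\in\mathbb R$ and $(r,\theta)$ are the polar coordinates of the base plane $\varphi=0$ with the origin $E_0=(1;0;0;0)$. The fibre lines are the orbits of $\varphi\mapsto\varphi+\psi$ $(\psi\in\mathbb R)$. The isometries are the homeomorphisms of $\widetilde{\mathcal H}$ that are lifts of the linear maps $x\mapsto xa$ (row vectors) by the matrices $$a=\begin{pmatrix} a_0^0&a_0^1&a_0^2&a_0^3\\ \mp a_0^1&\pm a_0^0&\pm a_0^3&\mp a_0^2\\ a_2^0&a_2^1&a_2^2&a_2^3\\ \pm a_2^1&\mp a_2^0&\mp a_2^3&\pm a_2^2\end{pmatrix}$$ which preserve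 the above quadratic form. The rotation by the angle $\omega$ about the fibre line through $E_0$ is the isometry that fixes this line pointwise and fixes $x^0,x^1$ and maps $(x^2,x^3)$ to $(x^2\cos\omega-x^3\sin\omega,\;x^2\sin\omega+x^3\cos\omega)$. The rotation about another fibre line is its conjugate by a translation of $\widetilde{\mathrm{SL}}_2\mathbf R$ (a lift of $x\mapsto xt$, where $t$ is the matrix of the above form, with upper signs, whose first row is the normalized coordinate vector of a point of that line and whose third row is $(x^2,x^3,x^0,x^1)$). *Prisms.* Let $p\ge 3$ and let $A_1,\dots,A_p$ be distinct points of the base plane, with the fibre lines $f_1,\dots,f_p$ through them (indices modulo $p$). A side face $[f_i;f_{i+1}]$ is the union of the fibre lines through the points of a straight segment of the model that lies in $\mathcal H$ and joins a point of $f_i$ to a point of $f_{i+1}$; it is required to lie on a one-sheeted hyperboloid of the model (in the affine coordinates $x^1/x^0,x^2/x^0,x^3/x^0$). Suppose that $[f_{i-1};f_i]\cap[f_i;f_{i+1}]=f_i$ for all $i$ and that non-neighbouring side faces are disjoint. The infinite $p$-sided prism with these side faces is the closed solid $\mathcal P^i$ inside them: it is a union of fibre lines, it is the closure of its interior, its boundary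 is the union of the side faces, and its intersection with the base plane is compact. It is regular if $$A_{k+1}=\bigl(1;\,0;\,x_3\sin\tfrac{2\pi k}{p};\,x_3\cos\tfrac{2\pi k}{p}\bigr),\qquad 0\le k<p,$$ for some $0<x_3<1$, and the side faces are congruent to each other under isometries. Isometric images of (regular) infinite prisms are again called (regular) infinite prisms. The faces of the prism are its side faces and its side fibre lines $f_i$. **Theorem 2.1.** For every integer $p\ge3$ and every integer $q>\frac{2p}{p-2}$ there is a regular infinite $p$-gonal prism tiling $\mathcal T_p^i(q)$ of $\widetilde{\mathrm{SL}}_2\mathbf R$. That is, there are $x_3\in(0,1)$ and a regular infinite $p$-sided prism $\mathcal P_p^i(q)$ with the vertices $A_1,\dots,A_p$ given above such that, for the rotations $r_i$ by the angle $\frac{2\pi}{q}$ about the side fibre lines $f_i$ and for the group $\mathbf G$ generated by $r_1,\dots,r_p$: 1. $r_i$ maps the side face $[f_{i-1};f_i]$ onto the neighbouring side face $[f_i;f_{i+1}]$, for $i=1,\dots,p$; 2. the images $g(\mathcal P_p^i(q))$, $g\in\mathbf G$, form a tiling: they are closed, their union is the whole space, and any two distinct ones have disjoint interiors; 3. all tiles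 are regular infinite $p$-sided prisms, congruent to each other; 4. the tiling is face-to-face: the intersection of two distinct tiles is empty or a common face of both. -/

import Mathlib

open scoped Matrix

namespace SL2RTilde

/-- The hyperboloid model space. It is the universal cover of the solid
`-x⁰x⁰ - x¹x¹ + x²x² + x³x³ < 0` (points up to positive factors), written in the fibre coordinate
`φ ∈ ℝ` and the point `ζ = tanh r · exp (i θ)` of the open unit disc, where `(r, θ)` are the polar
coordinates of the base plane. The universal covering projection is `modelCoord`. -/
abbrev Space : Type := ℝ × Metric.ball (0 : ℂ) 1

/-- The normalized model coordinates
`(cosh r cos φ, cosh r sin φ, sinh r cos (θ - φ), sinh r sin (θ - φ))` of a point; here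
`cosh r = 1 / √(1 - ‖ζ‖²)` and `sinh r · exp (i θ) = ζ / √(1 - ‖ζ‖²)`. This is the universal
covering projection onto the hyperboloid `-x⁰x⁰ - x¹x¹ + x²x² + x³x³ = -1`; its deck group is
generated by `φ ↦ φ + 2π`. -/
noncomputable def modelCoord (X : Space) : Fin 4 → ℝ :=
  let k : ℝ := (Real.sqrt (1 - ‖(X.2 : ℂ)‖ ^ 2))⁻¹
  let w : ℂ := (X.2 : ℂ) * Complex.exp (-(X.1 * Complex.I))
  ![k * Real.cos X.1, k * Real.sin X.1, k * w.re, k * w.im]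

/-- The quadratic form of signature `(- - + +)`. -/
def quadForm (x : Fin 4 → ℝ) : ℝ := -(x 0 * x 0) - x 1 * x 1 + x 2 * x 2 + x 3 * x 3

/-- The point `X` has the homogeneous coordinates `u` (with positive equivalence). -/
def HasHomCoord (X : Space) (u : Fin 4 → ℝ) : Prop := ∃ c : ℝ, 0 < c ∧ modelCoord X = c • u

/-- The fibre translation by `ψ`, i.e. the lift of the one-parameter group
`(x⁰ cos ψ - x¹ sin ψ, x⁰ sin ψ + x¹ cos ψ, x² cos ψ + x³ sin ψ, -x² sin ψ + x³ cos ψ)`. -/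
def fibreTranslation (ψ : ℝ) (X : Space) : Space := (X.1 + ψ, X.2)

/-- The fibre line through `X`. -/
def fibre (X : Space) : Set Space := Set.range fun ψ : ℝ => fibreTranslation ψ X

/-- The hyperbolic base plane `φ = 0`. -/
def basePlane : Set Space := {X | X.1 = 0}

/-! ### Isometries -/

/-- The matrices (acting on row vectors from the right) that describe the isometries; `ε = 1` and
`ε = -1` are the upper and the lower choice of the signs. -/
def IsIsometryMatrix (a : Matrix (Fin 4) (Fin 4) ℝ) : Prop :=
  (∃ ε : ℝ, (ε = 1 ∨ ε = -1) ∧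
    a 1 0 = -ε * a 0 1 ∧ a 1 1 = ε * a 0 0 ∧ a 1 2 = ε * a 0 3 ∧ a 1 3 = -ε * a 0 2 ∧
    a 3 0 = ε * a 2 1 ∧ a 3 1 = -ε * a 2 0 ∧ a 3 2 = -ε * a 2 3 ∧ a 3 3 = ε * a 2 2) ∧
  -(a 0 0) ^ 2 - (a 0 1) ^ 2 + (a 0 2) ^ 2 + (a 0 3) ^ 2 = -1 ∧
  -(a 2 0) ^ 2 - (a 2 1) ^ 2 + (a 2 2) ^ 2 + (a 2 3) ^ 2 = 1 ∧
  -(a 0 0 * a 2 0) - a 0 1 * a 2 1 + a 0 2 * a 2 2 + a 0 3 * a 2 3 = 0 ∧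
  -(a 0 0 * a 2 1) + a 0 1 * a 2 0 - a 0 2 * a 2 3 + a 0 3 * a 2 2 = 0

/-- The homeomorphism `g` of the space is a lift of the collineation with matrix `a`. -/
def Covers (g : Space ≃ₜ Space) (a : Matrix (Fin 4) (Fin 4) ℝ) : Prop :=
  ∀ Y, modelCoord (g Y) = modelCoord Y ᵥ* a

/-- The isometries of the space: all lifts of the collineations given by isometry matrices. -/
def IsIsometry (g : Space ≃ₜ Space) : Prop := ∃ a, IsIsometryMatrix a ∧ Covers g a

/-- The translation matrix that maps the origin `(1, 0, 0, 0)` to `x`. -/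
def transMatrix (x : Fin 4 → ℝ) : Matrix (Fin 4) (Fin 4) ℝ :=
  !![x 0, x 1, x 2, x 3;
     -x 1, x 0, x 3, -x 2;
     x 2, x 3, x 0, x 1;
     x 3, -x 2, -x 1, x 0]

/-- The inverse of `transMatrix x`, when `quadForm x = -1`. -/
def transInvMatrix (x : Fin 4 → ℝ) : Matrix (Fin 4) (Fin 4) ℝ :=
  !![x 0, -x 1, -x 2, -x 3;
     x 1, x 0, -x 3, x 2;
     -x 2, -x 3, x 0, -x 1;
     -x 3, x 2, x 1, x 0]

/-- The matrix of the rotation by the angle `ω` about the fibre line through the origin. -/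
noncomputable def originRotMatrix (ω : ℝ) : Matrix (Fin 4) (Fin 4) ℝ :=
  !![1, 0, 0, 0;
     0, 1, 0, 0;
     0, 0, Real.cos ω, Real.sin ω;
     0, 0, -Real.sin ω, Real.cos ω]

/-- The matrix of the rotation by the angle `ω` about the fibre line through `x`. -/
noncomputable def rotMatrix (x : Fin 4 → ℝ) (ω : ℝ) : Matrix (Fin 4) (Fin 4) ℝ :=
  transInvMatrix x * originRotMatrix ω * transMatrix x

/-- `g` is the rotation by the angle `ω` about the fibre line through `X`: the lift of the
rotation collineation that fixes this fibre line pointwise. -/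
def IsRotation (X : Space) (ω : ℝ) (g : Space ≃ₜ Space) : Prop :=
  Covers g (rotMatrix (modelCoord X) ω) ∧ ∀ Y ∈ fibre X, g Y = Y

/-! ### Infinite prisms -/

/-- The set `S` lies on a surface that is a one-sheeted hyperboloid in the affine coordinates
`x¹/x⁰, x²/x⁰, x³/x⁰` of the model, i.e. one with the equation `ℓ₁² + ℓ₂² - ℓ₃² = 1` for three
affine functions `ℓᵢ` that form an affine coordinate system (here homogenized: `ℓ₀ = x⁰`, and
`ℓ` is an invertible linear change of the homogeneous coordinates). -/
def OnOneSheetedHyperboloid (S : Set Space) : Prop :=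
  ∃ L : Matrix (Fin 4) (Fin 4) ℝ, L.det ≠ 0 ∧ (∀ x : Fin 4 → ℝ, (x ᵥ* L) 0 = x 0) ∧
    ∀ Z ∈ S, let ℓ := modelCoord Z ᵥ* L
      ℓ 1 ^ 2 + ℓ 2 ^ 2 - ℓ 3 ^ 2 = ℓ 0 ^ 2

/-- The union of all fibre lines through the points of the straight segment of the model that
joins `X` to `Y`. -/
def segmentFibres (X Y : Space) : Set Space :=
  {Z | ∃ t ∈ Set.Icc (0 : ℝ) 1, ∃ W ∈ fibre Z,
    HasHomCoord W ((1 - t) • modelCoord X + t • modelCoord Y)}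

/-- `S` is a side face with the bounding side fibre lines `fibre A` and `fibre B`: it consists of
the fibre lines through the points of a straight segment which joins a point of the first line to
a point of the second one inside the model, and it lies on a one-sheeted hyperboloid. -/
def IsSideFace (A B : Space) (S : Set Space) : Prop :=
  (∃ X ∈ fibre A, ∃ Y ∈ fibre B,
    (∀ t ∈ Set.Icc (0 : ℝ) 1, quadForm ((1 - t) • modelCoord X + t • modelCoord Y) < 0) ∧
    S = segmentFibres X Y) ∧
  OnOneSheetedHyperboloid S

/-- `P` is the infinite solid over a `p`-gon of the base plane with the consecutive vertices `A i`,
bounded by the side faces `S i`, where `S i` has the side fibre lines through `A i` and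
`A (i + 1)`. The side faces form a closed cycle without self-intersections, and `P` is the closed
solid inside. -/
structure IsInfinitePrism (p : ℕ) (A : ZMod p → Space) (S : ZMod p → Set Space)
    (P : Set Space) : Prop where
  vertex_mem : ∀ i, A i ∈ basePlane
  vertex_inj : Function.Injective A
  side : ∀ i, IsSideFace (A i) (A (i + 1)) (S i)
  side_inter : ∀ i, S i ∩ S (i + 1) = fibre (A (i + 1))
  side_disjoint : ∀ i j, i ≠ j → j ≠ i + 1 → i ≠ j + 1 → Disjoint (S i) (S j)
  fibre_subset : ∀ X ∈ P, fibre X ⊆ P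
  base_compact : IsCompact (P ∩ basePlane)
  regular_closed : closure (interior P) = P
  frontier_eq : frontier P = ⋃ i, S i

/-- `P` is a regular infinite prism in standard position: an infinite prism whose `p`-gon is
the regular one with centre at the origin and with the vertices
`(1, 0, x₃ sin (2πk/p), x₃ cos (2πk/p))`, and whose side faces are congruent to each other. -/
structure IsStandardRegularInfinitePrism (p : ℕ) (x₃ : ℝ) (A : ZMod p → Space)
    (S : ZMod p → Set Space) (P : Set Space) : Prop extends IsInfinitePrism p A S P where
  param_pos : 0 < x₃
  vertex_coord : ∀ k, HasHomCoord (A k)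
    ![1, 0, x₃ * Real.sin (2 * Real.pi * k.val / p), x₃ * Real.cos (2 * Real.pi * k.val / p)]
  side_congruent : ∀ i j, ∃ g, IsIsometry g ∧ g '' S i = S j

/-- `Q` is a regular infinite `p`-sided prism: an isometric image of one in standard position. -/
def IsRegularInfinitePrism (p : ℕ) (Q : Set Space) : Prop :=
  ∃ x₃ A S P g, IsStandardRegularInfinitePrism p x₃ A S P ∧ IsIsometry g ∧ Q = g '' P

/-! ### Tilings -/

/-- A family of closed sets that cover the space and whose distinct members have disjoint
interiors. -/
structure IsTiling (T : Set (Set Space)) : Prop where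
  closed : ∀ Q ∈ T, IsClosed Q
  cover : ⋃₀ T = Set.univ
  disjoint : ∀ Q ∈ T, ∀ Q' ∈ T, Q ≠ Q' → Disjoint (interior Q) (interior Q')

/-- All tiles are congruent to each other. -/
def IsMonohedral (T : Set (Set Space)) : Prop :=
  ∀ Q ∈ T, ∀ Q' ∈ T, ∃ g, IsIsometry g ∧ g '' Q = Q'

/-- The images of `P` under the group `G`. -/
def orbitTiles (G : Subgroup (Space ≃ₜ Space)) (P : Set Space) : Set (Set Space) :=
  {Q | ∃ g ∈ G, Q = g '' P}

/-- The faces of the prism with the vertices `A i` and the side faces `S i`: the side faces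
and the side fibre lines. -/
def prismFaces {p : ℕ} (A : ZMod p → Space) (S : ZMod p → Set Space) : Set (Set Space) :=
  {F | (∃ i, F = S i) ∨ ∃ i, F = fibre (A i)}

/-- The images of a prism `P` under the group `G` are face-to-face: two different ones are
disjoint, or their intersection is a common face of both. -/
def IsFaceToFace {p : ℕ} (G : Subgroup (Space ≃ₜ Space)) (A : ZMod p → Space)
    (S : ZMod p → Set Space) (P : Set Space) : Prop :=
  ∀ g ∈ G, ∀ h ∈ G, g '' P ≠ h '' P →
    g '' P ∩ h '' P = ∅ ∨
    ((∃ F ∈ prismFaces A S, g '' P ∩ h '' P = g '' F) ∧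
      ∃ F ∈ prismFaces A S, g '' P ∩ h '' P = h '' F)

end SL2RTilde

/-! The space is a line bundle over the hyperbolic plane and every set in the theorem is a union of
fibres, so the claim is about the regular `p`-gon with vertex angle `2π/q`. With `z = x⁰ + i x¹` and
`w = x² + i x³`, the map `(z, w) ↦ (|z|² + |w|², 2wz)` forgets the fibre coordinate and sends the
space onto the unit hyperboloid of the Lorentzian space `ℝ × ℂ` (`hvec`, `baseVec`). Translations
and rotations of the space induce Lorentz maps there, and a straight segment of the model projects
to a geodesic segment once its ends are suitably placed on their fibres (`exists_geodesic_segment`).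
The prism is the preimage of the cone cut out by the inner normals of the sides of the polygon. The
hypothesis on `q` says `π/p + π/q < π/2`, which lets such a polygon exist.

The tiling comes from the reflection group of the triangle with angles `π/p`, `π/q`, `π/2` whose
corners are the centre, a vertex and the midpoint of a side. The length argument of Tits shows that
`w (α s)` is nonnegative on the chamber whenever `s` does not shorten `w` (`root_nonneg`). Hence the
chamber meets an orbit at most once, and stabilizers are generated by the walls through the point
(`eq_and_mem_stabilizer`). That every timelike vector can be moved into the chamber is a
minimization over a discrete orbit (`exists_mem_chamber`).

The rotation about vertex `k` is the reflection in side `k` times the reflection in the line from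
the centre to that vertex, and the latter is a symmetry of the polygon. So the triangle group is the
product of the rotations and the dihedral symmetry group of the polygon
(`exists_rotation_mul_dihedral`), and the tile of an element depends only on its coset modulo the
dihedral group. A common point of two tiles is moved to the triangle, where its stabilizer decides
(`exists_decomposition`, `side_or_vertex`): off the sides the tiles coincide, on a side but not at a
vertex they are mirror images across that side, and otherwise they meet at a vertex. Elements of the
rotation group that act trivially on the plane preserve each fibre, hence the prism, so the group
itself need not be determined. -/

namespace SL2RTilde

/-! ### Groups generated by linear reflections -/

section Reflections

variable {S V : Type*} [AddCommGroup V] [Module ℝ V]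

/-- Unit vectors `α s` of a symmetric bilinear form whose reflections `σ s` satisfy the
angle conditions of a Coxeter system of finite type in rank two. -/
structure CoxeterRoots (B : LinearMap.BilinForm ℝ V) (α : S → V) (σ : S → V ≃ₗ[ℝ] V) : Prop where
  symm : ∀ x y, B x y = B y x
  norm : ∀ s, B (α s) (α s) = 1
  apply : ∀ s v, σ s v = v - (2 * B v (α s)) • α s
  angle : ∀ s t, s ≠ t → ∃ m : ℕ, 2 ≤ m ∧ B (α s) (α t) = -Real.cos (Real.pi / m)

/-- The product of the generators along a word. -/
def wordProd (σ : S → V ≃ₗ[ℝ] V) (L : List S) : V ≃ₗ[ℝ] V := (L.map σ).prod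

/-- The length of a shortest word for `w`. -/
noncomputable def wordLength (σ : S → V ≃ₗ[ℝ] V) (w : V ≃ₗ[ℝ] V) : ℕ :=
  sInf {n | ∃ L : List S, L.length = n ∧ wordProd σ L = w}

@[simp] lemma wordProd_nil (σ : S → V ≃ₗ[ℝ] V) : wordProd σ [] = 1 := rfl

@[simp] lemma wordProd_cons (σ : S → V ≃ₗ[ℝ] V) (s : S) (L : List S) :
    wordProd σ (s :: L) = σ s * wordProd σ L := by simp [wordProd]

@[simp] lemma wordProd_append (σ : S → V ≃ₗ[ℝ] V) (L M : List S) :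
    wordProd σ (L ++ M) = wordProd σ L * wordProd σ M := by simp [wordProd]

lemma wordLength_wordProd_le (σ : S → V ≃ₗ[ℝ] V) (L : List S) :
    wordLength σ (wordProd σ L) ≤ L.length := Nat.sInf_le ⟨L, rfl, rfl⟩

lemma wordProd_mem_closure (σ : S → V ≃ₗ[ℝ] V) (L : List S) :
    wordProd σ L ∈ Subgroup.closure (Set.range σ) := by
  induction L with
  | nil => simp [one_mem]
  | cons s L ih =>
    rw [wordProd_cons]
    exact mul_mem (Subgroup.subset_closure ⟨s, rfl⟩) ih

/-- The closed chamber bounded by the mirrors of the reflections. -/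
def chamber (B : LinearMap.BilinForm ℝ V) (α : S → V) : Set V := {x | ∀ s, 0 ≤ B x (α s)}

variable {B : LinearMap.BilinForm ℝ V} {α : S → V} {σ : S → V ≃ₗ[ℝ] V}

/-! ### Words and length in the reflections. -/

namespace CoxeterRoots

lemma apply_root (h : CoxeterRoots B α σ) (s : S) : σ s (α s) = -α s := by
  rw [h.apply, h.norm]; module

lemma mul_self (h : CoxeterRoots B α σ) (s : S) : σ s * σ s = 1 := by
  ext v
  simp only [LinearEquiv.mul_apply, LinearEquiv.coe_one, id_eq]
  rw [h.apply s v, map_sub, map_smul, h.apply_root, h.apply]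
  module

lemma inv_eq (h : CoxeterRoots B α σ) (s : S) : (σ s)⁻¹ = σ s :=
  inv_eq_of_mul_eq_one_left (h.mul_self s)

lemma form_apply (h : CoxeterRoots B α σ) (s : S) (x y : V) : B (σ s x) (σ s y) = B x y := by
  simp only [h.apply, map_sub, map_smul, LinearMap.sub_apply, LinearMap.smul_apply, smul_eq_mul,
    h.norm, h.symm (α s)]
  ring

lemma form_mem (h : CoxeterRoots B α σ) {w : V ≃ₗ[ℝ] V}
    (hw : w ∈ Subgroup.closure (Set.range σ)) : ∀ x y, B (w x) (w y) = B x y := by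
  induction hw using Subgroup.closure_induction with
  | mem w hw => obtain ⟨s, rfl⟩ := hw; exact h.form_apply s
  | one => intro x y; rfl
  | mul a b _ _ ha hb => intro x y; rw [LinearEquiv.mul_apply, LinearEquiv.mul_apply, ha, hb]
  | inv a _ ha =>
    intro x y
    rw [← ha, ← LinearEquiv.mul_apply, ← LinearEquiv.mul_apply, mul_inv_cancel]
    rfl

lemma exists_word (h : CoxeterRoots B α σ) {w : V ≃ₗ[ℝ] V}
    (hw : w ∈ Subgroup.closure (Set.range σ)) : ∃ L, wordProd σ L = w := by
  induction hw using Subgroup.closure_induction with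
  | mem w hw => obtain ⟨s, rfl⟩ := hw; exact ⟨[s], by simp⟩
  | one => exact ⟨[], rfl⟩
  | mul a b _ _ ha hb =>
    obtain ⟨L, rfl⟩ := ha
    obtain ⟨M, rfl⟩ := hb
    exact ⟨L ++ M, by simp⟩
  | inv a _ ha =>
    obtain ⟨L, rfl⟩ := ha
    refine ⟨L.reverse, ?_⟩
    induction L with
    | nil => simp
    | cons s L ih => simp [ih (wordProd_mem_closure σ L), h.inv_eq]

lemma exists_reduced_word (h : CoxeterRoots B α σ) {w : V ≃ₗ[ℝ] V}
    (hw : w ∈ Subgroup.closure (Set.range σ)) :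
    ∃ L, wordProd σ L = w ∧ L.length = wordLength σ w := by
  obtain ⟨L, hL⟩ := h.exists_word hw
  obtain ⟨M, hM, hM'⟩ := Nat.sInf_mem
    (s := {n | ∃ L : List S, L.length = n ∧ wordProd σ L = w}) ⟨L.length, L, rfl, hL⟩
  exact ⟨M, hM', hM⟩

lemma wordLength_mul_le (h : CoxeterRoots B α σ) {w : V ≃ₗ[ℝ] V}
    (hw : w ∈ Subgroup.closure (Set.range σ)) (L : List S) :
    wordLength σ (w * wordProd σ L) ≤ wordLength σ w + L.length := by
  obtain ⟨M, hM, hM'⟩ := h.exists_reduced_word hw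
  have := wordLength_wordProd_le σ (M ++ L)
  rw [wordProd_append, hM, List.length_append, hM'] at this
  exact this

/-! #### Two reflections -/

open CoxeterSystem (alternatingWord alternatingWord_succ alternatingWord_succ'
  length_alternatingWord)

lemma mem_alternatingWord (s t : S) (k : ℕ) : ∀ x ∈ alternatingWord s t k, x = s ∨ x = t := by
  induction k with
  | zero => simp [alternatingWord]
  | succ k ih =>
    rw [alternatingWord_succ']
    intro x hx
    rcases List.mem_cons.1 hx with rfl | hx
    · split_ifs <;> simp
    · exact ih x hx

/-- The coefficients satisfy the Chebyshev recursion `sin ((k + 2) θ) = 2 cos θ sin ((k + 1) θ) -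
sin (k θ)`. The word ends in `t`, so `σ t` acts first on `α s`. The factor `sin θ` avoids a
division. -/
lemma alternating_apply_root (h : CoxeterRoots B α σ) {s t : S} {θ : ℝ}
    (hθ : B (α s) (α t) = -Real.cos θ) (k : ℕ) :
    Real.sin θ • wordProd σ (alternatingWord s t k) (α s) =
      Real.sin ((k + 1) * θ) • α (if Even k then s else t) +
        Real.sin (k * θ) • α (if Even k then t else s) := by
  have hθ' : B (α t) (α s) = -Real.cos θ := by rw [h.symm, hθ]
  induction k with
  | zero => simp [alternatingWord]
  | succ k ih =>
    have e : Real.sin ((((k + 1 : ℕ) : ℝ) + 1) * θ) =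
        2 * Real.cos θ * Real.sin ((k + 1) * θ) - Real.sin (k * θ) := by
      push_cast
      have e1 : ((k : ℝ) + 1 + 1) * θ = (k + 1) * θ + θ := by ring
      have e2 : (k : ℝ) * θ = (k + 1) * θ - θ := by ring
      rw [e1, e2, Real.sin_add, Real.sin_sub]; ring
    rw [alternatingWord_succ', wordProd_cons, LinearEquiv.mul_apply, ← map_smul, ih, e]
    by_cases hk : Even k
    · have hk' : ¬ Even (k + 1) := by simpa [Nat.even_add_one] using hk
      simp only [hk, hk', if_true, if_false, map_add, map_smul, h.apply_root]
      rw [h.apply t (α s), hθ]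
      push_cast
      module
    · have hk' : Even (k + 1) := by simpa [Nat.even_add_one] using hk
      simp only [hk, hk', if_true, if_false, map_add, map_smul, h.apply_root]
      rw [h.apply s (α t), hθ']
      push_cast
      module

lemma alternating_apply_of_orthogonal (h : CoxeterRoots B α σ) {s t : S} {v : V}
    (hs : B v (α s) = 0) (ht : B v (α t) = 0) (k : ℕ) :
    wordProd σ (alternatingWord s t k) v = v := by
  induction k with
  | zero => simp [alternatingWord]
  | succ k ih =>
    rw [alternatingWord_succ', wordProd_cons, LinearEquiv.mul_apply, ih]
    split_ifs <;> rw [h.apply] <;> simp [hs, ht]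

/-- At `m θ = π` the sines degenerate and both sides become the negative of a single root. The word
`t s …` of length `m` ends in `s`, which first turns `α s` into `-α s`, and the remaining `m - 1`
letters are handled by the same formula. -/
lemma braid_apply_root (h : CoxeterRoots B α σ) {s t : S} {θ : ℝ} {m : ℕ} (hm : 1 ≤ m)
    (hθ : B (α s) (α t) = -Real.cos θ) (hmθ : m * θ = Real.pi) (h0 : Real.sin θ ≠ 0) :
    wordProd σ (alternatingWord s t m) (α s) = wordProd σ (alternatingWord t s m) (α s) := by
  obtain ⟨n, rfl⟩ := Nat.exists_eq_add_of_le' hm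
  have e1 : Real.sin ((((n + 1 : ℕ) : ℝ) + 1) * θ) = -Real.sin θ := by
    rw [add_mul, hmθ, one_mul, add_comm, Real.sin_add_pi]
  have e2 : Real.sin (((n + 1 : ℕ) : ℝ) * θ) = 0 := by rw [hmθ, Real.sin_pi]
  have e3 : Real.sin ((n : ℝ) * θ) = Real.sin θ := by
    rw [← Real.sin_pi_sub, ← hmθ]; congr 1; push_cast; ring
  have e4 : Real.sin (((n : ℝ) + 1) * θ) = 0 := by rw [← e2]; push_cast; rfl
  have c1 := h.alternating_apply_root hθ (n + 1)
  have c2 := h.alternating_apply_root hθ n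
  rw [e1, e2] at c1
  rw [e3, e4] at c2
  have d1 : wordProd σ (alternatingWord s t (n + 1)) (α s) =
      -α (if Even (n + 1) then s else t) := by
    apply (smul_right_injective V h0); dsimp only; rw [c1]; module
  have d2 : wordProd σ (alternatingWord s t n) (α s) = α (if Even n then t else s) := by
    apply (smul_right_injective V h0); dsimp only; rw [c2]; module
  rw [d1, alternatingWord_succ, List.concat_eq_append, wordProd_append, LinearEquiv.mul_apply]
  simp only [wordProd_cons, wordProd_nil, mul_one, h.apply_root, map_neg, d2]
  by_cases hn : Even n <;> simp [hn, Nat.even_add_one]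

/-- Both words fix the vectors orthogonal to the two roots and agree on the roots; as the Gram
determinant `sin² θ` is nonzero, these vectors span the space. -/
lemma braid (h : CoxeterRoots B α σ) {s t : S} {θ : ℝ} {m : ℕ} (hm : 1 ≤ m)
    (hθ : B (α s) (α t) = -Real.cos θ) (hmθ : m * θ = Real.pi) (h0 : Real.sin θ ≠ 0) :
    wordProd σ (alternatingWord s t m) = wordProd σ (alternatingWord t s m) := by
  have hθ' : B (α t) (α s) = -Real.cos θ := by rw [h.symm, hθ]
  have hs := h.braid_apply_root hm hθ hmθ h0
  have ht := (h.braid_apply_root hm hθ' hmθ h0).symm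
  ext v
  -- `a` and `b` solve the Gram system that makes `v - a • α s - b • α t` orthogonal to both roots.
  set a := (B v (α s) + Real.cos θ * B v (α t)) / Real.sin θ ^ 2 with ha
  set b := (B v (α t) + Real.cos θ * B v (α s)) / Real.sin θ ^ 2 with hb
  have hsq := Real.sin_sq_add_cos_sq θ
  have hv : v = a • α s + b • α t + (v - a • α s - b • α t) := by module
  have o1 : B (v - a • α s - b • α t) (α s) = 0 := by
    simp only [map_sub, map_smul, LinearMap.sub_apply, LinearMap.smul_apply, smul_eq_mul, h.norm,
      hθ', ha, hb]
    field_simp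
    linear_combination (B v (α s)) * hsq
  have o2 : B (v - a • α s - b • α t) (α t) = 0 := by
    simp only [map_sub, map_smul, LinearMap.sub_apply, LinearMap.smul_apply, smul_eq_mul, h.norm,
      hθ, ha, hb]
    field_simp
    linear_combination (B v (α t)) * hsq
  rw [hv]
  simp only [map_add, map_smul]
  rw [h.alternating_apply_of_orthogonal o1 o2, h.alternating_apply_of_orthogonal o2 o1, hs, ht]

/-- A repeated letter would cancel because the generators are involutions. Minimality is only
required among words in the two letters. -/
lemma reduced_eq_alternating (h : CoxeterRoots B α σ) {s t : S} (L : List S)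
    (hL : ∀ x ∈ L, x = s ∨ x = t)
    (hred : ∀ M : List S, (∀ x ∈ M, x = s ∨ x = t) → wordProd σ M = wordProd σ L →
      L.length ≤ M.length) :
    L = alternatingWord s t L.length ∨ L = alternatingWord t s L.length := by
  induction L with
  | nil => left; rfl
  | cons x L ih =>
    have hL' : ∀ x ∈ L, x = s ∨ x = t := fun y hy => hL y (List.mem_cons_of_mem _ hy)
    have hx := hL x List.mem_cons_self
    have key : ∀ s' t' : S, (x = s' ∨ x = t') → (∀ x ∈ L, x = s' ∨ x = t') →
        (∀ M : List S, (∀ x ∈ M, x = s' ∨ x = t') → wordProd σ M = wordProd σ (x :: L) →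
          (x :: L).length ≤ M.length) →
        L = alternatingWord s' t' L.length →
        (x :: L) = alternatingWord s' t' (x :: L).length ∨
          (x :: L) = alternatingWord t' s' (x :: L).length := by
      intro s t hx hL' hred e
      rcases hn : L.length with _ | n
      · have : L = [] := List.length_eq_zero_iff.1 hn
        subst this
        rcases hx with rfl | rfl
        · right; rfl
        · left; rfl
      · left
        rw [List.length_cons, hn, alternatingWord_succ']
        rw [hn] at e
        rw [← e]
        congr 1
        by_contra hne
        have e' := e
        rw [alternatingWord_succ'] at e'
        have hx' : x = if Even n then t else s := by
          by_cases hn' : Even n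
          · have : ¬ Even (n + 1) := by simpa [Nat.even_add_one] using hn'
            simp only [this, hn', if_false, if_true] at hne ⊢
            tauto
          · have : Even (n + 1) := by simpa [Nat.even_add_one] using hn'
            simp only [this, hn', if_false, if_true] at hne ⊢
            tauto
        rw [← hx'] at e'
        have := hred (alternatingWord s t n) (mem_alternatingWord s t n) (by
          rw [e', wordProd_cons, wordProd_cons, ← mul_assoc, h.mul_self, one_mul])
        rw [length_alternatingWord, List.length_cons, hn] at this
        omega
    have hred' : ∀ M : List S, (∀ x ∈ M, x = s ∨ x = t) → wordProd σ M = wordProd σ L →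
      L.length ≤ M.length := by
      intro M hM e
      have := hred (x :: M) (by
        intro y hy
        rcases List.mem_cons.1 hy with rfl | hy
        · exact hx
        · exact hM y hy) (by simp [e])
      simpa using this
    rcases ih hL' hred' with e | e
    · exact key s t hx hL' hred e
    · have sw : ∀ x, (x = t ∨ x = s) ↔ (x = s ∨ x = t) := fun x => or_comm
      exact (key t s hx.symm (by simpa only [sw] using hL') (by simpa only [sw] using hred) e).symm

lemma alternating_add (s t : S) (j m : ℕ) : ∃ M : List S, (∀ x ∈ M, x = s ∨ x = t) ∧
    M.length = j ∧ alternatingWord s t (j + m) = M ++ alternatingWord s t m := by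
  induction j with
  | zero => exact ⟨[], by simp, rfl, by simp⟩
  | succ j ih =>
    obtain ⟨M, hM, hl, e⟩ := ih
    refine ⟨(if Even (j + m) then t else s) :: M, ?_, by simp [hl], ?_⟩
    · intro x hx
      rcases List.mem_cons.1 hx with rfl | hx
      · split_ifs <;> simp
      · exact hM x hx
    · rw [add_right_comm, alternatingWord_succ', e, List.cons_append]

/-- By minimality `L` is alternating. It cannot end in `s`, for then `s` would cancel, and it cannot
have `m` or more letters, for then the braid relation would rewrite it to end in `s`. So it ends in
`t` or is empty and has length `k < m`, and the coefficients `sin ((k + 1) θ) / sin θ` and `sin (k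
θ) / sin θ` are nonnegative because `(k + 1) θ ≤ π`. -/
lemma dihedral_apply_root (h : CoxeterRoots B α σ) {s t : S} (hst : s ≠ t) (L : List S)
    (hL : ∀ x ∈ L, x = s ∨ x = t)
    (hred : ∀ M : List S, (∀ x ∈ M, x = s ∨ x = t) → wordProd σ M = wordProd σ L →
      L.length ≤ M.length)
    (hasc : ∀ M : List S, (∀ x ∈ M, x = s ∨ x = t) → wordProd σ M = wordProd σ L * σ s →
      L.length ≤ M.length) :
    ∃ a b : ℝ, 0 ≤ a ∧ 0 ≤ b ∧ wordProd σ L (α s) = a • α s + b • α t := by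
  obtain ⟨m, hm, hB⟩ := h.angle s t hst
  have hm0 : (0 : ℝ) < m := by positivity
  have hm2 : (2 : ℝ) ≤ m := by exact_mod_cast hm
  set θ := Real.pi / m with hθ
  have hmθ : m * θ = Real.pi := by rw [hθ]; field_simp
  have hθ0 : 0 < θ := by positivity
  have hθ1 : θ < Real.pi := by rw [← hmθ]; nlinarith
  have hsin : 0 < Real.sin θ := Real.sin_pos_of_pos_of_lt_pi hθ0 hθ1
  have main : ∀ k : ℕ, k < m → ∃ a b : ℝ, 0 ≤ a ∧ 0 ≤ b ∧
      wordProd σ (alternatingWord s t k) (α s) = a • α s + b • α t := by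
    intro k hk
    have hk' : (k : ℝ) + 1 ≤ m := by exact_mod_cast hk
    have p1 : 0 ≤ Real.sin ((k + 1) * θ) / Real.sin θ := by
      apply div_nonneg _ hsin.le
      apply Real.sin_nonneg_of_nonneg_of_le_pi (by positivity)
      rw [← hmθ]; nlinarith
    have p2 : 0 ≤ Real.sin (k * θ) / Real.sin θ := by
      apply div_nonneg _ hsin.le
      apply Real.sin_nonneg_of_nonneg_of_le_pi (by positivity)
      rw [← hmθ]; nlinarith
    have c := h.alternating_apply_root hB k
    have c' : wordProd σ (alternatingWord s t k) (α s) =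
        (Real.sin ((k + 1) * θ) / Real.sin θ) • α (if Even k then s else t) +
        (Real.sin (k * θ) / Real.sin θ) • α (if Even k then t else s) := by
      apply (smul_right_injective V hsin.ne')
      dsimp only
      rw [c, smul_add, smul_smul, smul_smul, mul_div_cancel₀ _ hsin.ne', mul_div_cancel₀ _ hsin.ne']
    by_cases hk : Even k
    · exact ⟨_, _, p1, p2, by simpa [hk] using c'⟩
    · exact ⟨_, _, p2, p1, by rw [c']; simp only [hk, if_false]; rw [add_comm]⟩
  rcases h.reduced_eq_alternating L hL hred with e | e
  · rcases lt_or_ge L.length m with hlt | hge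
    · rw [e]; exact main _ hlt
    · exfalso
      obtain ⟨j, hj⟩ := Nat.exists_eq_add_of_le' hge
      obtain ⟨M, hM, hMl, eM⟩ := alternating_add s t j m
      obtain ⟨n, rfl⟩ := Nat.exists_eq_add_of_le' (show 1 ≤ m by omega)
      have := hasc (M ++ alternatingWord s t n) (by
        intro x hx
        rcases List.mem_append.1 hx with hx | hx
        · exact hM x hx
        · exact mem_alternatingWord s t n x hx) (by
        rw [e, hj, eM, wordProd_append, wordProd_append, h.braid (by omega) hB hmθ hsin.ne',
          alternatingWord_succ, List.concat_eq_append, wordProd_append]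
        simp only [wordProd_cons, wordProd_nil, mul_one, mul_assoc, h.mul_self])
      rw [List.length_append, length_alternatingWord, hMl] at this
      omega
  · rcases hn : L.length with _ | n
    · have : L = [] := List.length_eq_zero_iff.1 hn
      subst this
      exact ⟨1, 0, by simp, le_rfl, by simp⟩
    · exfalso
      rw [hn] at e
      have := hasc (alternatingWord s t n) (mem_alternatingWord s t n) (by
        rw [e, alternatingWord_succ, List.concat_eq_append, wordProd_append]
        simp only [wordProd_cons, wordProd_nil, mul_one, mul_assoc, h.mul_self])
      rw [length_alternatingWord, hn] at this
      omega

/-! #### The chamber is a strict fundamental domain -/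

/-- If right multiplication by `σ s` does not shorten `w`, then `w (α s)` is nonnegative on the
chamber. -/
theorem root_nonneg (h : CoxeterRoots B α σ) {w : V ≃ₗ[ℝ] V}
    (hw : w ∈ Subgroup.closure (Set.range σ)) (s : S)
    (hlen : wordLength σ w ≤ wordLength σ (w * σ s)) :
    ∀ x ∈ chamber B α, 0 ≤ B x (w (α s)) := by
  classical
  induction hn : wordLength σ w using Nat.strong_induction_on generalizing w s with
  | _ n IH =>
  obtain ⟨L, hLw, hLl⟩ := h.exists_reduced_word hw
  rcases List.eq_nil_or_concat L with rfl | ⟨L0, t, rfl⟩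
  · intro x hx
    rw [← hLw]; exact hx s
  rw [List.concat_eq_append] at hLw hLl
  have hmem := wordProd_mem_closure σ
  have hst : s ≠ t := by
    rintro rfl
    have : w * σ s = wordProd σ L0 := by
      rw [← hLw]; simp [mul_assoc, h.mul_self]
    have h2 := wordLength_wordProd_le σ L0
    rw [← this] at h2
    simp at hLl
    omega
  -- With `t` the last letter of a reduced word of `w`, consider the factorizations of `w` into some
  -- `v` and a word in `s`, `t` whose lengths add up, and take `v` shortest. Then neither `s` nor
  -- `t` shortens `v`, so induction applies to `v (α s)` and `v (α t)`, while the dihedral factor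
  -- turns `α s` into a nonnegative combination of `α s` and `α t`. Splitting off `t` shows that `v`
  -- is shorter than `w`.
  let A : ℕ → Prop := fun k => ∃ v ∈ Subgroup.closure (Set.range σ), ∃ M : List S,
    (∀ x ∈ M, x = s ∨ x = t) ∧ v * wordProd σ M = w ∧ wordLength σ v + M.length = wordLength σ w ∧
    wordLength σ v = k
  have hA0 : A (wordLength σ (wordProd σ L0)) := by
    have e : wordProd σ L0 * wordProd σ [t] = w := by rw [← hLw]; simp
    refine ⟨_, hmem L0, [t], by simp, e, ?_, rfl⟩
    have h1 := wordLength_wordProd_le σ L0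
    have h2 := h.wordLength_mul_le (hmem L0) [t]
    rw [e] at h2
    simp at hLl h2 ⊢
    omega
  have hA : ∃ k, A k := ⟨_, hA0⟩
  obtain ⟨v, hv, M, hM, hvM, hl, hvk⟩ := Nat.find_spec hA
  have hmin : ∀ k, A k → wordLength σ v ≤ k := fun k hk => by rw [hvk]; exact Nat.find_min' hA hk
  have hvlt : wordLength σ v < n := by
    have h1 := hmin _ hA0
    have h2 := wordLength_wordProd_le σ L0
    simp at hLl
    omega
  have asc : ∀ x, (x = s ∨ x = t) → wordLength σ v ≤ wordLength σ (v * σ x) := by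
    intro x hx
    by_contra hlt
    push Not at hlt
    have hvx : v * σ x ∈ Subgroup.closure (Set.range σ) :=
      mul_mem hv (Subgroup.subset_closure ⟨x, rfl⟩)
    have e : v * σ x * wordProd σ (x :: M) = w := by
      rw [wordProd_cons, mul_assoc, ← mul_assoc (σ x), h.mul_self, one_mul, hvM]
    have h1 := h.wordLength_mul_le hvx (x :: M)
    rw [e, List.length_cons] at h1
    have := hmin (wordLength σ (v * σ x)) ⟨_, hvx, x :: M, by
      intro y hy
      rcases List.mem_cons.1 hy with rfl | hy
      · exact hx
      · exact hM y hy, e, by rw [List.length_cons]; omega, rfl⟩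
    omega
  have ps := IH _ hvlt hv s (asc s (Or.inl rfl)) rfl
  have pt := IH _ hvlt hv t (asc t (Or.inr rfl)) rfl
  obtain ⟨a, b, ha, hb, e⟩ := h.dihedral_apply_root hst M hM (by
      intro N hN eN
      have := h.wordLength_mul_le hv N
      rw [eN, hvM] at this
      omega) (by
      intro N hN eN
      have := h.wordLength_mul_le hv N
      rw [eN, ← mul_assoc, hvM] at this
      omega)
  intro x hx
  rw [← hvM, LinearEquiv.mul_apply, e]
  simp only [map_add, map_smul, smul_eq_mul]
  exact add_nonneg (mul_nonneg ha (ps x hx)) (mul_nonneg hb (pt x hx))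

/-- Two points of the chamber in the same orbit coincide, and the stabilizer of a point of the
chamber is generated by the reflections in the walls through it. -/
theorem eq_and_mem_stabilizer (h : CoxeterRoots B α σ) {w : V ≃ₗ[ℝ] V}
    (hw : w ∈ Subgroup.closure (Set.range σ)) {x y : V} (hx : x ∈ chamber B α)
    (hy : y ∈ chamber B α) (hxy : w x = y) :
    x = y ∧ w ∈ Subgroup.closure (σ '' {s | B x (α s) = 0}) := by
  induction hn : wordLength σ w using Nat.strong_induction_on generalizing w with
  | _ n IH =>
  obtain ⟨L, hLw, hLl⟩ := h.exists_reduced_word hw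
  rcases List.eq_nil_or_concat L with rfl | ⟨L0, s, rfl⟩
  · rw [wordProd_nil] at hLw
    subst hLw
    exact ⟨hxy, one_mem _⟩
  rw [List.concat_eq_append] at hLw hLl
  have e : w * σ s = wordProd σ L0 := by
    rw [← hLw]; simp [mul_assoc, h.mul_self]
  have e' : w * σ s * σ s = w := by rw [mul_assoc, h.mul_self, mul_one]
  have hlt : wordLength σ (w * σ s) < wordLength σ w := by
    have := wordLength_wordProd_le σ L0
    rw [e]
    simp at hLl
    omega
  have hmem : w * σ s ∈ Subgroup.closure (Set.range σ) := by
    rw [e]; exact wordProd_mem_closure σ L0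
  -- As `s` shortens `w`, the vector `w (α s)` is nonpositive on the chamber. Evaluated at `y = w x`
  -- this gives `B x (α s) ≤ 0`, so `x` lies on the mirror of `s`, and `s` can be removed from `w`
  -- without changing the image of `x`.
  have p := h.root_nonneg hmem s (by rw [e']; exact hlt.le) y hy
  rw [LinearEquiv.mul_apply, h.apply_root, map_neg, map_neg, ← hxy, h.form_mem hw] at p
  have hs : B x (α s) = 0 := le_antisymm (by linarith) (hx s)
  have hfix : σ s x = x := by rw [h.apply, hs]; simp
  obtain ⟨h1, h2⟩ := IH _ (hn ▸ hlt) hmem (by rw [LinearEquiv.mul_apply, hfix, hxy]) rfl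
  refine ⟨h1, ?_⟩
  rw [← e']
  exact mul_mem h2 (Subgroup.subset_closure ⟨s, hs, rfl⟩)

end CoxeterRoots

end Reflections

/-! ### The Minkowski space of the base plane -/

/-- The three-dimensional Minkowski space `ℝ × ℂ`. -/
abbrev Mink : Type := ℝ × ℂ

/-- The Lorentzian form `Re (u ū') - s s'` on `ℝ × ℂ`. -/
noncomputable def mform : LinearMap.BilinForm ℝ Mink :=
  LinearMap.mk₂ ℝ (fun x y => x.2.re * y.2.re + x.2.im * y.2.im - x.1 * y.1)
    (by intros; simp; ring) (by intros; simp; ring) (by intros; simp; ring) (by intros; simp; ring)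

lemma mform_apply (x y : Mink) :
    mform x y = x.2.re * y.2.re + x.2.im * y.2.im - x.1 * y.1 := rfl

lemma mform_symm (x y : Mink) : mform x y = mform y x := by
  simp only [mform_apply]; ring

/-- The reflection in the plane orthogonal to the unit vector `n`. -/
noncomputable def mreflect (n : Mink) (hn : mform n n = 1) : Mink ≃ₗ[ℝ] Mink :=
  Module.reflection (x := n) (f := (2 : ℝ) • mform n) (by simp [hn])

lemma mreflect_apply (n : Mink) (hn : mform n n = 1) (v : Mink) :
    mreflect n hn v = v - (2 * mform v n) • n := by
  simp [mreflect, Module.reflection_apply, mform_symm v n]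

/-- The open cone of forward timelike vectors. -/
def forwardCone : Set Mink := {v | mform v v < 0 ∧ 0 < v.1}

lemma norm_snd_lt {v : Mink} (hv : v ∈ forwardCone) : ‖v.2‖ < v.1 := by
  have h1 := hv.1
  rw [mform_apply] at h1
  have h2 := Complex.sq_norm v.2
  rw [Complex.normSq_apply] at h2
  nlinarith [norm_nonneg v.2, hv.2]

lemma re_mul_add_im_mul_le (a b : ℂ) : a.re * b.re + a.im * b.im ≤ ‖a‖ * ‖b‖ := by
  have h1 := Complex.sq_norm a
  have h2 := Complex.sq_norm b
  rw [Complex.normSq_apply] at h1 h2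
  apply le_of_sq_le_sq _ (by positivity)
  rw [mul_pow, h1, h2]
  nlinarith [sq_nonneg (a.re * b.im - a.im * b.re)]

/-- A quantitative reversed Cauchy–Schwarz inequality. For a forward timelike `v` the factor `v.1 -
‖v.2‖` is positive, so a bound on `-mform v w` bounds the height of `w`; this later gives
compactness. -/
lemma mul_le_neg_mform (v : Mink) {w : Mink} (hw : w ∈ forwardCone) :
    (v.1 - ‖v.2‖) * w.1 ≤ -mform v w := by
  have h1 := re_mul_add_im_mul_le v.2 w.2
  have h2 := norm_snd_lt hw
  rw [mform_apply]
  nlinarith [norm_nonneg v.2]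

lemma mform_neg {v w : Mink} (hv : v ∈ forwardCone) (hw : w ∈ forwardCone) : mform v w < 0 := by
  have h1 := mul_le_neg_mform v hw
  have h2 := mul_pos (sub_pos.2 (norm_snd_lt hv)) hw.2
  linarith

lemma add_mem_forwardCone {v w : Mink} (hv : v ∈ forwardCone) (hw : w ∈ forwardCone) :
    v + w ∈ forwardCone := by
  refine ⟨?_, add_pos hv.2 hw.2⟩
  simp only [map_add, LinearMap.add_apply]
  linarith [hv.1, hw.1, mform_neg hv hw, mform_neg hw hv]

/-- The image `y` is timelike because the form is preserved. It is not backward, since then `mform v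
y` would be positive, whereas it equals `mform v v - 2 (mform v n)²`. -/
lemma reflection_mem_forwardCone {n v : Mink} (hn : mform n n = 1) (hv : v ∈ forwardCone) :
    v - (2 * mform v n) • n ∈ forwardCone := by
  set y := v - (2 * mform v n) • n with hy
  have h1 : mform y y = mform v v := by
    simp only [hy, map_sub, map_smul, LinearMap.sub_apply, LinearMap.smul_apply, smul_eq_mul, hn,
      mform_symm n v]
    ring
  have h2 : mform v y = mform v v - 2 * mform v n ^ 2 := by
    simp only [hy, map_sub, map_smul, smul_eq_mul]
    ring
  have hneg : mform y y < 0 := h1 ▸ hv.1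
  refine ⟨hneg, ?_⟩
  by_contra hle
  push Not at hle
  rcases hle.lt_or_eq with hlt | heq
  · have : -y ∈ forwardCone := ⟨by simpa using hneg, by simpa using hlt⟩
    have := mform_neg hv this
    rw [map_neg, h2] at this
    nlinarith [hv.1, sq_nonneg (mform v n)]
  · rw [mform_apply, heq] at hneg
    nlinarith [sq_nonneg y.2.re, sq_nonneg y.2.im]

lemma word_mem_forwardCone {S : Type*} {α : S → Mink} {σ : S → Mink ≃ₗ[ℝ] Mink}
    (h : CoxeterRoots mform α σ) {w : Mink ≃ₗ[ℝ] Mink}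
    (hw : w ∈ Subgroup.closure (Set.range σ)) {v : Mink} (hv : v ∈ forwardCone) :
    w v ∈ forwardCone := by
  obtain ⟨L, rfl⟩ := h.exists_word hw
  clear hw
  induction L with
  | nil => exact hv
  | cons s L ih =>
    rw [wordProd_cons, LinearEquiv.mul_apply, h.apply]
    exact reflection_mem_forwardCone (h.norm s) ih

/-! ### Discreteness of orbits and reduction to the chamber. -/

lemma gram_det_nonpos (x y z : Mink) :
    mform x x * (mform y y * mform z z - mform y z ^ 2) -
      mform x y * (mform x y * mform z z - mform y z * mform x z) +
      mform x z * (mform x y * mform y z - mform y y * mform x z) ≤ 0 := by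
  have : mform x x * (mform y y * mform z z - mform y z ^ 2) -
      mform x y * (mform x y * mform z z - mform y z * mform x z) +
      mform x z * (mform x y * mform y z - mform y y * mform x z) =
      -(x.1 * (y.2.re * z.2.im - y.2.im * z.2.re) - x.2.re * (y.1 * z.2.im - y.2.im * z.1) +
        x.2.im * (y.1 * z.2.re - y.2.re * z.1)) ^ 2 := by
    simp only [mform_apply]; ring
  rw [this]
  exact neg_nonpos.2 (sq_nonneg _)

lemma mform_self_le_sq_dist (x y : Mink) : mform (x - y) (x - y) ≤ dist x y ^ 2 := by
  have h1 := Complex.sq_norm (x - y).2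
  rw [Complex.normSq_apply] at h1
  have h2 : ‖(x - y).2‖ ≤ ‖x - y‖ := norm_snd_le _
  rw [dist_eq_norm, mform_apply]
  nlinarith [norm_nonneg (x - y).2, sq_nonneg (x - y).1]

/-- Distinct points of the orbit of a unit vector in the open chamber are uniformly separated. -/
lemma orbit_separated {S : Type*} [Finite S] {α : S → Mink} {σ : S → Mink ≃ₗ[ℝ] Mink}
    (h : CoxeterRoots mform α σ) {ρ : Mink} (hρ : ρ ∈ forwardCone) (hρ1 : mform ρ ρ = -1)
    (hpos : ∀ s, 0 < mform ρ (α s)) :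
    ∃ ε : ℝ, 0 < ε ∧ ∀ w ∈ Subgroup.closure (Set.range σ),
      ∀ w' ∈ Subgroup.closure (Set.range σ), w ρ ≠ w' ρ → ε ≤ dist (w ρ) (w' ρ) := by
  -- The factor `3` and the bound `δ ≤ 1` serve the estimate `(1 + δ)² ≤ 1 + 3δ` at the end.
  obtain ⟨δ, hδ0, hδ1, hδ⟩ : ∃ δ : ℝ, 0 < δ ∧ δ ≤ 1 ∧ ∀ s, 3 * δ ≤ mform ρ (α s) ^ 2 := by
    rcases isEmpty_or_nonempty S with hS | hS
    · exact ⟨1, one_pos, le_rfl, fun s => (hS.false s).elim⟩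
    · obtain ⟨s, hs⟩ := Finite.exists_min fun s => mform ρ (α s)
      refine ⟨min 1 (mform ρ (α s) ^ 2 / 3), lt_min one_pos (by have := hpos s; positivity),
        min_le_left _ _, fun t => ?_⟩
      have h1 := min_le_right 1 (mform ρ (α s) ^ 2 / 3)
      have h2 := hs t
      have h3 := hpos s
      nlinarith
  refine ⟨Real.sqrt (2 * δ), by positivity, fun w hw w' hw' hne => ?_⟩
  apply Real.sqrt_le_iff.2 ⟨dist_nonneg, _⟩
  refine le_trans ?_ (mform_self_le_sq_dist _ _)
  have hwinv := inv_mem hw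
  have hz : w⁻¹ * w' ∈ Subgroup.closure (Set.range σ) := mul_mem hwinv hw'
  set z := (w⁻¹ * w') ρ with hzdef
  have hwz : w z = w' ρ := by
    rw [hzdef, ← LinearEquiv.mul_apply, mul_inv_cancel_left]
  have e1 : mform z z = -1 := by rw [hzdef, h.form_mem hz, hρ1]
  have hzf : z ∈ forwardCone := word_mem_forwardCone h hz hρ
  have e2 : mform (w ρ - w' ρ) (w ρ - w' ρ) = -2 - 2 * mform ρ z := by
    rw [← hwz, ← map_sub, h.form_mem hw]
    simp only [map_sub, LinearMap.sub_apply, hρ1, e1, mform_symm z ρ]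
    ring
  rw [e2]
  have hzC : z ∉ chamber mform α := by
    intro hC
    have := (h.eq_and_mem_stabilizer hz (fun s => (hpos s).le) hC rfl).1
    exact hne (by rw [← hwz, ← this])
  obtain ⟨s, hs⟩ : ∃ s, mform z (α s) < 0 := by
    by_contra hcon
    push Not at hcon
    exact hzC hcon
  -- The mirror of `s` separates `ρ` from `z`. Write `a`, `b`, `c` for the products of `ρ` with `α
  -- s`, of `z` with `α s` and of `ρ` with `z`. The Gram determinant gives `c² ≥ 1 + a² + b² +
  -- 2abc`, where `abc ≥ 0` because `a > 0` and `b, c < 0`. Hence `-c ≥ 1 + δ`.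
  have g := gram_det_nonpos ρ z (α s)
  rw [hρ1, e1, h.norm] at g
  have hc := mform_neg hρ hzf
  have hd := hδ s
  have hp := hpos s
  have h3 : 0 ≤ mform ρ (α s) * mform z (α s) * mform ρ z := by
    have := mul_pos hp (mul_pos_of_neg_of_neg hs hc)
    nlinarith
  have h4 : 1 + 3 * δ ≤ mform ρ z ^ 2 := by nlinarith [sq_nonneg (mform z (α s))]
  nlinarith

/-- Every timelike vector can be moved into the chamber of a subset of the reflections by the
group that this subset generates. -/
theorem exists_mem_chamber {S : Type*} [Finite S] {α : S → Mink} {σ : S → Mink ≃ₗ[ℝ] Mink}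
    (h : CoxeterRoots mform α σ) {ρ : Mink} (hρ : ρ ∈ forwardCone) (hρ1 : mform ρ ρ = -1)
    (hpos : ∀ s, 0 < mform ρ (α s)) (I : Set S) {x : Mink} (hx : x ∈ forwardCone) :
    ∃ w ∈ Subgroup.closure (σ '' I), ∀ s ∈ I, 0 ≤ mform (w x) (α s) := by
  obtain ⟨ε, hε, hsep⟩ := orbit_separated h hρ hρ1 hpos
  have hsub : Subgroup.closure (σ '' I) ≤ Subgroup.closure (Set.range σ) :=
    Subgroup.closure_mono (Set.image_subset_range _ _)
  -- The orbit point of `ρ` nearest to `x` is sought, with `-mform x y` in the role of the distance.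
  -- The orbit is closed by separation and the relevant sublevel set is bounded, so a minimum
  -- exists.
  let T : Set Mink := {y | ∃ w ∈ Subgroup.closure (σ '' I), y = w ρ}
  have hTc : IsClosed T := by
    apply Metric.isClosed_of_pairwise_le_dist hε
    rintro _ ⟨w, hw, rfl⟩ _ ⟨w', hw', rfl⟩ hne
    exact hsep w (hsub hw) w' (hsub hw') hne
  have hcont : Continuous fun y : Mink => -mform x y := by
    simp only [mform_apply]; fun_prop
  set κ := x.1 - ‖x.2‖ with hκ
  have hκ0 : 0 < κ := sub_pos.2 (norm_snd_lt hx)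
  set R := -mform x ρ / κ with hR
  have hbound : ∀ y ∈ T, -mform x y ≤ -mform x ρ → ‖y‖ ≤ R := by
    rintro _ ⟨w, hw, rfl⟩ hle
    have hf := word_mem_forwardCone h (hsub hw) hρ
    have h1 := mul_le_neg_mform x hf
    have h2 := norm_snd_lt hf
    have h3 : ‖w ρ‖ ≤ (w ρ).1 := by
      rw [Prod.norm_def]
      exact max_le (by rw [Real.norm_of_nonneg hf.2.le]) h2.le
    rw [hR, le_div_iff₀ hκ0]
    nlinarith
  have hρT : ρ ∈ T := ⟨1, one_mem _, rfl⟩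
  have hK : IsCompact (T ∩ Metric.closedBall 0 R) := by
    rw [Set.inter_comm]; exact (isCompact_closedBall _ _).inter_right hTc
  obtain ⟨y, hy, hymin⟩ := hK.exists_isMinOn
    ⟨ρ, hρT, by simpa using hbound ρ hρT le_rfl⟩ hcont.continuousOn
  have hymin' : ∀ z ∈ T, -mform x y ≤ -mform x z := by
    intro z hz
    rcases le_or_gt (-mform x z) (-mform x ρ) with hle | hgt
    · exact hymin ⟨hz, by simpa using hbound z hz hle⟩
    · exact (hymin ⟨hρT, by simpa using hbound ρ hρT le_rfl⟩ : _).trans hgt.le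
  obtain ⟨w, hw, rfl⟩ := hy.1
  have hwi := h.form_mem (hsub hw)
  refine ⟨w⁻¹, inv_mem hw, fun s hs => ?_⟩
  -- Replacing `ρ` by its mirror image in `s` does not bring it closer to `w⁻¹ x`, so `w⁻¹ x` is on
  -- the same side of the mirror as `ρ`, or on the mirror.
  have h1 := hymin' ((w * σ s) ρ) ⟨w * σ s, mul_mem hw (Subgroup.subset_closure ⟨s, hs, rfl⟩), rfl⟩
  have hxw : x = w (w⁻¹ x) := by rw [← LinearEquiv.mul_apply, mul_inv_cancel]; rfl
  have h2 : mform x (w ρ) = mform (w⁻¹ x) ρ := by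
    conv_lhs => rw [hxw]
    rw [hwi]
  have h3 : mform x ((w * σ s) ρ) =
      mform (w⁻¹ x) ρ - 2 * mform ρ (α s) * mform (w⁻¹ x) (α s) := by
    conv_lhs => rw [hxw]
    rw [LinearEquiv.mul_apply, hwi, h.apply, map_sub, map_smul, smul_eq_mul]
  rw [h2, h3] at h1
  have h4 : 0 ≤ mform ρ (α s) * mform (w⁻¹ x) (α s) := by linarith
  exact nonneg_of_mul_nonneg_right h4 (hpos s)

/-! ### Complex coordinates of the model -/

/-- The real coordinate vector with the complex coordinates `z = x⁰ + i x¹`, `w = x² + i x³`. -/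
def cvec (z w : ℂ) : Fin 4 → ℝ := ![z.re, z.im, w.re, w.im]

lemma cvec_inj {z w z' w' : ℂ} (h : cvec z w = cvec z' w') : z = z' ∧ w = w' := by
  have h0 := congrFun h 0
  have h1 := congrFun h 1
  have h2 := congrFun h 2
  have h3 := congrFun h 3
  simp [cvec] at h0 h1 h2 h3
  exact ⟨Complex.ext h0 h1, Complex.ext h2 h3⟩

lemma smul_cvec (c : ℝ) (z w : ℂ) : c • cvec z w = cvec (c * z) (c * w) := by
  ext i; fin_cases i <;> simp [cvec]

lemma cvec_add (z w z' w' : ℂ) : cvec z w + cvec z' w' = cvec (z + z') (w + w') := by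
  ext i; fin_cases i <;> simp [cvec]

lemma quadForm_cvec (z w : ℂ) :
    quadForm (cvec z w) = Complex.normSq w - Complex.normSq z := by
  simp [quadForm, cvec, Complex.normSq_apply]; ring

lemma cvec_vecMul_transMatrix (z w a c : ℂ) :
    cvec z w ᵥ* transMatrix (cvec a c) =
      cvec (z * a + (starRingEnd ℂ) w * c) ((starRingEnd ℂ) z * c + w * a) := by
  ext i
  fin_cases i <;> simp [cvec, transMatrix, Matrix.vecMul, dotProduct, Fin.sum_univ_four] <;> ring

lemma cvec_vecMul_originRotMatrix (z w : ℂ) (ω : ℝ) :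
    cvec z w ᵥ* originRotMatrix ω = cvec z (Complex.exp (ω * Complex.I) * w) := by
  ext i
  fin_cases i <;> simp [cvec, originRotMatrix, Matrix.vecMul, dotProduct, Fin.sum_univ_four,
    Complex.exp_ofReal_mul_I_re, Complex.exp_ofReal_mul_I_im] <;> ring

lemma transInvMatrix_cvec (a : ℝ) (c : ℂ) :
    transInvMatrix (cvec a c) = transMatrix (cvec a (-c)) := by
  ext i j
  fin_cases i <;> fin_cases j <;> simp [cvec, transMatrix, transInvMatrix]

lemma normSq_lt_one (ζ : Metric.ball (0 : ℂ) 1) : Complex.normSq (ζ : ℂ) < 1 := by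
  have h := mem_ball_zero_iff.1 ζ.2
  rw [← Complex.sq_norm]
  nlinarith [norm_nonneg (ζ : ℂ)]

/-- The factor `cosh r`. -/
noncomputable def coshFactor (ζ : ℂ) : ℝ := (Real.sqrt (1 - Complex.normSq ζ))⁻¹

lemma coshFactor_pos (ζ : Metric.ball (0 : ℂ) 1) : 0 < coshFactor ζ :=
  inv_pos.2 (Real.sqrt_pos.2 (sub_pos.2 (normSq_lt_one ζ)))

lemma coshFactor_sq (ζ : Metric.ball (0 : ℂ) 1) :
    coshFactor ζ ^ 2 * (1 - Complex.normSq (ζ : ℂ)) = 1 := by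
  have h := sub_pos.2 (normSq_lt_one ζ)
  rw [coshFactor, inv_pow, Real.sq_sqrt h.le, inv_mul_cancel₀ h.ne']

@[simp] lemma coshFactor_neg (ζ : ℂ) : coshFactor (-ζ) = coshFactor ζ := by
  simp [coshFactor]

/-- The complex coordinate `x⁰ + i x¹`. -/
noncomputable def zCoord (Z : Space) : ℂ := coshFactor Z.2 * Complex.exp (Z.1 * Complex.I)

/-- The complex coordinate `x² + i x³`. -/
noncomputable def wCoord (Z : Space) : ℂ :=
  coshFactor Z.2 * (Z.2 * Complex.exp (-(Z.1 * Complex.I)))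

lemma modelCoord_eq (Z : Space) : modelCoord Z = cvec (zCoord Z) (wCoord Z) := by
  ext i
  fin_cases i <;> simp [modelCoord, cvec, zCoord, wCoord, coshFactor, Complex.sq_norm,
    Complex.exp_ofReal_mul_I_re, Complex.exp_ofReal_mul_I_im]

lemma normSq_exp_mul_I (x : ℝ) : Complex.normSq (Complex.exp (x * Complex.I)) = 1 := by
  rw [← Complex.sq_norm, Complex.norm_exp_ofReal_mul_I, one_pow]

lemma exp_neg_mul_I (x : ℝ) :
    Complex.exp (-(x * Complex.I)) = (starRingEnd ℂ) (Complex.exp (x * Complex.I)) := by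
  rw [← Complex.exp_conj]; simp

lemma mul_conj_of_normSq {e : ℂ} (h : Complex.normSq e = 1) : e * (starRingEnd ℂ) e = 1 := by
  rw [Complex.mul_conj, h, Complex.ofReal_one]

/-! ### The Minkowski vector of a point of the base plane -/

/-- The quadratic map from complex coordinates to the Minkowski space. -/
noncomputable def hvec (z w : ℂ) : Mink := (Complex.normSq z + Complex.normSq w, 2 * w * z)

/-- The point of the hyperboloid in `ℝ × ℂ` that corresponds to a point of the disc. -/
noncomputable def discVec (ζ : ℂ) : Mink :=
  (coshFactor ζ ^ 2) • ((1 + Complex.normSq ζ, 2 * ζ) : Mink)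

/-- The point of the hyperboloid in `ℝ × ℂ` below a point of the space. -/
noncomputable def baseVec (Z : Space) : Mink := discVec Z.2

/-- The fibre coordinate enters `z` with the phase `exp (iφ)` and `w` with the opposite phase, so it
cancels in `w z` and in the absolute values. -/
lemma hvec_coord (Z : Space) : hvec (zCoord Z) (wCoord Z) = baseVec Z := by
  have h1 := normSq_exp_mul_I Z.1
  have h2 := mul_conj_of_normSq h1
  rw [hvec, baseVec, discVec, zCoord, wCoord, exp_neg_mul_I]
  ext1
  · simp only [map_mul, Complex.normSq_ofReal, Complex.normSq_conj, h1, Prod.smul_fst, smul_eq_mul]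
    ring
  · simp only [Prod.smul_snd, Complex.real_smul]
    push_cast
    linear_combination (2 * (coshFactor Z.2 : ℂ) ^ 2 * Z.2) * h2

lemma hvec_smul (c : ℝ) (z w : ℂ) : hvec (c * z) (c * w) = (c ^ 2) • hvec z w := by
  ext1
  · simp [hvec]; ring
  · simp [hvec]; ring

lemma mform_hvec (z w : ℂ) :
    mform (hvec z w) (hvec z w) = -(Complex.normSq z - Complex.normSq w) ^ 2 := by
  simp [hvec, mform_apply, Complex.normSq_apply]; ring

lemma normSq_coord (Z : Space) :
    Complex.normSq (zCoord Z) - Complex.normSq (wCoord Z) = 1 := by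
  have h1 := normSq_exp_mul_I Z.1
  rw [zCoord, wCoord, exp_neg_mul_I]
  simp only [map_mul, Complex.normSq_ofReal, Complex.normSq_conj, h1]
  linear_combination coshFactor_sq Z.2

lemma mform_baseVec (Z : Space) : mform (baseVec Z) (baseVec Z) = -1 := by
  rw [← hvec_coord, mform_hvec, normSq_coord]; norm_num

lemma baseVec_mem (Z : Space) : baseVec Z ∈ forwardCone := by
  refine ⟨by rw [mform_baseVec]; norm_num, ?_⟩
  have := coshFactor_pos Z.2
  have := Complex.normSq_nonneg (Z.2 : ℂ)
  simp [baseVec, discVec]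
  positivity

/-- Stereographic projection recovers the disc point, as the second component of `baseVec` divided
by the first one plus `1`. -/
lemma baseVec_eq_iff {Y Z : Space} : baseVec Y = baseVec Z ↔ Y.2 = Z.2 := by
  refine ⟨fun h => ?_, fun h => by rw [baseVec, baseVec, h]⟩
  have key : ∀ X : Space, (baseVec X).2 = ((baseVec X).1 + 1 : ℝ) * (X.2 : ℂ) := by
    intro X
    have := coshFactor_sq X.2
    have e : (baseVec X).1 + 1 = 2 * coshFactor X.2 ^ 2 := by
      simp [baseVec, discVec]; linear_combination -this
    rw [e]
    simp [baseVec, discVec]; ring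
  have hy := key Y
  rw [h, key Z] at hy
  have hne : (((baseVec Z).1 + 1 : ℝ) : ℂ) ≠ 0 := by
    have := (baseVec_mem Z).2
    exact_mod_cast (by positivity : (baseVec Z).1 + 1 ≠ 0)
  exact Subtype.ext (mul_left_cancel₀ hne hy).symm

lemma fibre_eq (X : Space) : fibre X = {Z | Z.2 = X.2} := by
  ext Z
  constructor
  · rintro ⟨ψ, rfl⟩; rfl
  · intro h
    exact ⟨Z.1 - X.1, Prod.ext (by simp [fibreTranslation]) h.symm⟩

lemma mem_fibre_iff {X Z : Space} : Z ∈ fibre X ↔ baseVec Z = baseVec X := by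
  rw [fibre_eq, baseVec_eq_iff]; rfl

lemma eq_of_smul_baseVec {Y Z : Space} {c : ℝ} (hc : 0 < c)
    (h : baseVec Y = c • baseVec Z) : baseVec Y = baseVec Z := by
  have h1 := mform_baseVec Y
  rw [h] at h1
  simp only [map_smul, LinearMap.smul_apply, smul_eq_mul, mform_baseVec] at h1
  have : c = 1 := by nlinarith
  rw [h, this, one_smul]

/-- Every vector of the negative cone of the model has a point of the space over it. -/
lemma exists_modelCoord {z w : ℂ} (h : Complex.normSq w < Complex.normSq z) :
    ∃ (W : Space) (c : ℝ), 0 < c ∧ modelCoord W = c • cvec z w := by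
  have hz : z ≠ 0 := by
    rintro rfl
    rw [map_zero] at h
    exact absurd (Complex.normSq_nonneg w) (not_le.2 h)
  have hz' := Complex.normSq_pos.2 hz
  -- Since `z = k exp (iφ)` and `w = k ζ exp (-iφ)` up to scale, the point has `φ = arg z` and `ζ =
  -- w / conj z`.
  have hn : Complex.normSq (w / (starRingEnd ℂ) z) < 1 := by
    rw [map_div₀, Complex.normSq_conj, div_lt_one hz']; exact h
  have hb : w / (starRingEnd ℂ) z ∈ Metric.ball (0 : ℂ) 1 := by
    rw [mem_ball_zero_iff]
    rw [← Complex.sq_norm] at hn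
    nlinarith [norm_nonneg (w / (starRingEnd ℂ) z)]
  let W : Space := (z.arg, ⟨_, hb⟩)
  have hk := coshFactor_pos W.2
  have hnz : 0 < ‖z‖ := norm_pos_iff.2 hz
  have hnz' : (‖z‖ : ℂ) ≠ 0 := by exact_mod_cast hnz.ne'
  have he := Complex.norm_mul_exp_arg_mul_I z
  have hc : (starRingEnd ℂ) z = ‖z‖ * Complex.exp (-(z.arg * Complex.I)) := by
    have := congrArg (starRingEnd ℂ) he
    rw [map_mul, Complex.conj_ofReal] at this
    rw [exp_neg_mul_I, this]
  have hcz : (starRingEnd ℂ) z ≠ 0 := by simpa using hz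
  refine ⟨W, coshFactor W.2 / ‖z‖, by positivity, ?_⟩
  rw [modelCoord_eq, smul_cvec]
  congr 1
  · rw [zCoord]
    push_cast
    rw [div_mul_eq_mul_div, eq_div_iff hnz', mul_assoc]
    congr 1
    rw [mul_comm]
    exact he
  · push_cast
    rw [eq_comm, div_mul_eq_mul_div, div_eq_iff hnz', eq_comm, wCoord, mul_assoc]
    congr 1
    change w / (starRingEnd ℂ) z * Complex.exp (-(z.arg * Complex.I)) * ‖z‖ = w
    rw [mul_assoc, mul_comm _ (‖z‖ : ℂ), ← hc, div_mul_cancel₀ _ hcz]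

/-- Every forward timelike vector is a positive multiple of the vector of a point. -/
lemma exists_baseVec {v : Mink} (hv : v ∈ forwardCone) :
    ∃ (Z : Space) (t : ℝ), 0 < t ∧ baseVec Z = t • v := by
  have h1 := hv.1
  rw [mform_apply] at h1
  set ν := Real.sqrt (-mform v v) with hν
  have hν0 : 0 < ν := Real.sqrt_pos.2 (neg_pos.2 hv.1)
  have hνsq : ν ^ 2 = v.1 ^ 2 - Complex.normSq v.2 := by
    rw [hν, Real.sq_sqrt (neg_pos.2 hv.1).le, mform_apply, Complex.normSq_apply]; ring
  have hs := hv.2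
  have hsν : 0 < v.1 + ν := by positivity
  -- For this `z` and `w`, `hvec z w = 2 (v.1 + ν) • v`, because `ν² = v.1² - |v.2|²`.
  obtain ⟨W, c, hc, hW⟩ := exists_modelCoord (z := ((v.1 + ν : ℝ) : ℂ)) (w := v.2) (by
    rw [Complex.normSq_ofReal]; nlinarith)
  rw [modelCoord_eq, smul_cvec] at hW
  obtain ⟨e1, e2⟩ := cvec_inj hW
  refine ⟨W, c ^ 2 * (2 * (v.1 + ν)), by positivity, ?_⟩
  rw [← hvec_coord, e1, e2, hvec_smul, mul_smul]
  congr 1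
  ext1
  · simp only [hvec, Complex.normSq_ofReal, Prod.smul_fst, smul_eq_mul]
    linear_combination hνsq
  · simp only [hvec, Prod.smul_snd, Complex.real_smul]
    push_cast; ring

/-! ### Side faces over geodesics -/

/-- Over any two points of the base plane there is a straight segment of the model that projects
to the geodesic segment joining them. -/
lemma exists_geodesic_segment (A B : Metric.ball (0 : ℂ) 1) :
    ∃ X ∈ fibre (0, A), ∃ Y ∈ fibre (0, B),
      (∀ t ∈ Set.Icc (0 : ℝ) 1, quadForm ((1 - t) • modelCoord X + t • modelCoord Y) < 0) ∧
      segmentFibres X Y =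
        {Z | ∃ a b : ℝ, 0 ≤ a ∧ 0 ≤ b ∧ baseVec Z = a • discVec A + b • discVec B} := by
  set u : ℂ := 1 - (starRingEnd ℂ) (A : ℂ) * B with hu
  have hu0 : u ≠ 0 := by
    intro h0
    have hA := mem_ball_zero_iff.1 A.2
    have hB := mem_ball_zero_iff.1 B.2
    have : ‖(starRingEnd ℂ) (A : ℂ) * B‖ < 1 := by
      rw [norm_mul, RCLike.norm_conj]
      nlinarith [norm_nonneg (A : ℂ), norm_nonneg (B : ℂ)]
    rw [← sub_eq_zero.1 h0, norm_one] at this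
    exact lt_irrefl _ this
  set D : ℝ := ‖u‖ with hD
  have hD0 : 0 < D := norm_pos_iff.2 hu0
  set kA := coshFactor A with hkA
  set kB := coshFactor B with hkB
  have hA0 : 0 < kA := coshFactor_pos A
  have hB0 : 0 < kB := coshFactor_pos B
  have hA2 := coshFactor_sq A
  have hB2 := coshFactor_sq B
  rw [← hkA] at hA2
  rw [← hkB] at hB2
  set e : ℂ := Complex.exp (u.arg * Complex.I) with he
  have hDe : (D : ℂ) * e = u := Complex.norm_mul_exp_arg_mul_I u
  have he1 : Complex.normSq e = 1 := normSq_exp_mul_I _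
  have hD2 : D ^ 2 = Complex.normSq u := Complex.sq_norm u
  let X : Space := (0, A)
  -- The lift of `B` along its fibre by `arg u` is chosen so that the mixed term of the quadratic
  -- form on the segment is `kA kB |u| > 0` and the mixed term of `hvec` is a positive multiple of
  -- `discVec A + discVec B`. Thus the segment stays in the model and projects into the cone of the
  -- two vectors.
  let Y : Space := (u.arg, B)
  have hX : modelCoord X = cvec kA (kA * A) := by
    rw [modelCoord_eq]; simp [X, zCoord, wCoord, hkA]
  have hY : modelCoord Y = cvec (kB * e) (kB * (B * (starRingEnd ℂ) e)) := by
    rw [modelCoord_eq]; simp only [Y, zCoord, wCoord, exp_neg_mul_I]; rfl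
  let z : ℝ → ℂ := fun t => (1 - t : ℝ) * kA + t * (kB * e)
  let w : ℝ → ℂ := fun t => (1 - t : ℝ) * (kA * A) + t * (kB * (B * (starRingEnd ℂ) e))
  have hseg : ∀ t : ℝ, (1 - t) • modelCoord X + t • modelCoord Y = cvec (z t) (w t) := by
    intro t; rw [hX, hY, smul_cvec, smul_cvec, cvec_add]
  have hur : u.re = 1 - ((A : ℂ).re * (B : ℂ).re + (A : ℂ).im * (B : ℂ).im) := by
    simp [hu]
  have hui : u.im = -((A : ℂ).re * (B : ℂ).im - (A : ℂ).im * (B : ℂ).re) := by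
    simp [hu]; ring
  have her : D * e.re = u.re := by rw [← hDe]; simp
  have hei : D * e.im = u.im := by rw [← hDe]; simp
  have he1' : e.re * e.re + e.im * e.im = 1 := by rw [← Complex.normSq_apply]; exact he1
  have hD2' : D ^ 2 = u.re * u.re + u.im * u.im := by rw [hD2, Complex.normSq_apply]
  rw [Complex.normSq_apply] at hA2 hB2
  set a1 := (A : ℂ).re
  set a2 := (A : ℂ).im
  set b1 := (B : ℂ).re
  set b2 := (B : ℂ).im
  have hq : ∀ t, Complex.normSq (z t) - Complex.normSq (w t) =
      (1 - t) ^ 2 + t ^ 2 + 2 * t * (1 - t) * (kA * kB * D) := by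
    intro t
    have e0 : e.re * u.re + e.im * u.im = D := by
      apply mul_left_cancel₀ hD0.ne'
      rw [← her, ← hei]
      linear_combination D ^ 2 * he1'
    have e1 : e.re * (1 - (a1 * b1 + a2 * b2)) - e.im * (a1 * b2 - a2 * b1) = D := by
      rw [← e0, hur, hui]; ring
    simp [z, w, Complex.normSq_apply]
    linear_combination (1 - t) ^ 2 * hA2 + t ^ 2 * hB2 +
      t ^ 2 * kB ^ 2 * (1 - b1 * b1 - b2 * b2) * he1' + 2 * t * (1 - t) * kA * kB * e1
  set μ := (kA * kB * D)⁻¹ with hμ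
  have hμ0 : 0 < μ := by positivity
  have hv : ∀ t, hvec (z t) (w t) = ((1 - t) ^ 2 + μ * (t * (1 - t))) • discVec A +
      (t ^ 2 + μ * (t * (1 - t))) • discVec B := by
    intro t
    have f1 : D * (2 * e.re - D) = 1 - (a1 * a1 + a2 * a2) * (b1 * b1 + b2 * b2) := by
      have : D * (2 * e.re - D) = 2 * (D * e.re) - D ^ 2 := by ring
      rw [this, her, hD2', hur, hui]; ring
    have f2 : 2 * (kA * kB) * (2 * e.re - D) =
        μ * (kA ^ 2 * (1 + (a1 * a1 + a2 * a2)) + kB ^ 2 * (1 + (b1 * b1 + b2 * b2))) := by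
      rw [hμ, inv_mul_eq_div, eq_div_iff (by positivity)]
      linear_combination 2 * kA ^ 2 * kB ^ 2 * f1 + kA ^ 2 * (1 + (a1 * a1 + a2 * a2)) * hB2 +
        kB ^ 2 * (1 + (b1 * b1 + b2 * b2)) * hA2
    have f3 : e.re + (e.re * (a1 * b1 + a2 * b2) + e.im * (a1 * b2 - a2 * b1)) =
        2 * e.re - D := by
      have e0 : e.re * u.re + e.im * u.im = D := by
        apply mul_left_cancel₀ hD0.ne'
        rw [← her, ← hei]
        linear_combination D ^ 2 * he1'
      rw [← e0, hur, hui]; ring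
    have hA2c : (kA : ℂ) ^ 2 * (1 - A * (starRingEnd ℂ) (A : ℂ)) = 1 := by
      rw [Complex.mul_conj]; exact_mod_cast coshFactor_sq A
    have hB2c : (kB : ℂ) ^ 2 * (1 - B * (starRingEnd ℂ) (B : ℂ)) = 1 := by
      rw [Complex.mul_conj]; exact_mod_cast coshFactor_sq B
    have hDe' : (D : ℂ) * (starRingEnd ℂ) e = (starRingEnd ℂ) u := by rw [← hDe]; simp
    have hee := mul_conj_of_normSq he1
    have hu' : (starRingEnd ℂ) u = 1 - A * (starRingEnd ℂ) (B : ℂ) := by simp [hu]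
    have g1 : (kA : ℂ) * kB * (A * e + B * (starRingEnd ℂ) e) =
        μ * (kA ^ 2 * A + kB ^ 2 * B) := by
      rw [hμ]
      push_cast
      rw [inv_mul_eq_div, eq_div_iff (by exact_mod_cast (by positivity : kA * kB * D ≠ 0))]
      have : (kA : ℂ) * kB * (A * e + B * (starRingEnd ℂ) e) * (kA * kB * D) =
        kA ^ 2 * kB ^ 2 * (A * (D * e) + B * (D * (starRingEnd ℂ) e)) := by ring
      rw [this, hDe, hDe', hu', hu]
      linear_combination (kA : ℂ) ^ 2 * A * hB2c + (kB : ℂ) ^ 2 * B * hA2c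
    ext1
    · simp [z, w, hvec, discVec, Complex.normSq_apply, ← hkA, ← hkB]
      linear_combination t ^ 2 * kB ^ 2 * (1 + b1 * b1 + b2 * b2) * he1' +
        2 * t * (1 - t) * kA * kB * f3 + t * (1 - t) * f2
    · simp only [z, w, hvec, discVec, ← hkA, ← hkB, Prod.snd_add, Prod.smul_snd,
        Complex.real_smul]
      push_cast
      linear_combination 2 * (t : ℂ) ^ 2 * kB ^ 2 * B * hee + 2 * (t : ℂ) * (1 - t) * g1
  have hneg : ∀ t ∈ Set.Icc (0 : ℝ) 1, 0 < Complex.normSq (z t) - Complex.normSq (w t) := by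
    rintro t ⟨h0, h1⟩
    rw [hq]
    have : 0 ≤ 2 * t * (1 - t) * (kA * kB * D) := by
      have := sub_nonneg.2 h1
      positivity
    nlinarith [sq_nonneg (1 - 2 * t)]
  refine ⟨X, mem_fibre_iff.2 rfl, Y, mem_fibre_iff.2 rfl, ?_, ?_⟩
  · intro t ht
    rw [hseg, quadForm_cvec]
    linarith [hneg t ht]
  ext Z
  constructor
  · rintro ⟨t, ⟨h0, h1⟩, W, hW, c, hc, hWc⟩
    rw [hseg, modelCoord_eq, smul_cvec] at hWc
    obtain ⟨e1, e2⟩ := cvec_inj hWc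
    have h1' := sub_nonneg.2 h1
    refine ⟨c ^ 2 * ((1 - t) ^ 2 + μ * (t * (1 - t))), c ^ 2 * (t ^ 2 + μ * (t * (1 - t))),
      by positivity, by positivity, ?_⟩
    rw [← mem_fibre_iff.1 hW, ← hvec_coord, e1, e2, hvec_smul, hv, smul_add, smul_smul, smul_smul]
  · rintro ⟨a, b, ha, hb, hZ⟩
    have hab : 0 < a + b := by
      rcases ha.eq_or_lt with rfl | ha
      · rcases hb.eq_or_lt with rfl | hb
        · have := (baseVec_mem Z).2
          rw [hZ] at this
          simp at this
        · linarith
      · linarith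
    -- By the intermediate value theorem some `t` gives the two coefficients the ratio `a : b`; both
    -- vectors are normalized, so proportionality is enough.
    obtain ⟨t, ht, hft⟩ : (0 : ℝ) ∈ (fun t : ℝ => ((1 - t) ^ 2 + μ * (t * (1 - t))) * b -
        (t ^ 2 + μ * (t * (1 - t))) * a) '' Set.Icc 0 1 := by
      apply intermediate_value_Icc' zero_le_one (by fun_prop)
      constructor <;> simp <;> assumption
    have hlt := sub_pos.1 (hneg t ht)
    obtain ⟨W, c, hc, hW⟩ := exists_modelCoord hlt
    refine ⟨t, ht, W, ?_, c, hc, by rw [hseg, hW]⟩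
    rw [mem_fibre_iff]
    rw [modelCoord_eq, smul_cvec] at hW
    obtain ⟨e1, e2⟩ := cvec_inj hW
    have h1' := sub_nonneg.2 ht.2
    have h0' := ht.1
    set α := (1 - t) ^ 2 + μ * (t * (1 - t)) with hα
    set β := t ^ 2 + μ * (t * (1 - t)) with hβ
    have hαβ : 0 < α + β := by
      have : 0 ≤ μ * (t * (1 - t)) := by positivity
      nlinarith [sq_nonneg (1 - 2 * t)]
    have hprop : α * b = β * a := sub_eq_zero.1 hft
    apply eq_of_smul_baseVec (c := c ^ 2 * ((α + β) / (a + b))) (by positivity)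
    rw [← hvec_coord W, e1, e2, hvec_smul, hv, hZ, mul_smul]
    congr 1
    have hα' : α = (α + β) / (a + b) * a := by
      field_simp; linear_combination hprop
    have hβ' : β = (α + β) / (a + b) * b := by
      field_simp; linear_combination -hprop
    rw [smul_add, smul_smul, smul_smul, ← hα', ← hβ']

/-! ### Translations and rotations -/

/-- Positivity of the real part keeps this factor off the branch cut, so its principal argument is a
continuous fibre shift and lifts the translation to the universal cover. -/
lemma one_add_mul_conj_re_pos (A ζ : Metric.ball (0 : ℂ) 1) :
    0 < (1 + (A : ℂ) * (starRingEnd ℂ) (ζ : ℂ)).re := by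
  have hA := mem_ball_zero_iff.1 A.2
  have hζ := mem_ball_zero_iff.1 ζ.2
  have h1 : ‖(A : ℂ) * (starRingEnd ℂ) (ζ : ℂ)‖ < 1 := by
    rw [norm_mul, RCLike.norm_conj]
    nlinarith [norm_nonneg (A : ℂ), norm_nonneg (ζ : ℂ)]
  have h2 := (abs_le.1 (Complex.abs_re_le_norm ((A : ℂ) * (starRingEnd ℂ) (ζ : ℂ)))).1
  rw [Complex.add_re, Complex.one_re]
  linarith

lemma one_add_mul_conj_ne_zero (A ζ : Metric.ball (0 : ℂ) 1) :
    1 + (A : ℂ) * (starRingEnd ℂ) (ζ : ℂ) ≠ 0 := fun h => by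
  have := one_add_mul_conj_re_pos A ζ
  rw [h] at this
  exact lt_irrefl _ this

lemma normSq_moebius (A ζ : ℂ) :
    Complex.normSq (1 + A * (starRingEnd ℂ) ζ) - Complex.normSq (ζ + A) =
      (1 - Complex.normSq A) * (1 - Complex.normSq ζ) := by
  simp [Complex.normSq_apply]; ring

lemma one_sub_normSq_moebius (A ζ : Metric.ball (0 : ℂ) 1) :
    1 - Complex.normSq (((ζ : ℂ) + A) / (starRingEnd ℂ) (1 + A * (starRingEnd ℂ) (ζ : ℂ))) =
      (1 - Complex.normSq (A : ℂ)) * (1 - Complex.normSq (ζ : ℂ)) /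
        Complex.normSq (1 + A * (starRingEnd ℂ) (ζ : ℂ)) := by
  have h := Complex.normSq_pos.2 (one_add_mul_conj_ne_zero A ζ)
  rw [map_div₀, Complex.normSq_conj, ← normSq_moebius, sub_div, div_self h.ne']

lemma mem_ball_of_normSq_lt {ζ : ℂ} (h : Complex.normSq ζ < 1) : ζ ∈ Metric.ball (0 : ℂ) 1 := by
  rw [mem_ball_zero_iff]
  rw [← Complex.sq_norm] at h
  nlinarith [norm_nonneg ζ]

lemma moebius_mem (A ζ : Metric.ball (0 : ℂ) 1) :
    ((ζ : ℂ) + A) / (starRingEnd ℂ) (1 + A * (starRingEnd ℂ) (ζ : ℂ)) ∈ Metric.ball (0 : ℂ) 1 := by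
  apply mem_ball_of_normSq_lt
  have h := Complex.normSq_pos.2 (one_add_mul_conj_ne_zero A ζ)
  have h1 := sub_pos.2 (normSq_lt_one A)
  have h2 := sub_pos.2 (normSq_lt_one ζ)
  have h3 := one_sub_normSq_moebius A ζ
  have : 0 < (1 - Complex.normSq (A : ℂ)) * (1 - Complex.normSq (ζ : ℂ)) /
        Complex.normSq (1 + A * (starRingEnd ℂ) (ζ : ℂ)) := by positivity
  linarith

/-- The translation of the space that moves the origin to `(0, A)`. -/
noncomputable def translFun (A : Metric.ball (0 : ℂ) 1) (Z : Space) : Space :=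
  (Z.1 + Complex.arg (1 + A * (starRingEnd ℂ) (Z.2 : ℂ)), ⟨_, moebius_mem A Z.2⟩)

lemma continuous_translFun (A : Metric.ball (0 : ℂ) 1) : Continuous (translFun A) := by
  have h1 : Continuous fun Z : Space => 1 + (A : ℂ) * (starRingEnd ℂ) (Z.2 : ℂ) :=
    continuous_const.add (continuous_const.mul
      (Complex.continuous_conj.comp (continuous_subtype_val.comp continuous_snd)))
  apply Continuous.prodMk
  · refine continuous_fst.add (continuous_iff_continuousAt.2 fun Z => ?_)
    exact (Complex.continuousAt_arg (Or.inl (one_add_mul_conj_re_pos A Z.2))).comp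
      (f := fun Z : Space => 1 + (A : ℂ) * (starRingEnd ℂ) (Z.2 : ℂ)) h1.continuousAt
  · refine Continuous.subtype_mk (Continuous.div ?_ (Complex.continuous_conj.comp h1) ?_) _
    · exact (continuous_subtype_val.comp continuous_snd).add continuous_const
    · intro Z
      exact (map_ne_zero _).2 (one_add_mul_conj_ne_zero A Z.2)

lemma translFun_neg_translFun (A : Metric.ball (0 : ℂ) 1) (Z : Space) :
    translFun (-A) (translFun A Z) = Z := by
  set u : ℂ := 1 + A * (starRingEnd ℂ) (Z.2 : ℂ) with hu
  have hu0 : u ≠ 0 := one_add_mul_conj_ne_zero A Z.2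
  have hre : 0 < u.re := one_add_mul_conj_re_pos A Z.2
  have hu0' : (starRingEnd ℂ) u ≠ 0 := by simpa using hu0
  have hA := sub_pos.2 (normSq_lt_one A)
  have hA' : (1 - (A : ℂ) * (starRingEnd ℂ) (A : ℂ)) ≠ 0 := by
    rw [Complex.mul_conj]; exact_mod_cast hA.ne'
  -- The factor of the backward translation is a positive multiple of `u⁻¹`, so the two fibre shifts
  -- are `arg u` and `-arg u`.
  have e1 : 1 + -(A : ℂ) * (starRingEnd ℂ) (((Z.2 : ℂ) + A) / (starRingEnd ℂ) u) =
      ((1 - Complex.normSq (A : ℂ) : ℝ) : ℂ) * u⁻¹ := by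
    push_cast
    rw [map_div₀, Complex.conj_conj, ← Complex.mul_conj, map_add]
    field_simp
    rw [hu]; ring
  apply Prod.ext
  · change Z.1 + Complex.arg u +
      Complex.arg (1 + -(A : ℂ) * (starRingEnd ℂ) (((Z.2 : ℂ) + A) / (starRingEnd ℂ) u)) = Z.1
    rw [e1, Complex.arg_real_mul _ hA, Complex.arg_inv, if_neg]
    · ring
    · intro h
      have := Complex.arg_eq_pi_iff.1 h
      linarith [this.1]
  · apply Subtype.ext
    change (((Z.2 : ℂ) + A) / (starRingEnd ℂ) u + -A) / (starRingEnd ℂ)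
      (1 + -(A : ℂ) * (starRingEnd ℂ) (((Z.2 : ℂ) + A) / (starRingEnd ℂ) u)) = Z.2
    rw [e1, map_mul, Complex.conj_ofReal, map_inv₀]
    push_cast
    rw [← Complex.mul_conj]
    field_simp
    rw [hu]; simp; ring

/-- The translation of the space that moves the origin to `(0, A)`, as a homeomorphism. -/
noncomputable def transl (A : Metric.ball (0 : ℂ) 1) : Space ≃ₜ Space where
  toFun := translFun A
  invFun := translFun (-A)
  left_inv := translFun_neg_translFun A
  right_inv Z := by
    have := translFun_neg_translFun (-A) Z
    rwa [neg_neg] at this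
  continuous_toFun := continuous_translFun A
  continuous_invFun := continuous_translFun (-A)

/-- The new `cosh` factor is the product of the old ones times `‖u‖`; together with the fibre shift
`arg u` this restores `u` itself, which makes the coordinates transform linearly over `ℝ`. -/
lemma coord_translFun (A : Metric.ball (0 : ℂ) 1) (Z : Space) :
    zCoord (translFun A Z) = zCoord Z * coshFactor A +
        (starRingEnd ℂ) (wCoord Z) * (coshFactor A * A) ∧
      wCoord (translFun A Z) = (starRingEnd ℂ) (zCoord Z) * (coshFactor A * A) +
        wCoord Z * coshFactor A := by
  set u : ℂ := 1 + A * (starRingEnd ℂ) (Z.2 : ℂ) with hu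
  have hu0 : u ≠ 0 := one_add_mul_conj_ne_zero A Z.2
  have hu0' : (starRingEnd ℂ) u ≠ 0 := by simpa using hu0
  have hpos := Complex.normSq_pos.2 hu0
  have hk : coshFactor (translFun A Z).2 = coshFactor A * coshFactor Z.2 * ‖u‖ := by
    have e : 1 - Complex.normSq ((translFun A Z).2 : ℂ) = (1 - Complex.normSq (A : ℂ)) *
      (1 - Complex.normSq (Z.2 : ℂ)) / Complex.normSq u := one_sub_normSq_moebius A Z.2
    have h1 := sub_pos.2 (normSq_lt_one A)
    have h2 := sub_pos.2 (normSq_lt_one Z.2)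
    rw [coshFactor, coshFactor, coshFactor, e, Real.sqrt_div (by positivity),
      Real.sqrt_mul h1.le, Complex.norm_def, inv_div, div_eq_mul_inv, mul_inv]
    ring
  have he : ‖u‖ * Complex.exp (u.arg * Complex.I) = u := Complex.norm_mul_exp_arg_mul_I u
  have he' : ‖u‖ * (starRingEnd ℂ) (Complex.exp (u.arg * Complex.I)) = (starRingEnd ℂ) u := by
    have := congrArg (starRingEnd ℂ) he
    rwa [map_mul, Complex.conj_ofReal] at this
  have h1 : ((translFun A Z).1 : ℂ) * Complex.I = Z.1 * Complex.I + u.arg * Complex.I := by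
    simp only [translFun, hu]; push_cast; ring
  have h2 : ((translFun A Z).2 : ℂ) * (starRingEnd ℂ) u = Z.2 + A := by
    change ((Z.2 : ℂ) + A) / (starRingEnd ℂ) u * (starRingEnd ℂ) u = _
    rw [div_mul_cancel₀ _ hu0']
  constructor
  · rw [zCoord, zCoord, wCoord, hk, h1, Complex.exp_add, exp_neg_mul_I]
    simp only [map_mul, Complex.conj_ofReal, Complex.conj_conj]
    push_cast
    linear_combination (coshFactor A : ℂ) * coshFactor Z.2 * Complex.exp (Z.1 * Complex.I) * he +
      (coshFactor A : ℂ) * coshFactor Z.2 * Complex.exp (Z.1 * Complex.I) * hu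
  · rw [zCoord, wCoord, wCoord, hk, exp_neg_mul_I, h1, Complex.exp_add, exp_neg_mul_I]
    simp only [map_mul, Complex.conj_ofReal]
    push_cast
    linear_combination (coshFactor A : ℂ) * coshFactor Z.2 *
      (starRingEnd ℂ) (Complex.exp (Z.1 * Complex.I)) * ((translFun A Z).2 * he' + h2)

/-- The rotation about the fibre line through the origin. -/
noncomputable def originRot (ω : ℝ) : Space ≃ₜ Space where
  toFun Z := (Z.1, ⟨Complex.exp (ω * Complex.I) * Z.2, mem_ball_of_normSq_lt (by
    rw [map_mul, normSq_exp_mul_I, one_mul]; exact normSq_lt_one Z.2)⟩)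
  invFun Z := (Z.1, ⟨Complex.exp ((-ω : ℝ) * Complex.I) * Z.2, mem_ball_of_normSq_lt (by
    rw [map_mul, normSq_exp_mul_I, one_mul]; exact normSq_lt_one Z.2)⟩)
  left_inv Z := Prod.ext rfl (Subtype.ext (by
    simp only [← mul_assoc, ← Complex.exp_add]; simp))
  right_inv Z := Prod.ext rfl (Subtype.ext (by
    simp only [← mul_assoc, ← Complex.exp_add]; simp))
  continuous_toFun := by fun_prop
  continuous_invFun := by fun_prop

lemma coord_originRot (ω : ℝ) (Z : Space) :
    zCoord (originRot ω Z) = zCoord Z ∧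
      wCoord (originRot ω Z) = Complex.exp (ω * Complex.I) * wCoord Z := by
  have hk : coshFactor (originRot ω Z).2 = coshFactor Z.2 := by
    simp [originRot, coshFactor, normSq_exp_mul_I]
  have h2 : ((originRot ω Z).2 : ℂ) = Complex.exp (ω * Complex.I) * Z.2 := rfl
  have h1 : (originRot ω Z).1 = Z.1 := rfl
  constructor
  · rw [zCoord, zCoord, hk, h1]
  · rw [wCoord, wCoord, hk, h1, h2]; ring

/-- The rotation by the angle `ω` about the fibre line through `(0, A)`. -/
noncomputable def rotAbout (A : Metric.ball (0 : ℂ) 1) (ω : ℝ) : Space ≃ₜ Space :=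
  ((transl A).symm.trans (originRot ω)).trans (transl A)

lemma rotAbout_apply (A : Metric.ball (0 : ℂ) 1) (ω : ℝ) (Z : Space) :
    rotAbout A ω Z = translFun A (originRot ω (translFun (-A) Z)) := rfl

lemma rotAbout_inv (A : Metric.ball (0 : ℂ) 1) (ω : ℝ) :
    (rotAbout A ω)⁻¹ = rotAbout A (-ω) := by
  have : (originRot ω).symm = originRot (-ω) := by
    ext Z
    · rfl
    · rfl
  change (rotAbout A ω).symm = _
  rw [rotAbout, rotAbout, ← this]
  rfl

lemma modelCoord_base (A : Metric.ball (0 : ℂ) 1) :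
    modelCoord (0, A) = cvec (coshFactor A) (coshFactor A * A) := by
  rw [modelCoord_eq]; simp [zCoord, wCoord]

lemma modelCoord_translFun (A : Metric.ball (0 : ℂ) 1) (Z : Space) :
    modelCoord (translFun A Z) = modelCoord Z ᵥ* transMatrix (modelCoord (0, A)) := by
  rw [modelCoord_eq, modelCoord_eq, modelCoord_base, cvec_vecMul_transMatrix,
    (coord_translFun A Z).1, (coord_translFun A Z).2]

lemma transInvMatrix_base (A : Metric.ball (0 : ℂ) 1) :
    transInvMatrix (modelCoord (0, A)) = transMatrix (modelCoord (0, -A)) := by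
  rw [modelCoord_base, modelCoord_base, transInvMatrix_cvec]
  simp

lemma covers_rotAbout (A : Metric.ball (0 : ℂ) 1) (ω : ℝ) :
    Covers (rotAbout A ω) (rotMatrix (modelCoord (0, A)) ω) := by
  intro Y
  rw [rotAbout_apply, modelCoord_translFun, modelCoord_eq (originRot _ _), (coord_originRot _ _).1,
    (coord_originRot _ _).2, ← cvec_vecMul_originRotMatrix, ← modelCoord_eq, modelCoord_translFun,
    rotMatrix, transInvMatrix_base, Matrix.vecMul_vecMul, Matrix.vecMul_vecMul, Matrix.mul_assoc]

lemma isRotation_rotAbout (A : Metric.ball (0 : ℂ) 1) (ω : ℝ) :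
    IsRotation (0, A) ω (rotAbout A ω) := by
  refine ⟨covers_rotAbout A ω, fun Y hY => ?_⟩
  rw [fibre_eq] at hY
  have h1 : ((translFun (-A) Y).2 : ℂ) = 0 := by
    change ((Y.2 : ℂ) + ((-A : Metric.ball (0 : ℂ) 1) : ℂ)) / _ = 0
    rw [show Y.2 = A from hY]
    simp
  have h2 : originRot ω (translFun (-A) Y) = translFun (-A) Y :=
    Prod.ext rfl (Subtype.ext (by
      change Complex.exp (ω * Complex.I) * ((translFun (-A) Y).2 : ℂ) = _
      rw [h1, mul_zero]))
  rw [rotAbout_apply, h2]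
  exact (transl A).apply_symm_apply Y

/-! ### Isometries -/

/-- The isometry matrices with the upper signs. -/
def IsUpperMatrix (a : Matrix (Fin 4) (Fin 4) ℝ) : Prop :=
  (a 1 0 = -a 0 1 ∧ a 1 1 = a 0 0 ∧ a 1 2 = a 0 3 ∧ a 1 3 = -a 0 2 ∧
    a 3 0 = a 2 1 ∧ a 3 1 = -a 2 0 ∧ a 3 2 = -a 2 3 ∧ a 3 3 = a 2 2) ∧
  -(a 0 0) ^ 2 - (a 0 1) ^ 2 + (a 0 2) ^ 2 + (a 0 3) ^ 2 = -1 ∧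
  -(a 2 0) ^ 2 - (a 2 1) ^ 2 + (a 2 2) ^ 2 + (a 2 3) ^ 2 = 1 ∧
  -(a 0 0 * a 2 0) - a 0 1 * a 2 1 + a 0 2 * a 2 2 + a 0 3 * a 2 3 = 0 ∧
  -(a 0 0 * a 2 1) + a 0 1 * a 2 0 - a 0 2 * a 2 3 + a 0 3 * a 2 2 = 0

lemma IsUpperMatrix.isIsometryMatrix {a : Matrix (Fin 4) (Fin 4) ℝ} (h : IsUpperMatrix a) :
    IsIsometryMatrix a :=
  ⟨⟨1, Or.inl rfl, by simpa only [neg_mul, one_mul] using h.1⟩, h.2⟩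

/-- Each quadratic relation of the product is a combination of the four relations of `b`, weighted
by entries of `a`, plus the same relation of `a`. Upper signs suffice for translations and
rotations. -/
lemma IsUpperMatrix.mul {a b : Matrix (Fin 4) (Fin 4) ℝ} (ha : IsUpperMatrix a)
    (hb : IsUpperMatrix b) : IsUpperMatrix (a * b) := by
  obtain ⟨⟨a10, a11, a12, a13, a30, a31, a32, a33⟩, ha1, ha2, ha3, ha4⟩ := ha
  obtain ⟨⟨b10, b11, b12, b13, b30, b31, b32, b33⟩, hb1, hb2, hb3, hb4⟩ := hb
  simp only [IsUpperMatrix, Matrix.mul_apply, Fin.sum_univ_four, a10, a11, a12, a13, a30, a31, a32,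
    a33, b10, b11, b12, b13, b30, b31, b32, b33]
  refine ⟨⟨by ring, by ring, by ring, by ring, by ring, by ring, by ring, by ring⟩, ?_, ?_, ?_, ?_⟩
  · linear_combination (a 0 0 ^ 2 + a 0 1 ^ 2) * hb1 + (a 0 2 ^ 2 + a 0 3 ^ 2) * hb2 +
      2 * (a 0 0 * a 0 2 - a 0 1 * a 0 3) * hb3 + 2 * (a 0 0 * a 0 3 + a 0 1 * a 0 2) * hb4 + ha1
  · linear_combination (a 2 0 ^ 2 + a 2 1 ^ 2) * hb1 + (a 2 2 ^ 2 + a 2 3 ^ 2) * hb2 +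
      2 * (a 2 0 * a 2 2 - a 2 1 * a 2 3) * hb3 + 2 * (a 2 0 * a 2 3 + a 2 1 * a 2 2) * hb4 + ha2
  · linear_combination (a 0 0 * a 2 0 + a 0 1 * a 2 1) * hb1 +
      (a 0 2 * a 2 2 + a 0 3 * a 2 3) * hb2 +
      (a 0 0 * a 2 2 + a 0 2 * a 2 0 - a 0 1 * a 2 3 - a 0 3 * a 2 1) * hb3 +
      (a 0 0 * a 2 3 + a 0 3 * a 2 0 + a 0 1 * a 2 2 + a 0 2 * a 2 1) * hb4 + ha3
  · linear_combination (a 0 0 * a 2 1 - a 0 1 * a 2 0) * hb1 +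
      (-(a 0 2 * a 2 3) + a 0 3 * a 2 2) * hb2 +
      (-(a 0 0 * a 2 3) + a 0 2 * a 2 1 - a 0 1 * a 2 2 + a 0 3 * a 2 0) * hb3 +
      (a 0 0 * a 2 2 + a 0 3 * a 2 1 - a 0 1 * a 2 3 - a 0 2 * a 2 0) * hb4 + ha4

lemma isUpperMatrix_transMatrix {x : Fin 4 → ℝ} (hx : quadForm x = -1) :
    IsUpperMatrix (transMatrix x) := by
  rw [quadForm] at hx
  simp only [IsUpperMatrix, transMatrix]
  simp
  refine ⟨?_, ?_, ?_, ?_⟩ <;> linarith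

lemma isUpperMatrix_originRotMatrix (ω : ℝ) : IsUpperMatrix (originRotMatrix ω) := by
  simp [IsUpperMatrix, originRotMatrix]

lemma quadForm_modelCoord (Z : Space) : quadForm (modelCoord Z) = -1 := by
  rw [modelCoord_eq, quadForm_cvec]; linarith [normSq_coord Z]

lemma isUpperMatrix_rotMatrix (A : Metric.ball (0 : ℂ) 1) (ω : ℝ) :
    IsUpperMatrix (rotMatrix (modelCoord (0, A)) ω) := by
  rw [rotMatrix, transInvMatrix_base]
  exact ((isUpperMatrix_transMatrix (quadForm_modelCoord _)).mul
    (isUpperMatrix_originRotMatrix ω)).mul (isUpperMatrix_transMatrix (quadForm_modelCoord _))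

/-- The elements of the group generated by rotations are isometries. -/
lemma isIsometry_of_mem_closure {ι : Type*} (A : ι → Metric.ball (0 : ℂ) 1) (ω : ℝ)
    {g : Space ≃ₜ Space}
    (hg : g ∈ Subgroup.closure (Set.range fun i => rotAbout (A i) ω)) : IsIsometry g := by
  -- Carrying `g⁻¹` along avoids inverting matrices: the inverse of a generating rotation is the
  -- rotation by `-ω`.
  suffices h : (∃ a, IsUpperMatrix a ∧ Covers g a) ∧ ∃ a, IsUpperMatrix a ∧ Covers g⁻¹ a by
    obtain ⟨⟨a, ha, hc⟩, -⟩ := h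
    exact ⟨a, ha.isIsometryMatrix, hc⟩
  have one : ∃ a, IsUpperMatrix a ∧ Covers 1 a :=
    ⟨1, by simp [IsUpperMatrix], fun Y => by rw [Matrix.vecMul_one]; rfl⟩
  have mul : ∀ g h : Space ≃ₜ Space, (∃ a, IsUpperMatrix a ∧ Covers g a) →
      (∃ a, IsUpperMatrix a ∧ Covers h a) → ∃ a, IsUpperMatrix a ∧ Covers (g * h) a := by
    rintro g h ⟨a, ha, hga⟩ ⟨b, hb, hhb⟩
    refine ⟨b * a, hb.mul ha, fun Y => ?_⟩
    rw [← Matrix.vecMul_vecMul, ← hhb, ← hga]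
    rfl
  induction hg using Subgroup.closure_induction with
  | mem g hg =>
    obtain ⟨i, rfl⟩ := hg
    refine ⟨⟨_, isUpperMatrix_rotMatrix (A i) ω, covers_rotAbout _ _⟩, ?_⟩
    dsimp only
    rw [rotAbout_inv]
    exact ⟨_, isUpperMatrix_rotMatrix (A i) (-ω), covers_rotAbout _ _⟩
  | one => exact ⟨one, by rw [inv_one]; exact one⟩
  | mul g h _ _ hg hh => exact ⟨mul _ _ hg.1 hh.1, by rw [mul_inv_rev]; exact mul _ _ hh.2 hg.2⟩
  | inv g _ hg => exact ⟨hg.2, by rw [inv_inv]; exact hg.1⟩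

/-! ### The action on the Minkowski space -/

/-- The linear action of the translation to `A`, up to the factor `1 - |A|²`. -/
noncomputable def mtransl (A : ℂ) : Mink →ₗ[ℝ] Mink where
  toFun v := ((1 + Complex.normSq A) * v.1 + 2 * (v.2 * (starRingEnd ℂ) A).re,
    2 * A * v.1 + v.2 + A ^ 2 * (starRingEnd ℂ) v.2)
  map_add' v w := by
    ext1
    · simp; ring
    · simp; ring
  map_smul' c v := by
    ext1
    · simp; ring
    · simp; ring

lemma mform_mtransl (A : ℂ) (v w : Mink) :
    mform (mtransl A v) (mtransl A w) = (1 - Complex.normSq A) ^ 2 * mform v w := by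
  simp [mtransl, mform_apply, Complex.normSq_apply, pow_two]
  ring

/-- This is the passage from `SU(1,1)` to the Lorentz group: a linear substitution in `z`, `w` and
their conjugates acts linearly on the quadratic expressions in `hvec`. -/
lemma baseVec_translFun (A : Metric.ball (0 : ℂ) 1) (Z : Space) :
    baseVec (translFun A Z) = coshFactor A ^ 2 • mtransl A (baseVec Z) := by
  rw [← hvec_coord, ← hvec_coord, (coord_translFun A Z).1, (coord_translFun A Z).2]
  generalize zCoord Z = z
  generalize wCoord Z = w
  generalize coshFactor A = k
  have h1 := Complex.mul_conj z
  have h2 := Complex.mul_conj w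
  ext1
  · simp [hvec, mtransl, Complex.normSq_apply]; ring
  · simp only [hvec, mtransl, LinearMap.coe_mk, AddHom.coe_mk, Prod.smul_snd, Complex.real_smul]
    push_cast
    simp only [map_mul, Complex.conj_ofNat, ← h1, ← h2]
    ring

lemma baseVec_originRot (ω : ℝ) (Z : Space) :
    baseVec (originRot ω Z) = ((baseVec Z).1, Complex.exp (ω * Complex.I) * (baseVec Z).2) := by
  rw [← hvec_coord, ← hvec_coord, (coord_originRot ω Z).1, (coord_originRot ω Z).2]
  ext1
  · simp [hvec, normSq_exp_mul_I]
  · simp only [hvec]; ring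

/-- The reflection in a plane through the vertical axis. -/
lemma reflect_axis {g : ℂ} (hg : Complex.normSq g = 1) (w : Mink) :
    w - (2 * mform w (0, g)) • ((0, g) : Mink) = (w.1, -(g ^ 2 * (starRingEnd ℂ) w.2)) := by
  have hg' := mul_conj_of_normSq hg
  have e1 : ((2 * mform w (0, g) : ℝ) : ℂ) =
      w.2 * (starRingEnd ℂ) g + (starRingEnd ℂ) w.2 * g := by
    apply Complex.ext
    · simp [mform_apply]; ring
    · simp; ring
  ext1
  · simp
  · simp only [Prod.snd_sub, Prod.smul_snd, Complex.real_smul, e1]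
    linear_combination -w.2 * hg'

/-- Two successive reflections in planes through the vertical axis. -/
lemma reflect_reflect_axis {e f : ℂ} (he : Complex.normSq e = 1) (hf : Complex.normSq f = 1)
    (v : Mink) (v' : Mink) (hv' : v' = v - (2 * mform v (0, e)) • ((0, e) : Mink)) :
    v' - (2 * mform v' (0, f)) • ((0, f) : Mink) =
      (v.1, (f * (starRingEnd ℂ) e) ^ 2 * v.2) := by
  rw [hv', reflect_axis he, reflect_axis hf]
  ext1
  · rfl
  · simp; ring

/-- The rotation about `A` acts on the Minkowski space as the product of two reflections. -/
lemma baseVec_rotAbout (A : Metric.ball (0 : ℂ) 1) {e f : ℂ} (he : Complex.normSq e = 1)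
    (hf : Complex.normSq f = 1) {ω : ℝ}
    (hω : (f * (starRingEnd ℂ) e) ^ 2 = Complex.exp (ω * Complex.I)) {n γ : Mink}
    (hn : n = coshFactor A ^ 2 • mtransl A (0, e)) (hγ : γ = coshFactor A ^ 2 • mtransl A (0, f))
    (hn1 : mform n n = 1) (hγ1 : mform γ γ = 1) (Z : Space) :
    baseVec (rotAbout A ω Z) = mreflect γ hγ1 (mreflect n hn1 (baseVec Z)) := by
  have hk := coshFactor_sq A
  -- `T` is a Lorentz isometry because `coshFactor A ^ 2 * (1 - |A|²) = 1`. Conjugation by it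
  -- reduces the claim to the vertical axis, where a rotation is a product of two reflections.
  set T : Mink →ₗ[ℝ] Mink := coshFactor A ^ 2 • mtransl A with hT
  have hTapp : ∀ v, T v = coshFactor A ^ 2 • mtransl A v := fun v => rfl
  have hform : ∀ v w, mform (T v) (T w) = mform v w := by
    intro v w
    simp only [hTapp, map_smul, LinearMap.smul_apply, smul_eq_mul, mform_mtransl]
    have : coshFactor A ^ 2 * (coshFactor A ^ 2 * ((1 - Complex.normSq (A : ℂ)) ^ 2 * mform v w)) =
      (coshFactor A ^ 2 * (1 - Complex.normSq (A : ℂ))) ^ 2 * mform v w := by ring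
    rw [this, hk]; ring
  rw [← hTapp] at hn hγ
  have hZ : Z = translFun A (translFun (-A) Z) := ((transl A).apply_symm_apply Z).symm
  set Y := translFun (-A) Z with hY
  rw [rotAbout_apply, ← hY, baseVec_translFun, ← hTapp, baseVec_originRot, ← hω]
  conv_rhs => rw [hZ, baseVec_translFun, ← hTapp]
  rw [← reflect_reflect_axis he hf (baseVec Y) _ rfl, mreflect_apply, mreflect_apply, hn, hγ]
  simp only [map_sub, map_smul, hform, LinearMap.sub_apply, LinearMap.smul_apply]

/-! ### The regular polygon -/

/-- The relations between the vertex parameter `x`, half the vertex angle `η`, and the hyperbolic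
sine `sh` and cosine `ch` of the inradius of a regular hyperbolic `p`-gon. -/
structure IsRegularPolygon (p : ℕ) (η x sh ch : ℝ) : Prop where
  three_le : 3 ≤ p
  x_pos : 0 < x
  x_lt_one : x < 1
  angle_pos : 0 < η
  angle_lt : η < Real.pi / 2
  ch_mul_sin : ch * Real.sin (Real.pi / p) = Real.cos η
  ch_mul_cos : ch * Real.cos (Real.pi / p) * (1 - x ^ 2) = Real.sin η * (1 + x ^ 2)
  sh_mul : sh * (1 - x ^ 2) = 2 * x * Real.sin η

section Polygon

variable {p : ℕ} {η x sh ch : ℝ}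

namespace IsRegularPolygon

lemma sq_lt (h : IsRegularPolygon p η x sh ch) : 0 < 1 - x ^ 2 := by
  nlinarith [h.x_pos, h.x_lt_one]

lemma p_pos (h : IsRegularPolygon p η x sh ch) : (0 : ℝ) < p := by
  have := h.three_le
  exact_mod_cast (by omega : 0 < p)

lemma theta_pos (h : IsRegularPolygon p η x sh ch) : 0 < Real.pi / p :=
  div_pos Real.pi_pos h.p_pos

lemma theta_lt (h : IsRegularPolygon p η x sh ch) : Real.pi / p < Real.pi / 2 := by
  have : (3 : ℝ) ≤ p := by exact_mod_cast h.three_le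
  exact div_lt_div_of_pos_left Real.pi_pos two_pos (by linarith)

lemma sin_pos (h : IsRegularPolygon p η x sh ch) : 0 < Real.sin (Real.pi / p) :=
  Real.sin_pos_of_pos_of_lt_pi h.theta_pos (by linarith [h.theta_lt, Real.pi_pos])

lemma cos_pos (h : IsRegularPolygon p η x sh ch) : 0 < Real.cos (Real.pi / p) :=
  Real.cos_pos_of_mem_Ioo ⟨by linarith [h.theta_pos, Real.pi_pos], h.theta_lt⟩

lemma sin_angle_pos (h : IsRegularPolygon p η x sh ch) : 0 < Real.sin η :=
  Real.sin_pos_of_pos_of_lt_pi h.angle_pos (by linarith [h.angle_lt, Real.pi_pos])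

lemma cos_angle_pos (h : IsRegularPolygon p η x sh ch) : 0 < Real.cos η :=
  Real.cos_pos_of_mem_Ioo ⟨by linarith [h.angle_pos, Real.pi_pos], h.angle_lt⟩

lemma sh_pos (h : IsRegularPolygon p η x sh ch) : 0 < sh := by
  have h1 := h.sq_lt
  have h2 : 0 < sh * (1 - x ^ 2) := by
    rw [h.sh_mul]; have := h.x_pos; have := h.sin_angle_pos; positivity
  exact pos_of_mul_pos_left h2 h1.le

lemma ch_pos (h : IsRegularPolygon p η x sh ch) : 0 < ch := by
  have h2 : 0 < ch * Real.sin (Real.pi / p) := by rw [h.ch_mul_sin]; exact h.cos_angle_pos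
  exact pos_of_mul_pos_left h2 h.sin_pos.le

/-- The squares of the three relations combine through `(1 + x²)² - (1 - x²)² = 4x²`. This makes the
side normals unit vectors. -/
lemma ch_sq_sub (h : IsRegularPolygon p η x sh ch) : ch ^ 2 - sh ^ 2 = 1 := by
  have h1 := h.sq_lt
  apply mul_right_cancel₀ (pow_ne_zero 2 h1.ne')
  have e1 := congrArg (· ^ 2) h.ch_mul_sin
  have e2 := congrArg (· ^ 2) h.ch_mul_cos
  have e3 := congrArg (· ^ 2) h.sh_mul
  have s1 := Real.sin_sq_add_cos_sq (Real.pi / p)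
  have s2 := Real.sin_sq_add_cos_sq η
  linear_combination (1 - x ^ 2) ^ 2 * e1 + e2 - e3 + (1 - x ^ 2) ^ 2 * s2 -
    ch ^ 2 * (1 - x ^ 2) ^ 2 * s1

lemma sh_mul_add (h : IsRegularPolygon p η x sh ch) :
    sh * (1 + x ^ 2) = 2 * x * (ch * Real.cos (Real.pi / p)) := by
  apply mul_right_cancel₀ h.sq_lt.ne'
  linear_combination (1 + x ^ 2) * h.sh_mul - 2 * x * h.ch_mul_cos

end IsRegularPolygon

/-- The unit direction to the midpoint of the side `0`. -/
noncomputable def midDir (p : ℕ) : ℂ :=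
  Real.sin (Real.pi / p) + Real.cos (Real.pi / p) * Complex.I

lemma normSq_midDir : Complex.normSq (midDir p) = 1 := by
  have := Real.sin_sq_add_cos_sq (Real.pi / p)
  rw [midDir]
  generalize Real.sin (Real.pi / p) = S at this ⊢
  generalize Real.cos (Real.pi / p) = C at this ⊢
  simp [Complex.normSq_apply]
  linarith

/-! ### Side normals, vertices and the cone over the polygon. -/

variable [NeZero p]

/-- The unit complex number `exp (- 2 π i k / p)`. -/
noncomputable def unitDir (k : ZMod p) : ℂ := ZMod.stdAddChar (-k)

lemma unitDir_add (j k : ZMod p) : unitDir (j + k) = unitDir j * unitDir k := by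
  rw [unitDir, neg_add, AddChar.map_add_eq_mul]; rfl

@[simp] lemma unitDir_zero : unitDir (0 : ZMod p) = 1 := by simp [unitDir]

lemma unitDir_intCast (k : ℤ) :
    unitDir (k : ZMod p) = Complex.exp ((-(2 * (k * (Real.pi / p))) : ℝ) * Complex.I) := by
  rw [unitDir, ← Int.cast_neg, ZMod.stdAddChar_coe]
  congr 1
  push_cast; ring

lemma unitDir_eq (k : ZMod p) :
    unitDir k = Complex.exp ((-(2 * (k.val * (Real.pi / p))) : ℝ) * Complex.I) := by
  have := unitDir_intCast (p := p) (k.val : ℤ)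
  rw [Int.cast_natCast, ZMod.natCast_zmod_val] at this
  rw [this]; simp

lemma normSq_unitDir (k : ZMod p) : Complex.normSq (unitDir k) = 1 := by
  rw [unitDir_eq, normSq_exp_mul_I]

lemma unitDir_neg (k : ZMod p) : unitDir (-k) = (starRingEnd ℂ) (unitDir k) := by
  have h1 := mul_conj_of_normSq (normSq_unitDir k)
  have h2 : unitDir k * unitDir (-k) = 1 := by rw [← unitDir_add]; simp
  have h0 : unitDir k ≠ 0 := left_ne_zero_of_mul_eq_one h1
  exact mul_left_cancel₀ h0 (h2.trans h1.symm)

lemma unitDir_one : unitDir (1 : ZMod p) =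
    (Real.cos (Real.pi / p) - Real.sin (Real.pi / p) * Complex.I) ^ 2 := by
  have := unitDir_intCast (p := p) 1
  rw [Int.cast_one] at this
  have e : ((Real.cos (Real.pi / p) - Real.sin (Real.pi / p) * Complex.I : ℂ)) =
      Complex.exp ((-(Real.pi / p) : ℝ) * Complex.I) := by
    rw [Complex.exp_mul_I, ← Complex.ofReal_cos, ← Complex.ofReal_sin, Real.cos_neg, Real.sin_neg]
    push_cast; ring
  rw [this, e, ← Complex.exp_nat_mul]
  congr 1
  push_cast; ring

lemma normSq_unitDir_mul_midDir (k : ZMod p) : Complex.normSq (unitDir k * midDir p) = 1 := by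
  rw [map_mul, normSq_unitDir, normSq_midDir, one_mul]

/-- The inner unit normal of the side `k`. -/
noncomputable def sideNormal (sh ch : ℝ) (k : ZMod p) : Mink :=
  (-sh, -(ch * (unitDir k * midDir p)))

/-- The coordinate of a complex number in the frame of the side `k`. -/
noncomputable def sideFrame (k : ZMod p) (u : ℂ) : ℂ := u * (starRingEnd ℂ) (unitDir k * midDir p)

lemma eq_sideFrame_mul (k : ZMod p) (u : ℂ) : u = sideFrame k u * (unitDir k * midDir p) := by
  have := mul_conj_of_normSq (normSq_unitDir_mul_midDir k)
  rw [sideFrame]; linear_combination -u * this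

lemma mform_sideNormal (k : ZMod p) (v : Mink) :
    mform v (sideNormal sh ch k) = sh * v.1 - ch * (sideFrame k v.2).re := by
  simp [mform_apply, sideNormal, sideFrame]; ring

lemma mform_sideNormal_self (h : IsRegularPolygon p η x sh ch) (k : ZMod p) :
    mform (sideNormal sh ch k) (sideNormal sh ch k) = 1 := by
  have e : sideFrame k (sideNormal sh ch k).2 = -ch := by
    have := mul_conj_of_normSq (normSq_unitDir_mul_midDir k)
    simp only [sideFrame, sideNormal]
    linear_combination -(ch : ℂ) * this
  rw [mform_sideNormal, e]
  simp only [sideNormal, Complex.neg_re, Complex.ofReal_re]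
  linear_combination h.ch_sq_sub

lemma sideFrame_add_one (k : ZMod p) (u : ℂ) :
    (sideFrame (k + 1) u).re = (sideFrame k u).re *
        (Real.cos (Real.pi / p) ^ 2 - Real.sin (Real.pi / p) ^ 2) -
      (sideFrame k u).im * (2 * Real.sin (Real.pi / p) * Real.cos (Real.pi / p)) := by
  have : sideFrame (k + 1) u = sideFrame k u *
      (Real.cos (Real.pi / p) + Real.sin (Real.pi / p) * Complex.I) ^ 2 := by
    rw [sideFrame, unitDir_add, unitDir_one, sideFrame]
    simp only [map_mul, map_pow, map_sub, Complex.conj_ofReal, Complex.conj_I]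
    ring
  rw [this]
  generalize Real.sin (Real.pi / p) = S
  generalize Real.cos (Real.pi / p) = C
  simp only [pow_two, Complex.mul_re, Complex.mul_im, Complex.add_re, Complex.add_im,
    Complex.ofReal_re, Complex.ofReal_im, Complex.I_re, Complex.I_im]
  ring

lemma sideFrame_sub_one (k : ZMod p) (u : ℂ) :
    (sideFrame (k - 1) u).re = (sideFrame k u).re *
        (Real.cos (Real.pi / p) ^ 2 - Real.sin (Real.pi / p) ^ 2) +
      (sideFrame k u).im * (2 * Real.sin (Real.pi / p) * Real.cos (Real.pi / p)) := by
  have : sideFrame (k - 1) u = sideFrame k u *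
      (Real.cos (Real.pi / p) - Real.sin (Real.pi / p) * Complex.I) ^ 2 := by
    rw [sideFrame, sub_eq_add_neg, unitDir_add, unitDir_neg, unitDir_one, sideFrame]
    simp only [map_mul, Complex.conj_conj]
    ring
  rw [this]
  generalize Real.sin (Real.pi / p) = S
  generalize Real.cos (Real.pi / p) = C
  simp only [pow_two, Complex.mul_re, Complex.mul_im, Complex.sub_re, Complex.sub_im,
    Complex.ofReal_re, Complex.ofReal_im, Complex.I_re, Complex.I_im]
  ring

/-- The Minkowski vector of the vertex `k`. -/
noncomputable def vertexVec (x : ℝ) (k : ZMod p) : Mink := discVec (Complex.I * x * unitDir k)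

lemma normSq_vertex (k : ZMod p) : Complex.normSq (Complex.I * x * unitDir k) = x ^ 2 := by
  simp [normSq_unitDir]; ring

lemma vertexVec_eq (hx : x ^ 2 < 1) (k : ZMod p) : vertexVec x k =
    ((1 - x ^ 2)⁻¹ * (1 + x ^ 2), ((1 - x ^ 2)⁻¹ : ℝ) * (2 * (Complex.I * x * unitDir k))) := by
  have : coshFactor (Complex.I * x * unitDir k) ^ 2 = (1 - x ^ 2)⁻¹ := by
    rw [coshFactor, normSq_vertex, inv_pow, Real.sq_sqrt (by linarith)]
  rw [vertexVec, discVec, this, normSq_vertex]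
  ext1
  · rfl
  · simp

lemma sideFrame_vertex (hx : x ^ 2 < 1) (j k : ZMod p) :
    sideFrame j (vertexVec x k).2 = ((1 - x ^ 2)⁻¹ * (2 * x) : ℝ) *
      (unitDir (k - j) * (Real.cos (Real.pi / p) + Real.sin (Real.pi / p) * Complex.I)) := by
  have hI := Complex.I_sq
  rw [vertexVec_eq hx, sideFrame, sub_eq_add_neg k j, unitDir_add, unitDir_neg, midDir]
  simp only [map_mul, map_add, Complex.conj_ofReal, Complex.conj_I]
  push_cast
  linear_combination -(2 * (1 - (x : ℂ) ^ 2)⁻¹ * x * unitDir k * (starRingEnd ℂ) (unitDir j) *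
    Complex.cos (Real.pi / p)) * hI

/-- The product form shows the sign. With `m = (k - j).val` and `θ = π / p` it vanishes for `m = 0,
1`, the two ends of side `j`, and both sines are positive for `2 ≤ m < p`. It arises from `cos θ -
cos ((2m - 1) θ)`. -/
lemma mform_vertex (h : IsRegularPolygon p η x sh ch) (j k : ZMod p) :
    mform (vertexVec x k) (sideNormal sh ch j) = 4 * (1 - x ^ 2)⁻¹ * x * ch *
      (Real.sin ((k - j).val * (Real.pi / p)) * Real.sin (((k - j).val - 1) * (Real.pi / p))) := by
  have hx : x ^ 2 < 1 := by linarith [h.sq_lt]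
  rw [mform_sideNormal, sideFrame_vertex hx, vertexVec_eq hx, unitDir_eq (k - j)]
  set m : ℝ := ((k - j).val : ℝ)
  set θ := Real.pi / p with hθ
  have e : (Complex.exp ((-(2 * (m * θ)) : ℝ) * Complex.I) *
      (Real.cos θ + Real.sin θ * Complex.I)).re = Real.cos ((2 * m - 1) * θ) := by
    have : (2 * m - 1) * θ = 2 * (m * θ) - θ := by ring
    rw [Complex.mul_re, Complex.exp_ofReal_mul_I_re, Complex.exp_ofReal_mul_I_im, Real.cos_neg,
      Real.sin_neg, this, Real.cos_sub]
    simp only [Complex.add_re, Complex.add_im, Complex.mul_re, Complex.mul_im, Complex.ofReal_re,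
      Complex.ofReal_im, Complex.I_re, Complex.I_im]
    ring
  rw [Complex.re_ofReal_mul, e]
  have t : Real.sin (m * θ) * Real.sin ((m - 1) * θ) =
      (Real.cos θ - Real.cos ((2 * m - 1) * θ)) / 2 := by
    have e1 : (2 * m - 1) * θ = m * θ + (m - 1) * θ := by ring
    have e2 : θ = m * θ - (m - 1) * θ := by ring
    have e3 : Real.cos θ = Real.cos (m * θ - (m - 1) * θ) := by rw [← e2]
    rw [e1, e3, Real.cos_sub, Real.cos_add]; ring
  rw [t]
  linear_combination (1 - x ^ 2)⁻¹ * h.sh_mul_add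

lemma mform_vertex_pos (h : IsRegularPolygon p η x sh ch) {j k : ZMod p} (h0 : k ≠ j)
    (h1 : k ≠ j + 1) : 0 < mform (vertexVec x k) (sideNormal sh ch j) := by
  rw [mform_vertex h]
  have hx := h.x_pos
  have hc := h.ch_pos
  have hs := inv_pos.2 h.sq_lt
  have hlt : ((k - j).val : ℝ) < p := by exact_mod_cast ZMod.val_lt (k - j)
  have hge : (2 : ℝ) ≤ (k - j).val := by
    have a0 : (k - j).val ≠ 0 := fun e => h0 (sub_eq_zero.1 ((ZMod.val_eq_zero _).1 e))
    have a1 : (k - j).val ≠ 1 := by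
      intro e
      apply h1
      have := ZMod.natCast_zmod_val (k - j)
      rw [e, Nat.cast_one] at this
      rw [this]; ring
    exact_mod_cast (by omega : 2 ≤ (k - j).val)
  have hp := h.p_pos
  have hθ := h.theta_pos
  have hpθ : p * (Real.pi / p) = Real.pi := by field_simp
  have s1 : 0 < Real.sin ((k - j).val * (Real.pi / p)) :=
    Real.sin_pos_of_pos_of_lt_pi (by positivity) (by
      calc _ < p * (Real.pi / p) := by gcongr
        _ = _ := hpθ)
  have s2 : 0 < Real.sin (((k - j).val - 1) * (Real.pi / p)) :=
    Real.sin_pos_of_pos_of_lt_pi (mul_pos (by linarith) hθ) (by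
      calc _ < p * (Real.pi / p) := by gcongr; linarith
        _ = _ := hpθ)
  positivity

lemma mform_vertex_eq_zero (h : IsRegularPolygon p η x sh ch) (j : ZMod p) :
    mform (vertexVec x j) (sideNormal sh ch j) = 0 := by
  rw [mform_vertex h]; simp

lemma mform_vertex_succ_eq_zero (h : IsRegularPolygon p η x sh ch) (j : ZMod p) :
    mform (vertexVec x (j + 1)) (sideNormal sh ch j) = 0 := by
  have : Fact (1 < p) := ⟨by have := h.three_le; omega⟩
  rw [mform_vertex h]; simp [ZMod.val_one]

lemma mform_vertex_nonneg (h : IsRegularPolygon p η x sh ch) (j k : ZMod p) :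
    0 ≤ mform (vertexVec x k) (sideNormal sh ch j) := by
  by_cases h0 : k = j
  · rw [h0, mform_vertex_eq_zero h]
  by_cases h1 : k = j + 1
  · rw [h1, mform_vertex_succ_eq_zero h]
  exact (mform_vertex_pos h h0 h1).le

/-- The cone over the polygon. -/
def polygonCone (sh ch : ℝ) (p : ℕ) [NeZero p] : Set Mink :=
  {v | ∀ k : ZMod p, 0 ≤ mform v (sideNormal sh ch k)}

/-- A side of the cone over the polygon is spanned by its two vertices. -/
lemma side_iff (h : IsRegularPolygon p η x sh ch) (k : ZMod p) {v : Mink} (hv : 0 < v.1) :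
    (v ∈ polygonCone sh ch p ∧ mform v (sideNormal sh ch k) = 0) ↔
      ∃ a b : ℝ, 0 ≤ a ∧ 0 ≤ b ∧ v = a • vertexVec x k + b • vertexVec x (k + 1) := by
  constructor
  · rintro ⟨hC, h0⟩
    have hx2 : x ^ 2 < 1 := by linarith [h.sq_lt]
    have hnext := hC (k + 1)
    have hprev := hC (k - 1)
    rw [mform_sideNormal] at h0 hnext hprev
    rw [sideFrame_add_one] at hnext
    rw [sideFrame_sub_one] at hprev
    have hu := eq_sideFrame_mul k v.2
    set a := (sideFrame k v.2).re with ha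
    set b := (sideFrame k v.2).im with hb
    have hab : sideFrame k v.2 = a + b * Complex.I := (Complex.re_add_im _).symm
    set S := Real.sin (Real.pi / p) with hS
    set C := Real.cos (Real.pi / p) with hC'
    have hSC : S ^ 2 + C ^ 2 = 1 := Real.sin_sq_add_cos_sq _
    have hS0 : 0 < S := h.sin_pos
    have hC0 : 0 < C := h.cos_pos
    have hch := h.ch_pos
    have hx0 := h.x_pos
    have hκ := h.sq_lt
    -- On the plane of side `k`, the inequalities of the two neighbouring sides become `a S ± b C ≥
    -- 0`; up to a positive factor these are the coefficients at the two vertices.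
    have b1 : 0 ≤ a * S + b * C := by
      have : 0 ≤ 2 * ch * S * (a * S + b * C) := by
        have e : sh * v.1 - ch * (a * (C ^ 2 - S ^ 2) - b * (2 * S * C)) =
          2 * ch * S * (a * S + b * C) := by linear_combination h0 - ch * a * hSC
        rwa [e] at hnext
      exact nonneg_of_mul_nonneg_right this (by positivity)
    have b2 : 0 ≤ a * S - b * C := by
      have : 0 ≤ 2 * ch * S * (a * S - b * C) := by
        have e : sh * v.1 - ch * (a * (C ^ 2 - S ^ 2) + b * (2 * S * C)) =
          2 * ch * S * (a * S - b * C) := by linear_combination h0 - ch * a * hSC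
        rwa [e] at hprev
      exact nonneg_of_mul_nonneg_right this (by positivity)
    have hs : a * (1 + x ^ 2) = 2 * x * C * v.1 := by
      apply mul_left_cancel₀ hch.ne'
      linear_combination -(1 + x ^ 2) * h0 + v.1 * h.sh_mul_add
    refine ⟨(1 - x ^ 2) * (a * S + b * C) / (4 * x * S * C),
      (1 - x ^ 2) * (a * S - b * C) / (4 * x * S * C), by positivity, by positivity, ?_⟩
    have hI := Complex.I_sq
    have hu1 : unitDir (k + 1) = unitDir k * (C - S * Complex.I) ^ 2 := by
      rw [unitDir_add, unitDir_one]
    have hm : midDir p = S + C * Complex.I := rfl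
    have hSC' : (S : ℂ) ^ 2 + C ^ 2 = 1 := by exact_mod_cast hSC
    have hS0' : (S : ℂ) ≠ 0 := by exact_mod_cast hS0.ne'
    have hC0' : (C : ℂ) ≠ 0 := by exact_mod_cast hC0.ne'
    have hx0' : (x : ℂ) ≠ 0 := by exact_mod_cast hx0.ne'
    have hκ' : (1 - (x : ℂ) ^ 2) ≠ 0 := by exact_mod_cast hκ.ne'
    rw [vertexVec_eq hx2, vertexVec_eq hx2]
    ext1
    · simp only [Prod.fst_add, Prod.smul_fst, smul_eq_mul]
      field_simp
      linear_combination -(2 * S) * hs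
    · simp only [Prod.snd_add, Prod.smul_snd, Complex.real_smul]
      rw [hu, hab, hu1, hm]
      have key : 2 * S * C * ((a + b * Complex.I) * (S + C * Complex.I)) =
          Complex.I * ((a * S + b * C) + (a * S - b * C) * (C - S * Complex.I) ^ 2) := by
        linear_combination (2 * (S : ℂ) ^ 2 * C * a - S ^ 2 * Complex.I * (a * S - b * C)) * hI +
          (a * S + b * C) * Complex.I * hSC'
      push_cast
      field_simp
      linear_combination 2 * unitDir k * key
  · rintro ⟨a, b, ha, hb, rfl⟩
    refine ⟨fun j => ?_, ?_⟩
    · simp only [map_add, map_smul, LinearMap.add_apply, LinearMap.smul_apply, smul_eq_mul]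
      exact add_nonneg (mul_nonneg ha (mform_vertex_nonneg h _ _))
        (mul_nonneg hb (mform_vertex_nonneg h _ _))
    · simp only [map_add, map_smul, LinearMap.add_apply, LinearMap.smul_apply, smul_eq_mul,
        mform_vertex_eq_zero h, mform_vertex_succ_eq_zero h]
      ring

/-- Some side normal makes an angle of at most `π / p` with a given direction. -/
lemma exists_sideFrame_re_ge (u : ℂ) :
    ∃ k : ZMod p, ‖u‖ * Real.cos (Real.pi / p) ≤ (sideFrame k u).re := by
  set θ := Real.pi / p with hθ
  have hp : (0 : ℝ) < p := by exact_mod_cast Nat.pos_of_ne_zero (NeZero.ne p)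
  have hp1 : (1 : ℝ) ≤ p := by exact_mod_cast Nat.one_le_iff_ne_zero.2 (NeZero.ne p)
  have hθ0 : 0 < θ := div_pos Real.pi_pos hp
  have hθ1 : θ ≤ Real.pi := div_le_self Real.pi_pos.le hp1
  -- `y` is the argument of `u` measured from `midDir`, of argument `π/2 - θ`, in steps of `2θ`.
  -- Rounding leaves an angle of at most `θ`; the minus sign below appears because `unitDir` turns
  -- clockwise.
  set y := (u.arg - (Real.pi / 2 - θ)) / (2 * θ) with hy
  refine ⟨((-round y : ℤ) : ZMod p), ?_⟩
  have hm : midDir p = Complex.exp ((Real.pi / 2 - θ : ℝ) * Complex.I) := by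
    rw [Complex.exp_mul_I, ← Complex.ofReal_cos, ← Complex.ofReal_sin, Real.cos_pi_div_two_sub,
      Real.sin_pi_div_two_sub, midDir]
  have hu : u = ‖u‖ * Complex.exp (u.arg * Complex.I) := (Complex.norm_mul_exp_arg_mul_I u).symm
  have e : sideFrame ((-round y : ℤ) : ZMod p) u =
      ‖u‖ * Complex.exp ((2 * θ * (y - round y) : ℝ) * Complex.I) := by
    rw [sideFrame, unitDir_intCast, hm, ← Complex.exp_add, ← add_mul, ← Complex.ofReal_add,
      ← exp_neg_mul_I]
    conv_lhs => rw [hu]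
    rw [mul_assoc, ← Complex.exp_add]
    congr 2
    rw [← neg_mul, ← Complex.ofReal_neg, ← add_mul, ← Complex.ofReal_add]
    congr 2
    have : 2 * θ * y = u.arg - (Real.pi / 2 - θ) := by rw [hy]; field_simp
    rw [mul_sub, this]
    push_cast
    ring
  rw [e, Complex.re_ofReal_mul, Complex.exp_ofReal_mul_I_re]
  apply mul_le_mul_of_nonneg_left _ (norm_nonneg u)
  rw [← Real.cos_abs (2 * θ * (y - round y))]
  apply Real.cos_le_cos_of_nonneg_of_le_pi (abs_nonneg _) hθ1
  rw [abs_mul, abs_of_pos (by positivity)]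
  have := abs_sub_round y
  nlinarith

/-- The polygon lies in its circumscribed disc. The inequality of the side whose normal direction is
within `π / p` of `v.2` suffices. -/
lemma norm_snd_le_of_mem (h : IsRegularPolygon p η x sh ch) {v : Mink}
    (hv : v ∈ polygonCone sh ch p) : ‖v.2‖ * (1 + x ^ 2) ≤ 2 * x * v.1 := by
  obtain ⟨k, hk⟩ := exists_sideFrame_re_ge (p := p) v.2
  have h1 := hv k
  rw [mform_sideNormal] at h1
  have hch := h.ch_pos
  have hC := h.cos_pos
  have h2 : ch * (‖v.2‖ * Real.cos (Real.pi / p)) ≤ sh * v.1 := by nlinarith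
  have h3 : (ch * Real.cos (Real.pi / p)) * (‖v.2‖ * (1 + x ^ 2)) ≤
      (ch * Real.cos (Real.pi / p)) * (2 * x * v.1) := by
    have := mul_le_mul_of_nonneg_right h2 (by positivity : 0 ≤ 1 + x ^ 2)
    have e := h.sh_mul_add
    calc _ = ch * (‖v.2‖ * Real.cos (Real.pi / p)) * (1 + x ^ 2) := by ring
      _ ≤ sh * v.1 * (1 + x ^ 2) := this
      _ = _ := by linear_combination v.1 * e
  exact le_of_mul_le_mul_left h3 (by positivity)

end Polygon

/-! ### The regular infinite prism -/

section Prism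

open Topology

variable {p : ℕ} [NeZero p] {η x sh ch : ℝ}

/-- The vertex `k` of the polygon as a point of the disc. -/
noncomputable def vertexPt (h : IsRegularPolygon p η x sh ch) (k : ZMod p) :
    Metric.ball (0 : ℂ) 1 :=
  ⟨Complex.I * x * unitDir k, mem_ball_of_normSq_lt (by
    rw [normSq_vertex]; linarith [h.sq_lt])⟩

/-- The vertices of the prism. -/
noncomputable def prismVertex (h : IsRegularPolygon p η x sh ch) (k : ZMod p) : Space :=
  (0, vertexPt h k)

/-- The solid over the polygon. -/
def prismSolid (sh ch : ℝ) (p : ℕ) [NeZero p] : Set Space := {Z | baseVec Z ∈ polygonCone sh ch p}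

/-- The side faces of the solid. -/
def prismSide (sh ch : ℝ) (k : ZMod p) : Set Space :=
  {Z | baseVec Z ∈ polygonCone sh ch p ∧ mform (baseVec Z) (sideNormal sh ch k) = 0}

lemma baseVec_prismVertex (h : IsRegularPolygon p η x sh ch) (k : ZMod p) :
    baseVec (prismVertex h k) = vertexVec x k := rfl

lemma mem_prismSide_iff (h : IsRegularPolygon p η x sh ch) (k : ZMod p) (Z : Space) :
    Z ∈ prismSide sh ch k ↔
      ∃ a b : ℝ, 0 ≤ a ∧ 0 ≤ b ∧ baseVec Z = a • vertexVec x k + b • vertexVec x (k + 1) :=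
  side_iff h k (baseVec_mem Z).2

lemma onOneSheetedHyperboloid_prismSide (h : IsRegularPolygon p η x sh ch) (k : ZMod p) :
    OnOneSheetedHyperboloid (prismSide sh ch k) := by
  have h1 := mform_sideNormal_self h k
  have h0 : (sideNormal sh ch k).1 ≠ 0 := neg_ne_zero.2 h.sh_pos.ne'
  have main : ∀ Z ∈ prismSide sh ch k, mform (baseVec Z) (sideNormal sh ch k) = 0 :=
    fun Z hZ => hZ.2
  generalize sideNormal sh ch k = γ at h0 h1 main
  obtain ⟨g, u⟩ := γ
  -- The coordinates are `ℓ₁ + i ℓ₂ = g w - u conj z` and `ℓ₃ = x¹`. Orthogonality to `(g, u)` gives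
  -- `|ℓ₁ + i ℓ₂|² = (|u|² - g²) |z|² = |z|²`, which is `ℓ₀² + ℓ₃²`.
  refine ⟨!![1, -u.re, -u.im, 0; 0, -u.im, u.re, 1; 0, g, 0, 0; 0, 0, g, 0], ?_, ?_, ?_⟩
  · simp [Matrix.det_succ_row_zero, Fin.sum_univ_succ, Fin.succAbove]
    simpa using h0
  · intro y
    simp [Matrix.vecMul, dotProduct, Fin.sum_univ_four]
  · intro Z hZ
    have e := main Z hZ
    rw [← hvec_coord] at e
    rw [modelCoord_eq]
    simp [mform_apply, hvec, Complex.normSq_apply] at e h1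
    simp [cvec, Matrix.vecMul, dotProduct, Fin.sum_univ_four]
    linear_combination -g * e + ((zCoord Z).re ^ 2 + (zCoord Z).im ^ 2) * h1

lemma isSideFace_prismSide (h : IsRegularPolygon p η x sh ch) (k : ZMod p) :
    IsSideFace (prismVertex h k) (prismVertex h (k + 1)) (prismSide sh ch k) := by
  refine ⟨?_, onOneSheetedHyperboloid_prismSide h k⟩
  obtain ⟨X, hX, Y, hY, hneg, hseg⟩ := exists_geodesic_segment (vertexPt h k) (vertexPt h (k + 1))
  refine ⟨X, hX, Y, hY, hneg, ?_⟩
  rw [hseg]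
  ext Z
  exact mem_prismSide_iff h k Z

lemma vertexVec_injective (h : IsRegularPolygon p η x sh ch) :
    Function.Injective (vertexVec x : ZMod p → Mink) := by
  intro j k e
  have e1 := baseVec_eq_iff.1 (show baseVec (prismVertex h j) = baseVec (prismVertex h k) from e)
  have e2 : Complex.I * x * unitDir j = Complex.I * x * unitDir k := congrArg Subtype.val e1
  have hx : Complex.I * (x : ℂ) ≠ 0 := mul_ne_zero Complex.I_ne_zero (by
    exact_mod_cast h.x_pos.ne')
  exact neg_injective (ZMod.injective_stdAddChar (mul_left_cancel₀ hx e2))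

/-- The common zeros of two consecutive side functions on a side are multiples of the vertex. -/
lemma eq_smul_vertexVec (h : IsRegularPolygon p η x sh ch) (k : ZMod p) {v : Mink} (hv : 0 < v.1)
    (hC : v ∈ polygonCone sh ch p) (h0 : mform v (sideNormal sh ch k) = 0)
    (h1 : mform v (sideNormal sh ch (k + 1)) = 0) :
    ∃ b : ℝ, 0 < b ∧ v = b • vertexVec x (k + 1) := by
  obtain ⟨a, b, ha, hb, e⟩ := (side_iff h k hv).1 ⟨hC, h0⟩
  have hne : (1 : ZMod p) ≠ 0 := by
    have : Fact (1 < p) := ⟨by have := h.three_le; omega⟩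
    exact one_ne_zero
  have hpos : 0 < mform (vertexVec x k) (sideNormal sh ch (k + 1)) := by
    apply mform_vertex_pos h
    · simpa using hne
    · intro e
      have e2 : ((2 : ℕ) : ZMod p) = 0 := by
        have : k + (1 + 1) = k + 0 := by rw [← add_assoc, ← e, add_zero]
        have := add_left_cancel this
        push_cast; rw [← this]; norm_num
      have := Nat.le_of_dvd two_pos ((ZMod.natCast_eq_zero_iff 2 p).1 e2)
      have := h.three_le
      omega
  rw [e] at h1
  simp only [map_add, map_smul, LinearMap.add_apply, LinearMap.smul_apply, smul_eq_mul,
    mform_vertex_eq_zero h, mul_zero, add_zero] at h1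
  have ha0 : a = 0 := (mul_eq_zero.1 h1).resolve_right hpos.ne'
  rw [ha0, zero_smul, zero_add] at e
  refine ⟨b, lt_of_le_of_ne hb ?_, e⟩
  rintro rfl
  rw [e] at hv
  simp at hv

lemma prismSide_inter (h : IsRegularPolygon p η x sh ch) (k : ZMod p) :
    prismSide sh ch k ∩ prismSide sh ch (k + 1) = fibre (prismVertex h (k + 1)) := by
  ext Z
  rw [mem_fibre_iff, baseVec_prismVertex]
  constructor
  · rintro ⟨⟨hC, h0⟩, -, h1⟩
    obtain ⟨b, hb, e⟩ := eq_smul_vertexVec h k (baseVec_mem Z).2 hC h0 h1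
    exact eq_of_smul_baseVec (Z := prismVertex h (k + 1)) hb e
  · intro e
    rw [Set.mem_inter_iff, mem_prismSide_iff h, mem_prismSide_iff h]
    exact ⟨⟨0, 1, le_rfl, zero_le_one, by simp [e]⟩, ⟨1, 0, zero_le_one, le_rfl, by simp [e]⟩⟩

lemma prismSide_disjoint (h : IsRegularPolygon p η x sh ch) (i j : ZMod p) (h0 : i ≠ j)
    (h1 : j ≠ i + 1) (h2 : i ≠ j + 1) : Disjoint (prismSide sh ch i) (prismSide sh ch j) := by
  rw [Set.disjoint_left]
  rintro Z hZ ⟨-, hj⟩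
  have hZ' := (baseVec_mem Z).2
  obtain ⟨a, b, ha, hb, e⟩ := (mem_prismSide_iff h i Z).1 hZ
  have p1 := mform_vertex_pos h h0 h2
  have p2 := mform_vertex_pos (k := i + 1) h h1.symm (by simpa using h0)
  rw [e] at hj hZ'
  simp only [map_add, map_smul, LinearMap.add_apply, LinearMap.smul_apply, smul_eq_mul] at hj
  have q1 := mul_nonneg ha p1.le
  have q2 := mul_nonneg hb p2.le
  have a0 : a = 0 := (mul_eq_zero.1 (by linarith)).resolve_right p1.ne'
  have b0 : b = 0 := (mul_eq_zero.1 (by linarith)).resolve_right p2.ne'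
  rw [a0, b0] at hZ'
  simp at hZ'

/-! ### Interior, closure, frontier and compactness of the solid. -/

lemma mform_baseVec_sideNormal (k : ZMod p) (Z : Space) :
    mform (baseVec Z) (sideNormal sh ch k) = coshFactor Z.2 ^ 2 *
      (sh * (1 + Complex.normSq (Z.2 : ℂ)) - 2 * ch * (sideFrame k Z.2).re) := by
  have : sideFrame k (baseVec Z).2 = (coshFactor Z.2 ^ 2 * 2 : ℝ) * sideFrame k Z.2 := by
    simp only [sideFrame, baseVec, discVec, Prod.smul_snd, Complex.real_smul]
    push_cast; ring
  rw [mform_sideNormal, this, Complex.re_ofReal_mul]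
  simp only [baseVec, discVec, Prod.smul_fst, smul_eq_mul]
  ring

/-- When `sh > 0` and `t |ζ|² < 1`, the last term has the sign of `1 - t`. So shrinking the disc
makes nonnegative side functions positive, and expanding it makes a vanishing one negative. -/
lemma sideNormal_scale (k : ZMod p) (Y Z : Space) (t : ℝ) (hY : (Y.2 : ℂ) = t * Z.2) :
    coshFactor Z.2 ^ 2 * mform (baseVec Y) (sideNormal sh ch k) = coshFactor Y.2 ^ 2 *
      (t * mform (baseVec Z) (sideNormal sh ch k) +
        coshFactor Z.2 ^ 2 * (sh * (1 - t) * (1 - t * Complex.normSq (Z.2 : ℂ)))) := by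
  have e1 : sideFrame k (Y.2 : ℂ) = t * sideFrame k (Z.2 : ℂ) := by
    rw [hY, sideFrame, sideFrame, mul_assoc]
  have e2 : Complex.normSq (Y.2 : ℂ) = t ^ 2 * Complex.normSq (Z.2 : ℂ) := by
    rw [hY, map_mul, Complex.normSq_ofReal, pow_two]
  rw [mform_baseVec_sideNormal, mform_baseVec_sideNormal, e1, e2, Complex.re_ofReal_mul]
  ring

lemma continuous_coshFactor :
    Continuous fun Z : Space => coshFactor (Z.2 : ℂ) := by
  have h : Continuous fun Z : Space => Real.sqrt (1 - Complex.normSq (Z.2 : ℂ)) :=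
    (continuous_const.sub (Complex.continuous_normSq.comp
      (continuous_subtype_val.comp continuous_snd))).sqrt
  exact h.inv₀ fun Z => (Real.sqrt_pos.2 (sub_pos.2 (normSq_lt_one Z.2))).ne'

lemma continuous_baseVec : Continuous baseVec := by
  have h1 : Continuous fun Z : Space => (Z.2 : ℂ) := continuous_subtype_val.comp continuous_snd
  exact (continuous_coshFactor.pow 2).smul
    ((continuous_const.add (Complex.continuous_normSq.comp h1)).prodMk (continuous_const.mul h1))

lemma continuous_mform (γ : Mink) : Continuous fun Z : Space => mform (baseVec Z) γ := by
  have h := continuous_baseVec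
  simp only [mform_apply]
  have h1 : Continuous fun Z => (baseVec Z).1 := h.fst
  have h2 : Continuous fun Z => (baseVec Z).2.re := Complex.continuous_re.comp h.snd
  have h3 : Continuous fun Z => (baseVec Z).2.im := Complex.continuous_im.comp h.snd
  fun_prop

lemma isClosed_prismSolid : IsClosed (prismSolid sh ch p) := by
  have : prismSolid sh ch p = ⋂ k : ZMod p, {Z | 0 ≤ mform (baseVec Z) (sideNormal sh ch k)} := by
    ext Z; simp [prismSolid, polygonCone]
  rw [this]
  exact isClosed_iInter fun k => isClosed_le continuous_const (continuous_mform _)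

/-- The open solid over the interior of the polygon. -/
def openSolid (sh ch : ℝ) (p : ℕ) [NeZero p] : Set Space :=
  {Z | ∀ k : ZMod p, 0 < mform (baseVec Z) (sideNormal sh ch k)}

lemma isOpen_openSolid : IsOpen (openSolid sh ch p) := by
  have : openSolid sh ch p = ⋂ k : ZMod p, {Z | 0 < mform (baseVec Z) (sideNormal sh ch k)} := by
    ext Z; simp [openSolid]
  rw [this]
  exact isOpen_iInter_of_finite fun k => isOpen_lt continuous_const (continuous_mform _)

/-- A neighbourhood of a point contains its images under dilatations of the disc near the
identity. -/
lemma eventually_dilate {Z : Space} {N : Set Space} (hN : N ∈ 𝓝 Z) :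
    ∀ᶠ t : ℝ in 𝓝 1, ∃ Y ∈ N, (Y.2 : ℂ) = t * Z.2 := by
  have h1 : {ζ : Metric.ball (0 : ℂ) 1 | (Z.1, ζ) ∈ N} ∈ 𝓝 Z.2 := by
    have hc : ContinuousAt (fun ζ : Metric.ball (0 : ℂ) 1 => ((Z.1, ζ) : Space)) Z.2 := by
      fun_prop
    exact hc hN
  have h2 := (Metric.isOpen_ball.isOpenEmbedding_subtypeVal).isOpenMap.image_mem_nhds h1
  have h3 : Filter.Tendsto (fun t : ℝ => (t : ℂ) * Z.2) (𝓝 1) (𝓝 (Z.2 : ℂ)) := by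
    have : Continuous fun t : ℝ => (t : ℂ) * Z.2 := by fun_prop
    simpa using this.tendsto 1
  filter_upwards [h3 h2] with t ht
  obtain ⟨ζ, hζ, e⟩ := ht
  exact ⟨(Z.1, ζ), hζ, e⟩

lemma mul_normSq_lt_one {Y Z : Space} {t : ℝ} (ht : 0 ≤ t) (hY : (Y.2 : ℂ) = t * Z.2) :
    t * Complex.normSq (Z.2 : ℂ) < 1 := by
  have h1 := mem_ball_zero_iff.1 Y.2.2
  have h2 := mem_ball_zero_iff.1 Z.2.2
  rw [hY, norm_mul, Complex.norm_real, Real.norm_of_nonneg ht] at h1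
  rw [← Complex.sq_norm]
  nlinarith [norm_nonneg (Z.2 : ℂ)]

/-- A point where a side function vanishes is not interior: dilatations with `t > 1` move it out of
the solid while staying arbitrarily near. -/
lemma interior_prismSolid (h : IsRegularPolygon p η x sh ch) :
    interior (prismSolid sh ch p) = openSolid sh ch p := by
  apply Set.Subset.antisymm
  · intro Z hZ k
    have hZP : Z ∈ prismSolid sh ch p := interior_subset hZ
    refine lt_of_le_of_ne (hZP k) fun h0 => ?_
    have hev := eventually_dilate (mem_interior_iff_mem_nhds.1 hZ)
    obtain ⟨t, ⟨Y, hYP, hY⟩, ht⟩ :=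
      ((hev.filter_mono nhdsWithin_le_nhds).and self_mem_nhdsWithin :
        ∀ᶠ t in 𝓝[>] (1 : ℝ), _).exists
    have ht1 : 1 < t := ht
    have hlt := mul_normSq_lt_one (by linarith) hY
    have e := sideNormal_scale (sh := sh) (ch := ch) k Y Z t hY
    rw [← h0] at e
    have p1 := pow_pos (coshFactor_pos Z.2) 2
    have p2 := pow_pos (coshFactor_pos Y.2) 2
    have p3 := mul_nonneg p1.le (hYP k)
    have p4 : 0 < coshFactor (Y.2 : ℂ) ^ 2 * (coshFactor (Z.2 : ℂ) ^ 2 *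
        (sh * (t - 1) * (1 - t * Complex.normSq (Z.2 : ℂ)))) :=
      mul_pos p2 (mul_pos p1 (mul_pos (mul_pos h.sh_pos (by linarith)) (by linarith)))
    nlinarith
  · exact interior_maximal (fun Z hZ k => (hZ k).le) isOpen_openSolid

/-- Dilatations with `t < 1` near `1` move any point of the solid into its interior. -/
lemma closure_interior_prismSolid (h : IsRegularPolygon p η x sh ch) :
    closure (interior (prismSolid sh ch p)) = prismSolid sh ch p := by
  apply Set.Subset.antisymm
  · exact closure_minimal interior_subset isClosed_prismSolid
  · intro Z hZ
    rw [interior_prismSolid h, mem_closure_iff_nhds]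
    intro N hN
    have hev := eventually_dilate hN
    have hpos : ∀ᶠ t : ℝ in 𝓝 1, 0 < t := lt_mem_nhds one_pos
    obtain ⟨t, ⟨⟨Y, hYN, hY⟩, h0⟩, ht⟩ :=
      (((hev.and hpos).filter_mono nhdsWithin_le_nhds).and self_mem_nhdsWithin :
        ∀ᶠ t in 𝓝[<] (1 : ℝ), _).exists
    have ht1 : t < 1 := ht
    refine ⟨Y, hYN, fun k => ?_⟩
    have hlt := mul_normSq_lt_one h0.le hY
    have e := sideNormal_scale (sh := sh) (ch := ch) k Y Z t hY
    have p1 := pow_pos (coshFactor_pos Z.2) 2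
    have p2 := pow_pos (coshFactor_pos Y.2) 2
    have p3 := mul_nonneg h0.le (hZ k)
    have p4 : 0 < coshFactor (Z.2 : ℂ) ^ 2 *
        (sh * (1 - t) * (1 - t * Complex.normSq (Z.2 : ℂ))) :=
      mul_pos p1 (mul_pos (mul_pos h.sh_pos (by linarith)) (by linarith))
    have p5 : 0 < coshFactor (Z.2 : ℂ) ^ 2 * mform (baseVec Y) (sideNormal sh ch k) := by
      rw [e]; exact mul_pos p2 (by linarith)
    exact pos_of_mul_pos_right p5 p1.le

lemma frontier_prismSolid (h : IsRegularPolygon p η x sh ch) :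
    frontier (prismSolid sh ch p) = ⋃ k : ZMod p, prismSide sh ch k := by
  rw [frontier, isClosed_prismSolid.closure_eq, interior_prismSolid h]
  ext Z
  simp only [Set.mem_sdiff, Set.mem_iUnion]
  constructor
  · rintro ⟨hZ, hn⟩
    simp only [openSolid, Set.mem_ofPred_eq, not_forall, not_lt] at hn
    obtain ⟨k, hk⟩ := hn
    exact ⟨k, hZ, le_antisymm hk (hZ k)⟩
  · rintro ⟨k, hZ, hk⟩
    exact ⟨hZ, fun ho => (ho k).ne' hk⟩

lemma isCompact_prismSolid_inter (h : IsRegularPolygon p η x sh ch) :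
    IsCompact (prismSolid sh ch p ∩ basePlane) := by
  have hx0 := h.x_pos
  have hx1 := h.x_lt_one
  have hK : IsCompact (Subtype.val ⁻¹' Metric.closedBall (0 : ℂ) x :
      Set (Metric.ball (0 : ℂ) 1)) := by
    rw [Subtype.isCompact_iff, Subtype.image_preimage_coe, Set.inter_eq_self_of_subset_right
      (Metric.closedBall_subset_ball hx1)]
    exact isCompact_closedBall _ _
  refine ((isCompact_singleton (x := (0 : ℝ))).prod hK).of_isClosed_subset
    (isClosed_prismSolid.inter (isClosed_eq continuous_fst continuous_const)) ?_
  rintro Z ⟨hZ, h0⟩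
  refine ⟨h0, ?_⟩
  have hle := norm_snd_le_of_mem h hZ
  have hk := pow_pos (coshFactor_pos Z.2) 2
  have e : ‖(baseVec Z).2‖ = coshFactor (Z.2 : ℂ) ^ 2 * (2 * ‖(Z.2 : ℂ)‖) := by
    simp [baseVec, discVec]
  have e' : (baseVec Z).1 = coshFactor (Z.2 : ℂ) ^ 2 * (1 + ‖(Z.2 : ℂ)‖ ^ 2) := by
    simp [baseVec, discVec, Complex.sq_norm]
  rw [e, e'] at hle
  -- With `r = ‖ζ‖`, the bound `r (1 + x²) ≤ x (1 + r²)` factors as `(r - x)(1 - x r) ≤ 0`, whence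
  -- `r ≤ x`.
  have h2 : coshFactor (Z.2 : ℂ) ^ 2 * ((‖(Z.2 : ℂ)‖ - x) * (1 - x * ‖(Z.2 : ℂ)‖)) ≤ 0 := by
    nlinarith
  have h3 : (‖(Z.2 : ℂ)‖ - x) * (1 - x * ‖(Z.2 : ℂ)‖) ≤ 0 := by
    by_contra hcon
    push Not at hcon
    exact absurd h2 (not_le.2 (mul_pos hk hcon))
  have h4 : 0 < 1 - x * ‖(Z.2 : ℂ)‖ := by
    have := mem_ball_zero_iff.1 Z.2.2
    nlinarith [norm_nonneg (Z.2 : ℂ)]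
  rw [Set.mem_preimage, mem_closedBall_zero_iff]
  by_contra hcon
  push Not at hcon
  exact absurd h3 (not_le.2 (mul_pos (sub_pos.2 hcon) h4))

lemma prismVertex_mem_basePlane (h : IsRegularPolygon p η x sh ch) (k : ZMod p) :
    prismVertex h k ∈ basePlane := by
  rw [basePlane, Set.mem_ofPred_eq, prismVertex]

lemma prismVertex_injective (h : IsRegularPolygon p η x sh ch) :
    Function.Injective (prismVertex h) := by
  intro j k e
  apply vertexVec_injective h
  rw [← baseVec_prismVertex h, ← baseVec_prismVertex h, e]

lemma fibre_subset_prismSolid (X : Space) (hX : X ∈ prismSolid sh ch p) :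
    fibre X ⊆ prismSolid sh ch p := by
  intro Y hY
  rw [mem_fibre_iff] at hY
  rw [prismSolid, Set.mem_ofPred_eq, hY]
  exact hX

theorem isInfinitePrism (h : IsRegularPolygon p η x sh ch) :
    IsInfinitePrism p (prismVertex h) (prismSide sh ch) (prismSolid sh ch p) where
  vertex_mem := prismVertex_mem_basePlane h
  vertex_inj := prismVertex_injective h
  side := isSideFace_prismSide h
  side_inter := prismSide_inter h
  side_disjoint := prismSide_disjoint h
  fibre_subset := fibre_subset_prismSolid
  base_compact := isCompact_prismSolid_inter h
  regular_closed := closure_interior_prismSolid h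
  frontier_eq := frontier_prismSolid h

lemma hasHomCoord_prismVertex (h : IsRegularPolygon p η x sh ch) (k : ZMod p) :
    HasHomCoord (prismVertex h k) ![1, 0, x * Real.sin (2 * Real.pi * k.val / p),
      x * Real.cos (2 * Real.pi * k.val / p)] := by
  refine ⟨coshFactor (vertexPt h k), coshFactor_pos _, ?_⟩
  have e : (vertexPt h k : ℂ) = ⟨x * Real.sin (2 * Real.pi * k.val / p),
      x * Real.cos (2 * Real.pi * k.val / p)⟩ := by
    have e1 : -(2 * (k.val * (Real.pi / p))) = -(2 * Real.pi * k.val / p) := by ring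
    change Complex.I * x * unitDir k = _
    rw [unitDir_eq, e1]
    apply Complex.ext
    · rw [Complex.mul_re, Complex.exp_ofReal_mul_I_re, Complex.exp_ofReal_mul_I_im]; simp
    · rw [Complex.mul_im, Complex.exp_ofReal_mul_I_re, Complex.exp_ofReal_mul_I_im]; simp
  rw [prismVertex, modelCoord_base]
  have e2 : cvec (coshFactor (vertexPt h k)) (coshFactor (vertexPt h k) * vertexPt h k) =
      (coshFactor (vertexPt h k) : ℝ) • cvec 1 (vertexPt h k) := by
    rw [smul_cvec, mul_one]
  rw [e2]
  congr 1
  rw [e]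
  simp [cvec]

end Prism

/-! ### The triangle group -/

section TriangleGroup

lemma normSq_midNormal (p : ℕ) :
    Complex.normSq (-Real.cos (Real.pi / p) + Real.sin (Real.pi / p) * Complex.I) = 1 := by
  have := Real.sin_sq_add_cos_sq (Real.pi / p)
  generalize Real.sin (Real.pi / p) = S at this ⊢
  generalize Real.cos (Real.pi / p) = C at this ⊢
  simp [Complex.normSq_apply]
  linarith

variable {p : ℕ} [NeZero p] {η x sh ch : ℝ}

/-- The normals of the characteristic triangle: the line to a vertex, the line to the midpoint of
a side, and the side. -/
noncomputable def triangleRoot (sh ch : ℝ) (p : ℕ) [NeZero p] : Fin 3 → Mink :=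
  ![(0, 1), (0, -Real.cos (Real.pi / p) + Real.sin (Real.pi / p) * Complex.I),
    sideNormal sh ch (0 : ZMod p)]

lemma mform_axis (e : ℂ) : mform (0, e) (0, e) = Complex.normSq e := by
  simp [mform_apply, Complex.normSq_apply]

lemma triangleRoot_norm (h : IsRegularPolygon p η x sh ch) (s : Fin 3) :
    mform (triangleRoot sh ch p s) (triangleRoot sh ch p s) = 1 := by
  fin_cases s
  · change mform ((0, 1) : Mink) (0, 1) = 1
    rw [mform_axis]; simp
  · change mform ((0, _) : Mink) (0, _) = 1
    rw [mform_axis, normSq_midNormal]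
  · exact mform_sideNormal_self h 0

/-- The reflections in the sides of the characteristic triangle. -/
noncomputable def triangleRefl (h : IsRegularPolygon p η x sh ch) (s : Fin 3) : Mink ≃ₗ[ℝ] Mink :=
  mreflect (triangleRoot sh ch p s) (triangleRoot_norm h s)

/-- The triangle has the angle `π/p` at the centre, `π/q` at the vertex and `π/2` at the midpoint of
the side. The second one is the relation `ch sin (π/p) = cos η` with `η = π/q`. -/
lemma coxeterRoots_triangle {q : ℕ} (hq : 2 ≤ q) (h : IsRegularPolygon p (Real.pi / q) x sh ch) :
    CoxeterRoots mform (triangleRoot sh ch p) (triangleRefl h) where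
  symm := mform_symm
  norm := triangleRoot_norm h
  apply s v := mreflect_apply _ _ v
  angle := by
    have e01 : mform (triangleRoot sh ch p 0) (triangleRoot sh ch p 1) =
        -Real.cos (Real.pi / p) := by
      rw [triangleRoot]
      generalize Real.sin (Real.pi / p) = S
      generalize Real.cos (Real.pi / p) = C
      simp [mform_apply]
    have e02 : mform (triangleRoot sh ch p 0) (triangleRoot sh ch p 2) =
        -Real.cos (Real.pi / q) := by
      rw [← h.ch_mul_sin]
      simp only [triangleRoot, sideNormal, midDir, unitDir_zero]
      generalize Real.sin (Real.pi / p) = S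
      generalize Real.cos (Real.pi / p) = C
      simp [mform_apply]
    have e12 : mform (triangleRoot sh ch p 1) (triangleRoot sh ch p 2) =
        -Real.cos (Real.pi / (2 : ℕ)) := by
      simp only [triangleRoot, sideNormal, midDir, unitDir_zero]
      generalize Real.sin (Real.pi / p) = S
      generalize Real.cos (Real.pi / p) = C
      simp [mform_apply]
      ring
    have hp : 2 ≤ p := by have := h.three_le; omega
    intro s t hst
    fin_cases s <;> fin_cases t
    · exact absurd rfl hst
    · exact ⟨p, hp, e01⟩
    · exact ⟨q, hq, e02⟩
    · exact ⟨p, hp, by rw [mform_symm]; exact e01⟩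
    · exact absurd rfl hst
    · exact ⟨2, le_rfl, e12⟩
    · exact ⟨q, hq, by rw [mform_symm]; exact e02⟩
    · exact ⟨2, le_rfl, by rw [mform_symm]; exact e12⟩
    · exact absurd rfl hst

/-- The full symmetry group of the tiling of the base plane. -/
noncomputable def triangleGroup (h : IsRegularPolygon p η x sh ch) : Subgroup (Mink ≃ₗ[ℝ] Mink) :=
  Subgroup.closure (Set.range (triangleRefl h))

/-- The symmetry group of the polygon. -/
noncomputable def dihedralPart (h : IsRegularPolygon p η x sh ch) : Subgroup (Mink ≃ₗ[ℝ] Mink) :=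
  Subgroup.closure (triangleRefl h '' {0, 1})

lemma dihedralPart_le (h : IsRegularPolygon p η x sh ch) : dihedralPart h ≤ triangleGroup h :=
  Subgroup.closure_mono (Set.image_subset_range _ _)

lemma triangleRefl_mem (h : IsRegularPolygon p η x sh ch) (s : Fin 3) :
    triangleRefl h s ∈ triangleGroup h := Subgroup.subset_closure ⟨s, rfl⟩

lemma triangleRefl_zero_mem (h : IsRegularPolygon p η x sh ch) :
    triangleRefl h 0 ∈ dihedralPart h := Subgroup.subset_closure ⟨0, by simp, rfl⟩

lemma triangleRefl_one_mem (h : IsRegularPolygon p η x sh ch) :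
    triangleRefl h 1 ∈ dihedralPart h := Subgroup.subset_closure ⟨1, by simp, rfl⟩

lemma mreflect_mul_self (n : Mink) (hn : mform n n = 1) : mreflect n hn * mreflect n hn = 1 := by
  ext v : 1
  simp only [LinearEquiv.mul_apply, LinearEquiv.coe_one, id_eq, mreflect_apply, map_sub, map_smul,
    hn]
  module

lemma mreflect_inv (n : Mink) (hn : mform n n = 1) : (mreflect n hn)⁻¹ = mreflect n hn :=
  inv_eq_of_mul_eq_one_left (mreflect_mul_self n hn)

lemma mform_mreflect (n : Mink) (hn : mform n n = 1) (v w : Mink) :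
    mform (mreflect n hn v) (mreflect n hn w) = mform v w := by
  simp only [mreflect_apply, map_sub, map_smul, LinearMap.sub_apply, LinearMap.smul_apply,
    smul_eq_mul, hn, mform_symm n w]
  ring

lemma mform_triangleGroup (h : IsRegularPolygon p η x sh ch) {w : Mink ≃ₗ[ℝ] Mink}
    (hw : w ∈ triangleGroup h) (u v : Mink) : mform (w u) (w v) = mform u v := by
  induction hw using Subgroup.closure_induction generalizing u v with
  | mem w hw => obtain ⟨s, rfl⟩ := hw; exact mform_mreflect _ _ u v
  | one => rfl
  | mul a b _ _ ha hb => rw [LinearEquiv.mul_apply, LinearEquiv.mul_apply, ha, hb]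
  | inv a _ ha =>
    rw [← ha, ← LinearEquiv.mul_apply, ← LinearEquiv.mul_apply, mul_inv_cancel]
    rfl

lemma mform_apply_left (h : IsRegularPolygon p η x sh ch) {w : Mink ≃ₗ[ℝ] Mink}
    (hw : w ∈ triangleGroup h) (u v : Mink) : mform (w u) v = mform u (w⁻¹ v) := by
  rw [← mform_triangleGroup h hw u (w⁻¹ v), ← LinearEquiv.mul_apply w, mul_inv_cancel]
  rfl

/-- The symmetry group of the polygon preserves a set which is preserved by both generators. -/
lemma dihedralPart_mapsTo (h : IsRegularPolygon p η x sh ch) {T : Set Mink}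
    (h0 : ∀ v ∈ T, triangleRefl h 0 v ∈ T) (h1 : ∀ v ∈ T, triangleRefl h 1 v ∈ T)
    {u : Mink ≃ₗ[ℝ] Mink} (hu : u ∈ dihedralPart h) : ∀ v ∈ T, u v ∈ T := by
  have gen : ∀ g ∈ triangleRefl h '' {0, 1}, ∀ v ∈ T, g v ∈ T := by
    rintro _ ⟨s, hs, rfl⟩
    rcases hs with rfl | rfl
    · exact h0
    · exact h1
  induction hu using Subgroup.closure_induction_left with
  | one => exact fun v hv => hv
  | mul_left g hg y _ ih => exact fun v hv => gen g hg _ (ih v hv)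
  | inv_mul_cancel g hg y _ ih =>
    intro v hv
    have : g⁻¹ = g := by
      obtain ⟨s, -, rfl⟩ := hg
      exact mreflect_inv _ _
    rw [this]
    exact gen g hg _ (ih v hv)

lemma triangleRefl_zero_apply (h : IsRegularPolygon p η x sh ch) (v : Mink) :
    triangleRefl h 0 v = (v.1, -(starRingEnd ℂ) v.2) := by
  have := reflect_axis (g := 1) (by simp) v
  rw [one_pow, one_mul] at this
  rw [← this]
  exact mreflect_apply _ _ v

lemma midNormal_sq : (-Real.cos (Real.pi / p) + Real.sin (Real.pi / p) * Complex.I : ℂ) ^ 2 =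
    unitDir (1 : ZMod p) := by
  rw [unitDir_one]; ring

lemma triangleRefl_one_apply (h : IsRegularPolygon p η x sh ch) (v : Mink) :
    triangleRefl h 1 v = (v.1, -(unitDir (1 : ZMod p) * (starRingEnd ℂ) v.2)) := by
  have := reflect_axis (normSq_midNormal p) v
  rw [midNormal_sq] at this
  rw [← this]
  exact mreflect_apply _ _ v

lemma unitDir_one_mul_conj_midDir :
    unitDir (1 : ZMod p) * (starRingEnd ℂ) (midDir p) = -midDir p := by
  have h1 : (Real.sin (Real.pi / p) : ℂ) ^ 2 + (Real.cos (Real.pi / p) : ℂ) ^ 2 = 1 := by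
    exact_mod_cast Real.sin_sq_add_cos_sq (Real.pi / p)
  have hI := Complex.I_sq
  rw [unitDir_one, midDir]
  generalize (Real.sin (Real.pi / p) : ℝ) = S at h1 ⊢
  generalize (Real.cos (Real.pi / p) : ℝ) = C at h1 ⊢
  simp only [map_add, map_mul, Complex.conj_ofReal, Complex.conj_I]
  linear_combination (-(S : ℂ) - C * Complex.I) * h1 +
    (S * (C : ℂ) ^ 2 * 2 + (S : ℂ) ^ 3 - S ^ 2 * C * Complex.I) * hI

/-- The reflection in the line to vertex `0` sends side `k` to `-k - 1`, and the one in the line to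
the midpoint of side `0` sends it to `-k`. -/
lemma dihedralPart_sideNormal (h : IsRegularPolygon p η x sh ch) {u : Mink ≃ₗ[ℝ] Mink}
    (hu : u ∈ dihedralPart h) (k : ZMod p) :
    ∃ j : ZMod p, u (sideNormal sh ch k) = sideNormal sh ch j := by
  have hm := unitDir_one_mul_conj_midDir (p := p)
  have h0 : ∀ v ∈ Set.range (sideNormal sh ch : ZMod p → Mink),
      triangleRefl h 0 v ∈ Set.range (sideNormal sh ch : ZMod p → Mink) := by
    rintro _ ⟨k, rfl⟩
    refine ⟨-k + -1, ?_⟩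
    have h1 := mul_conj_of_normSq (normSq_unitDir (1 : ZMod p))
    rw [triangleRefl_zero_apply, sideNormal, sideNormal, unitDir_add, unitDir_neg, unitDir_neg]
    ext1
    · rfl
    · simp only [map_mul, map_neg, Complex.conj_ofReal]
      linear_combination -ch * (starRingEnd ℂ) (unitDir k) *
        ((starRingEnd ℂ) (unitDir (1 : ZMod p)) * hm - (starRingEnd ℂ) (midDir p) * h1)
  have h1 : ∀ v ∈ Set.range (sideNormal sh ch : ZMod p → Mink),
      triangleRefl h 1 v ∈ Set.range (sideNormal sh ch : ZMod p → Mink) := by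
    rintro _ ⟨k, rfl⟩
    refine ⟨-k, ?_⟩
    rw [triangleRefl_one_apply, sideNormal, sideNormal, unitDir_neg]
    ext1
    · rfl
    · simp only [map_mul, map_neg, Complex.conj_ofReal]
      linear_combination -ch * (starRingEnd ℂ) (unitDir k) * hm
  obtain ⟨j, hj⟩ := dihedralPart_mapsTo h h0 h1 hu _ ⟨k, rfl⟩
  exact ⟨j, hj.symm⟩

lemma dihedralPart_vertexVec (h : IsRegularPolygon p η x sh ch) {u : Mink ≃ₗ[ℝ] Mink}
    (hu : u ∈ dihedralPart h) (k : ZMod p) :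
    ∃ j : ZMod p, u (vertexVec x k) = vertexVec x j := by
  have hx : x ^ 2 < 1 := by linarith [h.sq_lt]
  have h0 : ∀ v ∈ Set.range (vertexVec x : ZMod p → Mink),
      triangleRefl h 0 v ∈ Set.range (vertexVec x : ZMod p → Mink) := by
    rintro _ ⟨k, rfl⟩
    refine ⟨-k, ?_⟩
    rw [triangleRefl_zero_apply, vertexVec_eq hx, vertexVec_eq hx, unitDir_neg]
    ext1
    · rfl
    · simp [Complex.conj_ofNat]
  have h1 : ∀ v ∈ Set.range (vertexVec x : ZMod p → Mink),
      triangleRefl h 1 v ∈ Set.range (vertexVec x : ZMod p → Mink) := by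
    rintro _ ⟨k, rfl⟩
    refine ⟨1 + -k, ?_⟩
    rw [triangleRefl_one_apply, vertexVec_eq hx, vertexVec_eq hx, unitDir_add, unitDir_neg]
    ext1
    · rfl
    · simp [Complex.conj_ofNat]; ring
  obtain ⟨j, hj⟩ := dihedralPart_mapsTo h h0 h1 hu _ ⟨k, rfl⟩
  exact ⟨j, hj.symm⟩

lemma dihedralPart_mem_polygonCone (h : IsRegularPolygon p η x sh ch) {u : Mink ≃ₗ[ℝ] Mink}
    (hu : u ∈ dihedralPart h) {v : Mink} (hv : v ∈ polygonCone sh ch p) :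
    u v ∈ polygonCone sh ch p := by
  intro k
  obtain ⟨j, hj⟩ := dihedralPart_sideNormal h (inv_mem hu) k
  rw [mform_apply_left h (dihedralPart_le h hu), hj]
  exact hv j

lemma dihedralPart_mem_polygonCone_iff (h : IsRegularPolygon p η x sh ch) {u : Mink ≃ₗ[ℝ] Mink}
    (hu : u ∈ dihedralPart h) {v : Mink} :
    u v ∈ polygonCone sh ch p ↔ v ∈ polygonCone sh ch p := by
  refine ⟨fun hv => ?_, dihedralPart_mem_polygonCone h hu⟩
  have := dihedralPart_mem_polygonCone h (inv_mem hu) hv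
  rwa [← LinearEquiv.mul_apply, inv_mul_cancel] at this

/-- The rotations of the polygon belong to its symmetry group. -/
lemma exists_rotation (h : IsRegularPolygon p η x sh ch) (k : ZMod p) :
    ∃ u ∈ dihedralPart h, ∀ v : Mink, u v = (v.1, unitDir k * v.2) := by
  have key : ∀ n : ℕ, ∃ u ∈ dihedralPart h, ∀ v : Mink, u v = (v.1, unitDir (n : ZMod p) * v.2) := by
    intro n
    induction n with
    | zero => exact ⟨1, one_mem _, fun v => by simp⟩
    | succ n ih =>
      obtain ⟨u, hu, huv⟩ := ih
      refine ⟨triangleRefl h 1 * triangleRefl h 0 * u,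
        mul_mem (mul_mem (triangleRefl_one_mem h) (triangleRefl_zero_mem h)) hu, fun v => ?_⟩
      rw [LinearEquiv.mul_apply, LinearEquiv.mul_apply, huv, triangleRefl_zero_apply,
        triangleRefl_one_apply, Nat.cast_succ, unitDir_add]
      ext1
      · rfl
      · simp; ring
  have := key k.val
  rwa [ZMod.natCast_zmod_val] at this

lemma mreflect_conj (h : IsRegularPolygon p η x sh ch) {u : Mink ≃ₗ[ℝ] Mink}
    (hu : u ∈ triangleGroup h) {n m : Mink} (hn : mform n n = 1) (hm : mform m m = 1)
    (e : u n = m) : mreflect m hm = u * mreflect n hn * u⁻¹ := by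
  rw [eq_mul_inv_iff_mul_eq]
  ext v : 1
  rw [LinearEquiv.mul_apply, LinearEquiv.mul_apply, mreflect_apply, mreflect_apply, map_sub,
    map_smul, ← e, mform_triangleGroup h hu]

lemma mform_axis_unitDir (k : ZMod p) : mform (0, unitDir k) (0, unitDir k) = 1 := by
  rw [mform_axis, normSq_unitDir]

lemma axisReflect_mem (h : IsRegularPolygon p η x sh ch) (k : ZMod p) :
    mreflect (0, unitDir k) (mform_axis_unitDir k) ∈ dihedralPart h := by
  obtain ⟨u, hu, huv⟩ := exists_rotation h k
  have e : u (triangleRoot sh ch p 0) = (0, unitDir k) := by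
    rw [huv]; simp [triangleRoot]
  rw [mreflect_conj h (dihedralPart_le h hu) (triangleRoot_norm h 0) _ e]
  exact mul_mem (mul_mem hu (triangleRefl_zero_mem h)) (inv_mem hu)

lemma exists_apply_root_two (h : IsRegularPolygon p η x sh ch) (k : ZMod p) :
    ∃ u ∈ dihedralPart h, u (triangleRoot sh ch p 2) = sideNormal sh ch k := by
  obtain ⟨u, hu, huv⟩ := exists_rotation h k
  refine ⟨u, hu, ?_⟩
  rw [huv]
  change ((sideNormal sh ch (0 : ZMod p)).1, unitDir k * (sideNormal sh ch (0 : ZMod p)).2) = _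
  rw [sideNormal, sideNormal, unitDir_zero]
  ext1
  · rfl
  · simp only; ring

lemma sideReflect_mem (h : IsRegularPolygon p η x sh ch) (k : ZMod p) :
    mreflect (sideNormal sh ch k) (mform_sideNormal_self h k) ∈ triangleGroup h := by
  obtain ⟨u, hu, e⟩ := exists_apply_root_two h k
  have hu' := dihedralPart_le h hu
  rw [mreflect_conj h hu' (triangleRoot_norm h 2) _ e]
  exact mul_mem (mul_mem hu' (triangleRefl_mem h 2)) (inv_mem hu')

/-- The product of reflections that describes the rotation about the vertex `k`. -/
noncomputable def vertexRot (h : IsRegularPolygon p η x sh ch) (k : ZMod p) : Mink ≃ₗ[ℝ] Mink :=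
  mreflect (sideNormal sh ch k) (mform_sideNormal_self h k) *
    mreflect (0, unitDir k) (mform_axis_unitDir k)

lemma vertexRot_mem (h : IsRegularPolygon p η x sh ch) (k : ZMod p) :
    vertexRot h k ∈ triangleGroup h :=
  mul_mem (sideReflect_mem h k) (dihedralPart_le h (axisReflect_mem h k))

/-- Modulo symmetries of the polygon, crossing side `k` by reflection is the same as crossing it by
rotation about vertex `k`. -/
lemma sideReflect_eq (h : IsRegularPolygon p η x sh ch) (k : ZMod p) :
    mreflect (sideNormal sh ch k) (mform_sideNormal_self h k) =
      vertexRot h k * mreflect (0, unitDir k) (mform_axis_unitDir k) := by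
  rw [vertexRot, mul_assoc, mreflect_mul_self, mul_one]

/-- The line from the centre to vertex `k` meets side `k` at half the vertex angle, `η`, so the
product of the two reflections turns by `2η`. Translated from the vertex to the origin, the two
normals are `unitDir k` and `-unitDir k exp (iη)`, the sign giving the inner normal of the side. -/
lemma baseVec_rotAbout_vertex (h : IsRegularPolygon p η x sh ch) (k : ZMod p) (Z : Space) :
    baseVec (rotAbout (vertexPt h k) (2 * η) Z) = vertexRot h k (baseVec Z) := by
  have hx : x ^ 2 < 1 := by linarith [h.sq_lt]
  have hκ : coshFactor (vertexPt h k : ℂ) ^ 2 = (1 - x ^ 2)⁻¹ := by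
    change coshFactor (Complex.I * x * unitDir k) ^ 2 = _
    rw [coshFactor, normSq_vertex, inv_pow, Real.sq_sqrt (by linarith)]
  have hE := mul_conj_of_normSq (normSq_unitDir k)
  have hI := Complex.I_sq
  have hne := h.sq_lt.ne'
  have hne' : (1 - (x : ℂ) ^ 2) ≠ 0 := by exact_mod_cast hne
  have hexp : Complex.exp (η * Complex.I) = Real.cos η + Real.sin η * Complex.I := by
    rw [Complex.exp_mul_I, Complex.ofReal_cos, Complex.ofReal_sin]
  have hA : (vertexPt h k : ℂ) = Complex.I * x * unitDir k := rfl
  refine baseVec_rotAbout (vertexPt h k) (e := unitDir k)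
    (f := -(unitDir k * Complex.exp (η * Complex.I))) (normSq_unitDir k) ?_ ?_ ?_ ?_
    (mform_axis_unitDir k) (mform_sideNormal_self h k) Z
  · rw [Complex.normSq_neg, map_mul, normSq_unitDir, normSq_exp_mul_I, one_mul]
  · have : -(unitDir k * Complex.exp (η * Complex.I)) * (starRingEnd ℂ) (unitDir k) =
        -Complex.exp (η * Complex.I) := by
      linear_combination -Complex.exp (η * Complex.I) * hE
    rw [this, neg_sq, ← Complex.exp_nat_mul]
    congr 1
    push_cast; ring
  · have e1 : unitDir k * (starRingEnd ℂ) (Complex.I * x * unitDir k) = -(x * Complex.I) := by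
      simp only [map_mul, Complex.conj_I, Complex.conj_ofReal]
      linear_combination -(Complex.I * x) * hE
    rw [hκ, hA]
    ext1
    · simp only [mtransl, LinearMap.coe_mk, AddHom.coe_mk, Prod.smul_fst, e1]
      simp
    · simp only [mtransl, LinearMap.coe_mk, AddHom.coe_mk, Prod.smul_snd, Complex.real_smul]
      push_cast
      field_simp
      linear_combination -(x : ℂ) ^ 2 * Complex.I ^ 2 * unitDir k * hE - x ^ 2 * unitDir k * hI
  · have e1 : -(unitDir k * Complex.exp (η * Complex.I)) *
        (starRingEnd ℂ) (Complex.I * x * unitDir k) =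
        x * (Real.cos η * Complex.I - Real.sin η) := by
      rw [hexp]
      simp only [map_mul, Complex.conj_I, Complex.conj_ofReal]
      linear_combination (Real.cos η + Real.sin η * Complex.I) * (Complex.I * x) * hE +
        x * Real.sin η * hI
    have hm : (ch : ℂ) * midDir p =
        Real.cos η + (1 - x ^ 2 : ℂ)⁻¹ * (Real.sin η * (1 + x ^ 2)) * Complex.I := by
      have c1 : (ch : ℂ) * Real.sin (Real.pi / p) = Real.cos η := by exact_mod_cast h.ch_mul_sin
      have c2 : (ch : ℂ) * Real.cos (Real.pi / p) * (1 - x ^ 2) = Real.sin η * (1 + x ^ 2) := by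
        exact_mod_cast h.ch_mul_cos
      rw [← c2, ← c1, midDir]
      field_simp
    rw [hκ, hA]
    ext1
    · simp only [mtransl, LinearMap.coe_mk, AddHom.coe_mk, Prod.smul_fst, smul_eq_mul, e1,
        sideNormal, Complex.re_ofReal_mul]
      have : (Real.cos η * Complex.I - Real.sin η : ℂ).re = -Real.sin η := by
        rw [Complex.sub_re, Complex.re_ofReal_mul, Complex.I_re, Complex.ofReal_re]; ring
      rw [this]
      field_simp
      linear_combination -h.sh_mul
    · have : -((ch : ℂ) * (unitDir k * midDir p)) = -unitDir k * (ch * midDir p) := by ring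
      simp only [mtransl, LinearMap.coe_mk, AddHom.coe_mk, Prod.smul_snd, Complex.real_smul,
        sideNormal]
      rw [this, hm, hexp]
      simp only [map_neg, map_mul, map_add, Complex.conj_I, Complex.conj_ofReal]
      push_cast
      field_simp
      linear_combination (Complex.I ^ 2 * x ^ 2 * unitDir k *
        (Complex.cos η - Complex.sin η * Complex.I)) * hE +
        (x ^ 2 * unitDir k * (Complex.cos η - Complex.sin η * Complex.I)) * hI

end TriangleGroup

/-! ### The tiling -/

section Tiling

variable {p : ℕ} [NeZero p] {η x sh ch : ℝ}

/-- A unit timelike vector in the interior of the characteristic triangle. -/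
lemma exists_interior_vector (h : IsRegularPolygon p η x sh ch) :
    ∃ ρ ∈ forwardCone, mform ρ ρ = -1 ∧ ∀ s, 0 < mform ρ (triangleRoot sh ch p s) := by
  have hS := h.sin_pos
  have hC := h.cos_pos
  have hsh := h.sh_pos
  have hch := h.ch_pos
  have hsq := h.ch_sq_sub
  have hC1 : Real.cos (Real.pi / p) ≤ 1 := Real.cos_le_one _
  have hSC := Real.sin_sq_add_cos_sq (Real.pi / p)
  -- The vector leans by a small amount from the centre along the bisector of the directions to the
  -- vertex and to the midpoint. This `ε` keeps it inside the side, as `ch ε (1 + cos (π/p)) ≤ sh /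
  -- 2`, and timelike, as `ε ≤ 1/4`.
  set ε := sh / (4 * ch) with hε
  have hε0 : 0 < ε := by positivity
  have hεch : 4 * (ch * ε) = sh := by rw [hε]; field_simp
  have hε1 : ε ≤ 1 / 4 := by rw [hε, div_le_iff₀ (by positivity)]; nlinarith
  let v : Mink := (1, ⟨ε * Real.sin (Real.pi / p), ε * (1 + Real.cos (Real.pi / p))⟩)
  have hv : v ∈ forwardCone := by
    refine ⟨?_, one_pos⟩
    have : mform v v = ε ^ 2 * (2 + 2 * Real.cos (Real.pi / p)) - 1 := by
      simp only [v, mform_apply]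
      linear_combination ε ^ 2 * hSC
    rw [this]
    nlinarith
  obtain ⟨Z, t, ht, e⟩ := exists_baseVec hv
  refine ⟨baseVec Z, baseVec_mem Z, mform_baseVec Z, fun s => ?_⟩
  rw [e, map_smul, LinearMap.smul_apply, smul_eq_mul]
  refine mul_pos ht ?_
  fin_cases s
  · have : mform v (triangleRoot sh ch p 0) = ε * Real.sin (Real.pi / p) := by
      simp [v, mform_apply, triangleRoot]
    exact this ▸ mul_pos hε0 hS
  · have : mform v (triangleRoot sh ch p 1) = ε * Real.sin (Real.pi / p) := by
      simp only [v, triangleRoot]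
      generalize Real.sin (Real.pi / p) = S
      generalize Real.cos (Real.pi / p) = C
      simp [mform_apply]
      ring
    exact this ▸ mul_pos hε0 hS
  · have : mform v (triangleRoot sh ch p 2) = sh - ch * ε * (1 + Real.cos (Real.pi / p)) := by
      simp only [v, triangleRoot, sideNormal, midDir, unitDir_zero]
      generalize Real.sin (Real.pi / p) = S at hSC ⊢
      generalize Real.cos (Real.pi / p) = C at hSC ⊢
      simp [mform_apply]
      linear_combination -ch * ε * hSC
    refine this ▸ ?_
    nlinarith [mul_pos hch hε0]

/-! ### The polygon against the triangle, and common vectors of two copies. -/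

lemma mem_chamber_of_mem {v : Mink}
    (h0 : 0 ≤ mform v (triangleRoot sh ch p 0)) (h1 : 0 ≤ mform v (triangleRoot sh ch p 1))
    (hv : v ∈ polygonCone sh ch p) : v ∈ chamber mform (triangleRoot sh ch p) := by
  intro s
  fin_cases s
  · exact h0
  · exact h1
  · exact hv 0

lemma axis_mem_chamber (h : IsRegularPolygon p η x sh ch) :
    ((1, 0) : Mink) ∈ chamber mform (triangleRoot sh ch p) := by
  intro s
  fin_cases s
  · simp [mform_apply, triangleRoot]
  · simp [mform_apply, triangleRoot]
  · simp [mform_apply, triangleRoot, sideNormal, h.sh_pos.le]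

lemma triangleGroup_mem_forwardCone {q : ℕ} (hq : 2 ≤ q)
    (h : IsRegularPolygon p (Real.pi / q) x sh ch)
    {w : Mink ≃ₗ[ℝ] Mink} (hw : w ∈ triangleGroup h) {v : Mink}
    (hv : v ∈ forwardCone) : w v ∈ forwardCone :=
  word_mem_forwardCone (coxeterRoots_triangle hq h) hw hv

/-- The characteristic triangle is part of the polygon. -/
lemma chamber_subset_polygonCone {q : ℕ} (hq : 2 ≤ q)
    (h : IsRegularPolygon p (Real.pi / q) x sh ch) :
    chamber mform (triangleRoot sh ch p) ⊆ polygonCone sh ch p := by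
  have hcox := coxeterRoots_triangle hq h
  intro v hv k
  obtain ⟨u, hu, e⟩ := exists_apply_root_two h k
  have hu' := dihedralPart_le h hu
  rw [← e]
  rcases le_or_gt (wordLength (triangleRefl h) u)
    (wordLength (triangleRefl h) (u * triangleRefl h 2)) with hle | hgt
  · exact hcox.root_nonneg hu' 2 hle v hv
  -- If the side reflection shortened `u`, the side normal would be nonpositive on the chamber; but
  -- at the centre, which lies in the chamber, it takes the value `sh > 0`.
  · exfalso
    have e2 : u * triangleRefl h 2 * triangleRefl h 2 = u := by
      rw [mul_assoc, hcox.mul_self, mul_one]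
    have := hcox.root_nonneg (mul_mem hu' (triangleRefl_mem h 2)) 2 (by rw [e2]; exact hgt.le)
      _ (axis_mem_chamber h)
    rw [LinearEquiv.mul_apply, hcox.apply_root, map_neg, e, map_neg] at this
    simp [mform_apply, sideNormal] at this
    linarith [h.sh_pos]

/-- Every timelike vector of the polygon is moved into the characteristic triangle by a symmetry
of the polygon. -/
lemma exists_dihedral_chamber {q : ℕ} (hq : 2 ≤ q)
    (h : IsRegularPolygon p (Real.pi / q) x sh ch)
    {v : Mink} (hv : v ∈ forwardCone) (hP : v ∈ polygonCone sh ch p) :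
    ∃ u ∈ dihedralPart h, ∃ y ∈ chamber mform (triangleRoot sh ch p), v = u y := by
  obtain ⟨ρ, hρ, hρ1, hpos⟩ := exists_interior_vector h
  obtain ⟨w, hw, hI⟩ := exists_mem_chamber (coxeterRoots_triangle hq h) hρ hρ1 hpos {0, 1} hv
  refine ⟨w⁻¹, inv_mem hw, w v, mem_chamber_of_mem (hI 0 (by simp)) (hI 1 (by simp))
    (dihedralPart_mem_polygonCone h hw hP), ?_⟩
  rw [← LinearEquiv.mul_apply, inv_mul_cancel]
  rfl

/-- The group elements that identify two vectors of the polygon. -/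
lemma exists_decomposition {q : ℕ} (hq : 2 ≤ q)
    (h : IsRegularPolygon p (Real.pi / q) x sh ch)
    {w : Mink ≃ₗ[ℝ] Mink} (hw : w ∈ triangleGroup h) {v y : Mink}
    (hv : v ∈ forwardCone) (hvP : v ∈ polygonCone sh ch p) (hyP : y ∈ polygonCone sh ch p)
    (e : v = w y) :
    ∃ u ∈ dihedralPart h, ∃ u' ∈ dihedralPart h, ∃ z ∈ chamber mform (triangleRoot sh ch p),
      ∃ g ∈ Subgroup.closure (triangleRefl h '' {s | mform z (triangleRoot sh ch p s) = 0}),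
        v = u z ∧ y = u' z ∧ w = u * g * u'⁻¹ := by
  have hy : y ∈ forwardCone := by
    have := triangleGroup_mem_forwardCone hq h (inv_mem hw) hv
    rwa [e, ← LinearEquiv.mul_apply, inv_mul_cancel] at this
  obtain ⟨u, hu, z, hz, e1⟩ := exists_dihedral_chamber hq h hv hvP
  obtain ⟨u', hu', z', hz', e2⟩ := exists_dihedral_chamber hq h hy hyP
  have hg : u⁻¹ * w * u' ∈ triangleGroup h :=
    mul_mem (mul_mem (inv_mem (dihedralPart_le h hu)) hw) (dihedralPart_le h hu')
  have e3 : (u⁻¹ * w * u') z' = z := by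
    rw [LinearEquiv.mul_apply, LinearEquiv.mul_apply, ← e2, ← e, e1, ← LinearEquiv.mul_apply,
      inv_mul_cancel]
    rfl
  obtain ⟨rfl, h2⟩ := (coxeterRoots_triangle hq h).eq_and_mem_stabilizer hg hz' hz e3
  exact ⟨u, hu, u', hu', z', hz, _, h2, e1, e2, by group⟩

/-- For `z` off the side, only the two walls through the centre can contain `z`. Hence copies of the
polygon sharing such a vector coincide. -/
lemma closure_le_dihedralPart (h : IsRegularPolygon p η x sh ch) {z : Mink}
    (hz : mform z (triangleRoot sh ch p 2) ≠ 0) :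
    Subgroup.closure (triangleRefl h '' {s | mform z (triangleRoot sh ch p s) = 0}) ≤
      dihedralPart h := by
  apply Subgroup.closure_mono
  apply Set.image_mono
  intro s hs
  fin_cases s
  · simp
  · simp
  · exact absurd hs hz

/-- Off the line to the vertex, only the side and the line to its midpoint can contain `z`. These
are orthogonal, so their reflections commute and the side reflection can be moved to the front. -/
lemma mem_dihedralPart_or_of_ne_zero {q : ℕ} (hq : 2 ≤ q)
    (h : IsRegularPolygon p (Real.pi / q) x sh ch)
    {z : Mink} (hz : mform z (triangleRoot sh ch p 0) ≠ 0)
    {g : Mink ≃ₗ[ℝ] Mink}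
    (hg : g ∈ Subgroup.closure (triangleRefl h '' {s | mform z (triangleRoot sh ch p s) = 0})) :
    g ∈ dihedralPart h ∨ ∃ d ∈ dihedralPart h, g = triangleRefl h 2 * d := by
  have hcox := coxeterRoots_triangle hq h
  have comm : triangleRefl h 1 * triangleRefl h 2 = triangleRefl h 2 * triangleRefl h 1 := by
    have e : mform (triangleRoot sh ch p 1) (triangleRoot sh ch p 2) = 0 := by
      simp only [triangleRoot, sideNormal, midDir, unitDir_zero]
      generalize Real.sin (Real.pi / p) = S
      generalize Real.cos (Real.pi / p) = C
      simp [mform_apply]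
      ring
    have e' : mform (triangleRoot sh ch p 2) (triangleRoot sh ch p 1) = 0 := by
      rw [mform_symm, e]
    ext v : 1
    rw [LinearEquiv.mul_apply, LinearEquiv.mul_apply]
    simp only [hcox.apply, map_sub, map_smul, LinearMap.sub_apply, LinearMap.smul_apply, e, e',
      smul_eq_mul]
    module
  have step : ∀ a ∈ triangleRefl h '' {s | mform z (triangleRoot sh ch p s) = 0}, ∀ y,
      (y ∈ dihedralPart h ∨ ∃ d ∈ dihedralPart h, y = triangleRefl h 2 * d) →
      (a * y ∈ dihedralPart h ∨ ∃ d ∈ dihedralPart h, a * y = triangleRefl h 2 * d) := by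
    rintro _ ⟨s, hs, rfl⟩ y hy
    fin_cases s
    · exact absurd hs hz
    · rcases hy with hy | ⟨d, hd, rfl⟩
      · exact Or.inl (mul_mem (triangleRefl_one_mem h) hy)
      · refine Or.inr ⟨_, mul_mem (triangleRefl_one_mem h) hd, ?_⟩
        change triangleRefl h 1 * (triangleRefl h 2 * d) = _
        rw [← mul_assoc, comm, mul_assoc]
    · rcases hy with hy | ⟨d, hd, rfl⟩
      · exact Or.inr ⟨y, hy, rfl⟩
      · left
        change triangleRefl h 2 * (triangleRefl h 2 * d) ∈ _
        rwa [← mul_assoc, hcox.mul_self, one_mul]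
  induction hg using Subgroup.closure_induction_left with
  | one => exact Or.inl (one_mem _)
  | mul_left a ha y _ ih => exact step a ha y ih
  | inv_mul_cancel a ha y _ ih =>
    have : a⁻¹ = a := by
      obtain ⟨s, -, rfl⟩ := ha
      exact hcox.inv_eq s
    rw [this]
    exact step a ha y ih

/-- Two copies of the polygon meet along a side, or only in vertices. -/
lemma side_or_vertex {q : ℕ} (hq : 2 ≤ q)
    (h : IsRegularPolygon p (Real.pi / q) x sh ch)
    {w : Mink ≃ₗ[ℝ] Mink} (hw : w ∈ triangleGroup h)
    (hwD : w ∉ dihedralPart h) :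
    (∃ u ∈ dihedralPart h, ∃ d ∈ dihedralPart h, w = u * triangleRefl h 2 * d) ∨
    ∀ v ∈ forwardCone, v ∈ polygonCone sh ch p → w⁻¹ v ∈ polygonCone sh ch p →
      ∃ (k : ZMod p) (b : ℝ), 0 < b ∧ v = b • vertexVec x k := by
  by_cases hA : ∃ u ∈ dihedralPart h, ∃ d ∈ dihedralPart h, w = u * triangleRefl h 2 * d
  · exact Or.inl hA
  right
  intro v hv hvP hyP
  obtain ⟨u, hu, u', hu', z, hz, g, hg, e1, e2, rfl⟩ := exists_decomposition hq h hw hv hvP hyP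
    (by rw [← LinearEquiv.mul_apply, mul_inv_cancel]; rfl)
  -- The representative `z` in the triangle must lie on the side, or else `w` is a symmetry of the
  -- polygon. It must also lie on the line to the vertex, or else `w` crosses a single side, which
  -- is excluded here.
  have h2 : mform z (triangleRoot sh ch p 2) = 0 := by
    by_contra hne
    exact hwD (mul_mem (mul_mem hu (closure_le_dihedralPart h hne hg)) (inv_mem hu'))
  have h0 : mform z (triangleRoot sh ch p 0) = 0 := by
    by_contra hne
    rcases mem_dihedralPart_or_of_ne_zero hq h hne hg with hgD | ⟨d, hd, rfl⟩
    · exact hwD (mul_mem (mul_mem hu hgD) (inv_mem hu'))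
    · exact hA ⟨u, hu, d * u'⁻¹, mul_mem hd (inv_mem hu'), by simp only [mul_assoc]⟩
  have hzf : z ∈ forwardCone := by
    have := triangleGroup_mem_forwardCone hq h (inv_mem (dihedralPart_le h hu)) hv
    rwa [e1, ← LinearEquiv.mul_apply, inv_mul_cancel] at this
  have hzP := chamber_subset_polygonCone hq h hz
  have hfix : triangleRefl h 0 z = z := by
    rw [(coxeterRoots_triangle hq h).apply, h0]; simp
  -- The reflection in the line to vertex `0` fixes `z` and exchanges the sides `0` and `-1`, so `z`
  -- lies on both and is a multiple of their common vertex.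
  have hprev : mform z (sideNormal sh ch (-1 : ZMod p)) = 0 := by
    have e : triangleRefl h 0 (sideNormal sh ch (0 : ZMod p)) = sideNormal sh ch (-1 : ZMod p) := by
      have hm := unitDir_one_mul_conj_midDir (p := p)
      have h1 := mul_conj_of_normSq (normSq_unitDir (1 : ZMod p))
      rw [triangleRefl_zero_apply, sideNormal, sideNormal, unitDir_neg, unitDir_zero]
      ext1
      · rfl
      · simp only [map_mul, map_neg, map_one, Complex.conj_ofReal]
        linear_combination (ch : ℂ) *
          ((starRingEnd ℂ) (unitDir (1 : ZMod p)) * hm - (starRingEnd ℂ) (midDir p) * h1)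
    rw [← e]
    conv_lhs => rw [← hfix]
    rw [triangleRefl, mform_mreflect]
    exact h2
  obtain ⟨b, hb, e⟩ := eq_smul_vertexVec h (-1) hzf.2 hzP hprev (by rw [neg_add_cancel]; exact h2)
  obtain ⟨k, hk⟩ := dihedralPart_vertexVec h hu (-1 + 1)
  exact ⟨k, b, hb, by rw [e1, e, map_smul, hk]⟩

/-- The homeomorphism `g` of the space induces the linear map `w` of the Minkowski space. -/
def Induces (g : Space ≃ₜ Space) (w : Mink ≃ₗ[ℝ] Mink) : Prop :=
  ∀ Z, baseVec (g Z) = w (baseVec Z)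

lemma Induces.mul {g g' : Space ≃ₜ Space} {w w' : Mink ≃ₗ[ℝ] Mink} (hg : Induces g w)
    (hg' : Induces g' w') : Induces (g * g') (w * w') := fun Z => by
  rw [LinearEquiv.mul_apply, ← hg', ← hg]; rfl

lemma Induces.inv {g : Space ≃ₜ Space} {w : Mink ≃ₗ[ℝ] Mink} (hg : Induces g w) :
    Induces g⁻¹ w⁻¹ := fun Z => by
  have := hg (g⁻¹ Z)
  rw [show g (g⁻¹ Z) = Z from g.apply_symm_apply Z] at this
  rw [this, ← LinearEquiv.mul_apply, inv_mul_cancel]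
  rfl

lemma Induces.mem_image_iff {g : Space ≃ₜ Space} {w : Mink ≃ₗ[ℝ] Mink} (hg : Induces g w)
    (T : Set Mink) (Y : Space) : Y ∈ g '' {Z | baseVec Z ∈ T} ↔ w⁻¹ (baseVec Y) ∈ T := by
  rw [← hg.inv Y]
  constructor
  · rintro ⟨Z, hZ, rfl⟩
    rw [show g⁻¹ (g Z) = Z from g.symm_apply_apply Z]
    exact hZ
  · intro hY
    exact ⟨g⁻¹ Y, hY, g.apply_symm_apply Y⟩

/-- The group generated by the rotations about the side fibre lines. -/
noncomputable def rotationGroup (h : IsRegularPolygon p η x sh ch) : Subgroup (Space ≃ₜ Space) :=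
  Subgroup.closure (Set.range fun k => rotAbout (vertexPt h k) (2 * η))

lemma rotAbout_mem (h : IsRegularPolygon p η x sh ch) (k : ZMod p) :
    rotAbout (vertexPt h k) (2 * η) ∈ rotationGroup h := Subgroup.subset_closure ⟨k, rfl⟩

lemma induces_rotAbout (h : IsRegularPolygon p η x sh ch) (k : ZMod p) :
    Induces (rotAbout (vertexPt h k) (2 * η)) (vertexRot h k) := baseVec_rotAbout_vertex h k

/-- Only existence matters: different elements of the rotation group may induce the same linear map,
and they then have the same tile. -/
lemma exists_induces (h : IsRegularPolygon p η x sh ch) {g : Space ≃ₜ Space}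
    (hg : g ∈ rotationGroup h) : ∃ w ∈ triangleGroup h, Induces g w := by
  induction hg using Subgroup.closure_induction with
  | mem g hg =>
    obtain ⟨k, rfl⟩ := hg
    exact ⟨_, vertexRot_mem h k, induces_rotAbout h k⟩
  | one => exact ⟨1, one_mem _, fun Z => rfl⟩
  | mul a b _ _ ha hb =>
    obtain ⟨w, hw, hwa⟩ := ha
    obtain ⟨w', hw', hwb⟩ := hb
    exact ⟨w * w', mul_mem hw hw', hwa.mul hwb⟩
  | inv a _ ha =>
    obtain ⟨w, hw, hwa⟩ := ha
    exact ⟨w⁻¹, inv_mem hw, hwa.inv⟩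

/-- The triangle group is the product of the rotation group and the symmetry group of the
polygon. -/
lemma exists_rotation_mul_dihedral (h : IsRegularPolygon p η x sh ch) {w : Mink ≃ₗ[ℝ] Mink}
    (hw : w ∈ triangleGroup h) :
    ∃ g ∈ rotationGroup h, ∃ w', Induces g w' ∧ ∃ u ∈ dihedralPart h, w = w' * u := by
  have step : ∀ s : Fin 3, ∀ w : Mink ≃ₗ[ℝ] Mink,
      (∃ g ∈ rotationGroup h, ∃ w', Induces g w' ∧ ∃ u ∈ dihedralPart h, w = w' * u) →
      ∃ g ∈ rotationGroup h, ∃ w', Induces g w' ∧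
        ∃ u ∈ dihedralPart h, w * triangleRefl h s = w' * u := by
    rintro s _ ⟨g, hg, w', hgw, u, hu, rfl⟩
    fin_cases s
    · exact ⟨g, hg, w', hgw, _, mul_mem hu (triangleRefl_zero_mem h), mul_assoc _ _ _⟩
    · exact ⟨g, hg, w', hgw, _, mul_mem hu (triangleRefl_one_mem h), mul_assoc _ _ _⟩
    -- Moved past `u`, the side reflection becomes the reflection in some side `k`, which is the
    -- rotation about vertex `k` times a symmetry of the polygon.
    · obtain ⟨k, hk⟩ := dihedralPart_sideNormal h hu 0
      have e := mreflect_conj h (dihedralPart_le h hu) (triangleRoot_norm h 2)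
        (mform_sideNormal_self h k) hk
      refine ⟨g * rotAbout (vertexPt h k) (2 * η), mul_mem hg (rotAbout_mem h k),
        w' * vertexRot h k, hgw.mul (induces_rotAbout h k), _,
        mul_mem (axisReflect_mem h k) hu, ?_⟩
      have e2 : mreflect (0, unitDir k) (mform_axis_unitDir k) =
          (vertexRot h k)⁻¹ * (u * triangleRefl h 2 * u⁻¹) := by
        rw [eq_inv_mul_iff_mul_eq, ← sideReflect_eq]
        exact e
      rw [e2]
      change w' * u * triangleRefl h 2 = _
      group
  induction hw using Subgroup.closure_induction_right with
  | one => exact ⟨1, one_mem _, 1, fun Z => rfl, 1, one_mem _, (one_mul 1).symm⟩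
  | mul_right y _ a ha ih =>
    obtain ⟨s, rfl⟩ := ha
    exact step s y ih
  | mul_inv_cancel y _ a ha ih =>
    obtain ⟨s, rfl⟩ := ha
    rw [show (triangleRefl h s)⁻¹ = triangleRefl h s from mreflect_inv _ _]
    exact step s y ih

/-! ### The rotations permute the side faces -/

lemma vertexRot_self (h : IsRegularPolygon p η x sh ch) (k : ZMod p) :
    vertexRot h k (vertexVec x k) = vertexVec x k := by
  have hx : x ^ 2 < 1 := by linarith [h.sq_lt]
  have hE := mul_conj_of_normSq (normSq_unitDir k)
  have e1 : mreflect (0, unitDir k) (mform_axis_unitDir k) (vertexVec x k) = vertexVec x k := by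
    rw [mreflect_apply, reflect_axis (normSq_unitDir k), vertexVec_eq hx]
    ext1
    · rfl
    · simp only [map_mul, Complex.conj_ofReal, Complex.conj_I, Complex.conj_ofNat]
      linear_combination (((1 - x ^ 2)⁻¹ : ℝ) : ℂ) * 2 * Complex.I * x * unitDir k * hE
  rw [vertexRot, LinearEquiv.mul_apply, e1, mreflect_apply, mform_vertex_eq_zero h]
  simp

/-- The line to vertex `k` exchanges its two neighbours, and the reflection in side `k` fixes the
end `k + 1`. -/
lemma vertexRot_prev (h : IsRegularPolygon p η x sh ch) (k : ZMod p) :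
    vertexRot h k (vertexVec x (k - 1)) = vertexVec x (k + 1) := by
  have hx : x ^ 2 < 1 := by linarith [h.sq_lt]
  have hE := mul_conj_of_normSq (normSq_unitDir k)
  have e1 : mreflect (0, unitDir k) (mform_axis_unitDir k) (vertexVec x (k - 1)) =
      vertexVec x (k + 1) := by
    rw [mreflect_apply, reflect_axis (normSq_unitDir k), vertexVec_eq hx, vertexVec_eq hx,
      unitDir_add, sub_eq_add_neg k 1, unitDir_add, unitDir_neg]
    ext1
    · rfl
    · simp only [map_mul, Complex.conj_ofReal, Complex.conj_I, Complex.conj_ofNat,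
        Complex.conj_conj]
      linear_combination (((1 - x ^ 2)⁻¹ : ℝ) : ℂ) * 2 * Complex.I * x * unitDir k *
        unitDir (1 : ZMod p) * hE
  rw [vertexRot, LinearEquiv.mul_apply, e1, mreflect_apply, mform_vertex_succ_eq_zero h]
  simp

lemma rotAbout_image_prismSide (h : IsRegularPolygon p η x sh ch) (k : ZMod p) :
    rotAbout (vertexPt h k) (2 * η) '' prismSide sh ch (k - 1) = prismSide sh ch k := by
  have e0 : ∀ Z, Z ∈ prismSide sh ch (k - 1) ↔ _ := mem_prismSide_iff h (k - 1)
  rw [sub_add_cancel] at e0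
  have e1 := vertexRot_self h k
  have e2 := vertexRot_prev h k
  have i1 : (vertexRot h k)⁻¹ (vertexVec x k) = vertexVec x (k : ZMod p) := by
    conv_lhs => rw [← e1]
    rw [← LinearEquiv.mul_apply, inv_mul_cancel]; rfl
  have i2 : (vertexRot h k)⁻¹ (vertexVec x (k + 1)) = vertexVec x (k - 1 : ZMod p) := by
    rw [← e2, ← LinearEquiv.mul_apply, inv_mul_cancel]; rfl
  ext Y
  constructor
  · rintro ⟨Z, hZ, rfl⟩
    obtain ⟨a, b, ha, hb, e⟩ := (e0 Z).1 hZ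
    refine (mem_prismSide_iff h k _).2 ⟨b, a, hb, ha, ?_⟩
    rw [induces_rotAbout h k, e, map_add, map_smul, map_smul, e1, e2, add_comm]
  · intro hY
    obtain ⟨a, b, ha, hb, e⟩ := (mem_prismSide_iff h k Y).1 hY
    refine ⟨(rotAbout (vertexPt h k) (2 * η))⁻¹ Y, (e0 _).2 ⟨b, a, hb, ha, ?_⟩,
      Homeomorph.apply_symm_apply _ Y⟩
    rw [(induces_rotAbout h k).inv, e, map_add, map_smul, map_smul, i1, i2, add_comm]

lemma exists_image_prismSide (h : IsRegularPolygon p η x sh ch) (i j : ZMod p) :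
    ∃ g ∈ rotationGroup h, g '' prismSide sh ch i = prismSide sh ch j := by
  have key : ∀ n : ℕ, ∃ g ∈ rotationGroup h, g '' prismSide sh ch i = prismSide sh ch (i + (n : ZMod p)) := by
    intro n
    induction n with
    | zero =>
      refine ⟨1, one_mem _, ?_⟩
      rw [Nat.cast_zero, add_zero]
      exact Set.image_id _
    | succ n ih =>
      obtain ⟨g, hg, e⟩ := ih
      refine ⟨rotAbout (vertexPt h (i + (n + 1))) (2 * η) * g,
        mul_mem (rotAbout_mem h _) hg, ?_⟩
      have := rotAbout_image_prismSide h (i + (n + 1) : ZMod p)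
      rw [show i + ((n : ZMod p) + 1) - 1 = i + n by ring, ← e, ← Set.image_comp] at this
      rw [Nat.cast_succ]
      exact this
  obtain ⟨g, hg, e⟩ := key (j - i).val
  refine ⟨g, hg, ?_⟩
  rw [e, ZMod.natCast_zmod_val, add_sub_cancel]

lemma isIsometry_of_mem_rotationGroup (h : IsRegularPolygon p η x sh ch) {g : Space ≃ₜ Space}
    (hg : g ∈ rotationGroup h) : IsIsometry g :=
  isIsometry_of_mem_closure (vertexPt h) (2 * η) hg

theorem isStandardRegularInfinitePrism (h : IsRegularPolygon p η x sh ch) :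
    IsStandardRegularInfinitePrism p x (prismVertex h) (prismSide sh ch) (prismSolid sh ch p) where
  toIsInfinitePrism := isInfinitePrism h
  param_pos := h.x_pos
  vertex_coord := hasHomCoord_prismVertex h
  side_congruent i j := by
    obtain ⟨g, hg, e⟩ := exists_image_prismSide h i j
    exact ⟨g, isIsometry_of_mem_rotationGroup h hg, e⟩

/-! ### The tiles -/

lemma image_prismSolid_eq (h : IsRegularPolygon p η x sh ch) {g g' : Space ≃ₜ Space}
    {w w' : Mink ≃ₗ[ℝ] Mink} (hg : Induces g w) (hg' : Induces g' w')
    (hD : w⁻¹ * w' ∈ dihedralPart h) :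
    g '' prismSolid sh ch p = g' '' prismSolid sh ch p := by
  ext Y
  rw [prismSolid, hg.mem_image_iff, hg'.mem_image_iff,
    ← dihedralPart_mem_polygonCone_iff h hD (v := w'⁻¹ (baseVec Y)), ← LinearEquiv.mul_apply,
    mul_inv_cancel_right]

lemma exists_mem_image_prismSolid {q : ℕ} (hq : 2 ≤ q)
    (h : IsRegularPolygon p (Real.pi / q) x sh ch) (Y : Space) :
    ∃ g ∈ rotationGroup h, Y ∈ g '' prismSolid sh ch p := by
  obtain ⟨ρ, hρ, hρ1, hpos⟩ := exists_interior_vector h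
  obtain ⟨w, hw, hI⟩ := exists_mem_chamber (coxeterRoots_triangle hq h) hρ hρ1 hpos Set.univ
    (baseVec_mem Y)
  rw [Set.image_univ] at hw
  have hwY : w (baseVec Y) ∈ polygonCone sh ch p :=
    chamber_subset_polygonCone hq h fun s => hI s trivial
  obtain ⟨g, hg, w', hgw, u, hu, e⟩ := exists_rotation_mul_dihedral h (inv_mem hw)
  refine ⟨g, hg, ?_⟩
  rw [prismSolid, hgw.mem_image_iff]
  have e2 : w'⁻¹ = u * w := by
    have : w = u⁻¹ * w'⁻¹ := by rw [← mul_inv_rev, ← e, inv_inv]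
    rw [this, mul_inv_cancel_left]
  rw [e2]
  exact dihedralPart_mem_polygonCone h hu hwY

lemma disjoint_interior_of_ne {q : ℕ} (hq : 2 ≤ q)
    (h : IsRegularPolygon p (Real.pi / q) x sh ch) {g g' : Space ≃ₜ Space}
    (hg : g ∈ rotationGroup h) (hg' : g' ∈ rotationGroup h)
    (hne : g '' prismSolid sh ch p ≠ g' '' prismSolid sh ch p) :
    Disjoint (interior (g '' prismSolid sh ch p)) (interior (g' '' prismSolid sh ch p)) := by
  rw [Set.disjoint_left]
  intro Y hY hY'
  obtain ⟨w, hw, hgw⟩ := exists_induces h hg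
  obtain ⟨w', hw', hgw'⟩ := exists_induces h hg'
  rw [← Homeomorph.image_interior, interior_prismSolid h] at hY
  obtain ⟨X, hX, rfl⟩ := hY
  have hY2 := interior_subset hY'
  rw [prismSolid, hgw'.mem_image_iff, hgw] at hY2
  obtain ⟨u, hu, u', hu', z, hz, a, ha, e1, e2, e3⟩ := exists_decomposition hq h
    (mul_mem (inv_mem hw) hw') (baseVec_mem X) (fun k => (hX k).le) hY2 (by
      rw [← LinearEquiv.mul_apply, ← LinearEquiv.mul_apply,
        show w⁻¹ * w' * w'⁻¹ * w = 1 by group]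
      rfl)
  -- An interior point of the first tile is on none of its sides, so its representative is off the
  -- side of the triangle and both tiles belong to the same coset.
  have h2 : mform z (triangleRoot sh ch p 2) ≠ 0 := by
    intro h0
    obtain ⟨k, hk⟩ := dihedralPart_sideNormal h hu 0
    have := hX k
    rw [e1, ← hk, mform_triangleGroup h (dihedralPart_le h hu)] at this
    exact this.ne' h0
  refine hne (image_prismSolid_eq h hgw hgw' ?_)
  rw [e3]
  exact mul_mem (mul_mem hu (closure_le_dihedralPart h h2 ha)) (inv_mem hu')

/-- A tile across side `k` satisfies the opposite inequality of that side, which leaves exactly the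
side. In the other case all common points lie over vertices. The face is one of the first tile;
exchanging the tiles gives the other half. -/
lemma exists_face_inter {q : ℕ} (hq : 2 ≤ q)
    (h : IsRegularPolygon p (Real.pi / q) x sh ch) {g g' : Space ≃ₜ Space}
    (hg : g ∈ rotationGroup h) (hg' : g' ∈ rotationGroup h)
    (hne : g '' prismSolid sh ch p ≠ g' '' prismSolid sh ch p) :
    g '' prismSolid sh ch p ∩ g' '' prismSolid sh ch p = ∅ ∨
      ∃ F ∈ prismFaces (prismVertex h) (prismSide sh ch),
        g '' prismSolid sh ch p ∩ g' '' prismSolid sh ch p = g '' F := by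
  obtain ⟨w, hw, hgw⟩ := exists_induces h hg
  obtain ⟨w', hw', hgw'⟩ := exists_induces h hg'
  have hmem : ∀ Y, Y ∈ g '' prismSolid sh ch p ∩ g' '' prismSolid sh ch p ↔
      w⁻¹ (baseVec Y) ∈ polygonCone sh ch p ∧
        (w⁻¹ * w')⁻¹ (w⁻¹ (baseVec Y)) ∈ polygonCone sh ch p := by
    intro Y
    rw [Set.mem_inter_iff, prismSolid, hgw.mem_image_iff, hgw'.mem_image_iff,
      ← LinearEquiv.mul_apply]
    simp
  have hD : w⁻¹ * w' ∉ dihedralPart h := fun hD => hne (image_prismSolid_eq h hgw hgw' hD)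
  have hforw : ∀ Y, w⁻¹ (baseVec Y) ∈ forwardCone := fun Y =>
    triangleGroup_mem_forwardCone hq h (inv_mem hw) (baseVec_mem Y)
  rcases side_or_vertex hq h (mul_mem (inv_mem hw) hw') hD with ⟨u, hu, d, hd, e⟩ | hB
  · right
    obtain ⟨k, hk⟩ := dihedralPart_sideNormal h hu 0
    have hcox := coxeterRoots_triangle hq h
    refine ⟨prismSide sh ch k, Or.inl ⟨k, rfl⟩, ?_⟩
    ext Y
    rw [hmem, e, prismSide]
    have : {Z | baseVec Z ∈ polygonCone sh ch p ∧ mform (baseVec Z) (sideNormal sh ch k) = 0} =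
        {Z | baseVec Z ∈ {v | v ∈ polygonCone sh ch p ∧ mform v (sideNormal sh ch k) = 0}} := rfl
    rw [this, hgw.mem_image_iff]
    generalize w⁻¹ (baseVec Y) = v
    have e2 : (u * triangleRefl h 2 * d)⁻¹ v = d⁻¹ (triangleRefl h 2 (u⁻¹ v)) := by
      rw [mul_inv_rev, mul_inv_rev, hcox.inv_eq]; rfl
    rw [e2, dihedralPart_mem_polygonCone_iff h (inv_mem hd)]
    have e3 : mform v (sideNormal sh ch k) = mform (u⁻¹ v) (triangleRoot sh ch p 2) := by
      rw [← hk, mform_apply_left h (inv_mem (dihedralPart_le h hu)), inv_inv]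
      rfl
    constructor
    · rintro ⟨hv, hv2⟩
      refine ⟨hv, le_antisymm ?_ (hv k)⟩
      have h0 : 0 ≤ mform (triangleRefl h 2 (u⁻¹ v)) (triangleRoot sh ch p 2) := hv2 0
      rw [mform_apply_left h (triangleRefl_mem h 2), hcox.inv_eq, hcox.apply_root, map_neg,
        ← e3] at h0
      linarith
    · rintro ⟨hv, hv0⟩
      refine ⟨hv, ?_⟩
      rw [hcox.apply, ← e3, hv0]
      simp only [mul_zero, zero_smul, sub_zero]
      exact dihedralPart_mem_polygonCone h (inv_mem hu) hv
  · rcases Set.eq_empty_or_nonempty (g '' prismSolid sh ch p ∩ g' '' prismSolid sh ch p) with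
      hemp | ⟨Y, hY⟩
    · exact Or.inl hemp
    right
    have hvert : ∀ Y ∈ g '' prismSolid sh ch p ∩ g' '' prismSolid sh ch p,
        ∃ k : ZMod p, w⁻¹ (baseVec Y) = vertexVec x k := by
      intro Y hY
      obtain ⟨h1, h2⟩ := (hmem Y).1 hY
      obtain ⟨k, b, hb, e⟩ := hB _ (hforw Y) h1 h2
      rw [← hgw.inv] at e ⊢
      exact ⟨k, eq_of_smul_baseVec (Z := prismVertex h k) hb e⟩
    obtain ⟨k, hk⟩ := hvert Y hY
    refine ⟨fibre (prismVertex h k), Or.inr ⟨k, rfl⟩, ?_⟩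
    have hfib : fibre (prismVertex h k) = {Z | baseVec Z ∈ ({vertexVec x k} : Set Mink)} := by
      ext Z; exact mem_fibre_iff
    ext X
    rw [hfib, hgw.mem_image_iff, Set.mem_singleton_iff]
    constructor
    · intro hX
      obtain ⟨j, hj⟩ := hvert X hX
      obtain ⟨hY1, hY2⟩ := (hmem Y).1 hY
      obtain ⟨hX1, hX2⟩ := (hmem X).1 hX
      -- By convexity the sum of two common vectors is common, hence a multiple of a single vertex
      -- `m`. The functions of the sides `m - 1` and `m` are nonnegative on both summands and vanish
      -- on the sum, so both summands are that vertex.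
      obtain ⟨m, b, hb, e⟩ := hB (w⁻¹ (baseVec Y) + w⁻¹ (baseVec X))
        (add_mem_forwardCone (hforw Y) (hforw X))
        (fun i => by rw [map_add, LinearMap.add_apply]; exact add_nonneg (hY1 i) (hX1 i))
        (fun i => by
          rw [map_add, map_add, LinearMap.add_apply]; exact add_nonneg (hY2 i) (hX2 i))
      have z1 : mform (b • vertexVec x m) (sideNormal sh ch m) = 0 := by
        rw [map_smul, LinearMap.smul_apply, mform_vertex_eq_zero h, smul_zero]
      have z2 : mform (b • vertexVec x m) (sideNormal sh ch (m - 1)) = 0 := by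
        have := mform_vertex_succ_eq_zero h (m - 1)
        rw [sub_add_cancel] at this
        rw [map_smul, LinearMap.smul_apply, this, smul_zero]
      rw [← e, map_add, LinearMap.add_apply] at z1 z2
      have key : ∀ v : Space, w⁻¹ (baseVec v) ∈ polygonCone sh ch p →
          mform (w⁻¹ (baseVec v)) (sideNormal sh ch (m - 1)) = 0 →
          mform (w⁻¹ (baseVec v)) (sideNormal sh ch m) = 0 →
          w⁻¹ (baseVec v) = vertexVec x m := by
        intro v h1 h2 h3
        obtain ⟨c, hc, e⟩ := eq_smul_vertexVec h (m - 1) (hforw v).2 h1 h2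
          (by rw [sub_add_cancel]; exact h3)
        rw [sub_add_cancel] at e
        rw [← hgw.inv] at e ⊢
        exact eq_of_smul_baseVec (Z := prismVertex h m) hc e
      have a1 := hY1 m
      have a2 := hX1 m
      have a3 := hY1 (m - 1)
      have a4 := hX1 (m - 1)
      rw [key X hX1 (by linarith) (by linarith), ← key Y hY1 (by linarith) (by linarith), hk]
    · intro hX
      rw [hmem] at hY ⊢
      rwa [hX, ← hk]

theorem isFaceToFace {q : ℕ} (hq : 2 ≤ q) (h : IsRegularPolygon p (Real.pi / q) x sh ch) :
    IsFaceToFace (rotationGroup h) (prismVertex h) (prismSide sh ch) (prismSolid sh ch p) := by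
  intro g hg g' hg' hne
  rcases exists_face_inter hq h hg hg' hne with he | h1
  · exact Or.inl he
  rcases exists_face_inter hq h hg' hg hne.symm with he | h2
  · exact Or.inl (by rw [Set.inter_comm]; exact he)
  exact Or.inr ⟨h1, by rw [Set.inter_comm]; exact h2⟩

theorem isTiling {q : ℕ} (hq : 2 ≤ q) (h : IsRegularPolygon p (Real.pi / q) x sh ch) :
    IsTiling (orbitTiles (rotationGroup h) (prismSolid sh ch p)) where
  closed := by
    rintro _ ⟨g, -, rfl⟩
    exact g.isClosedMap _ isClosed_prismSolid
  cover := by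
    rw [Set.eq_univ_iff_forall]
    intro Y
    obtain ⟨g, hg, hY⟩ := exists_mem_image_prismSolid hq h Y
    exact ⟨_, ⟨g, hg, rfl⟩, hY⟩
  disjoint := by
    rintro _ ⟨g, hg, rfl⟩ _ ⟨g', hg', rfl⟩ hne
    exact disjoint_interior_of_ne hq h hg hg' hne

theorem isMonohedral (h : IsRegularPolygon p η x sh ch) :
    IsMonohedral (orbitTiles (rotationGroup h) (prismSolid sh ch p)) := by
  rintro _ ⟨g, hg, rfl⟩ _ ⟨g', hg', rfl⟩
  refine ⟨g' * g⁻¹, isIsometry_of_mem_rotationGroup h (mul_mem hg' (inv_mem hg)), ?_⟩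
  rw [← Set.image_comp]
  apply Set.image_congr
  intro Z _
  change g' (g⁻¹ (g Z)) = g' Z
  rw [show g⁻¹ (g Z) = Z from g.symm_apply_apply Z]

theorem isRegularInfinitePrism_of_mem (h : IsRegularPolygon p η x sh ch) :
    ∀ Q ∈ orbitTiles (rotationGroup h) (prismSolid sh ch p), IsRegularInfinitePrism p Q := by
  rintro _ ⟨g, hg, rfl⟩
  exact ⟨x, _, _, _, g, isStandardRegularInfinitePrism h, isIsometry_of_mem_rotationGroup h hg, rfl⟩

end Tiling

/-- The regular polygon with `p` vertices and the vertex angle `2 π / q`. -/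
lemma exists_regularPolygon {p q : ℕ} (hp : 3 ≤ p) (hq : 2 * (p : ℝ) / ((p : ℝ) - 2) < (q : ℝ)) :
    3 ≤ q ∧ ∃ x sh ch, IsRegularPolygon p (Real.pi / q) x sh ch := by
  have hp3 : (3 : ℝ) ≤ p := by exact_mod_cast hp
  have hp2 : (0 : ℝ) < p - 2 := by linarith
  rw [div_lt_iff₀ hp2] at hq
  have hq2 : (2 : ℝ) < q := by
    by_contra hle
    push Not at hle
    nlinarith
  have hq3 : 3 ≤ q := by exact_mod_cast hq2
  refine ⟨hq3, ?_⟩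
  have hp0 : (0 : ℝ) < p := by linarith
  have hq0 : (0 : ℝ) < q := by linarith
  set θ := Real.pi / p with hθ
  set η := Real.pi / q with hη
  have hθ0 : 0 < θ := by positivity
  have hη0 : 0 < η := by positivity
  have hsum : θ + η < Real.pi / 2 := by
    rw [hθ, hη, div_add_div _ _ hp0.ne' hq0.ne', div_lt_div_iff₀ (by positivity) two_pos]
    nlinarith [Real.pi_pos]
  have hθ1 : θ < Real.pi / 2 := by linarith
  have hη1 : η < Real.pi / 2 := by linarith
  have sθ : 0 < Real.sin θ := Real.sin_pos_of_pos_of_lt_pi hθ0 (by linarith)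
  have sη : 0 < Real.sin η := Real.sin_pos_of_pos_of_lt_pi hη0 (by linarith)
  have hcos : 0 < Real.cos (θ + η) := Real.cos_pos_of_mem_Ioo ⟨by linarith, hsum⟩
  rw [Real.cos_add] at hcos
  -- `K = cot θ cot η` is the hyperbolic cosine of the circumradius, in curvature `-1`. It exceeds
  -- `1` because `θ + η < π/2`, and `x` is determined by `K = (1 + x²) / (1 - x²)`.
  set K := Real.cos θ * Real.cos η / (Real.sin θ * Real.sin η) with hK
  have hK1 : 1 < K := by rw [hK, lt_div_iff₀ (by positivity)]; linarith
  have hK' : K * (Real.sin θ * Real.sin η) = Real.cos θ * Real.cos η := by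
    rw [hK]; field_simp
  set x := Real.sqrt ((K - 1) / (K + 1)) with hx
  have hpos : 0 < (K - 1) / (K + 1) := div_pos (by linarith) (by linarith)
  have hxsq : x ^ 2 = (K - 1) / (K + 1) := Real.sq_sqrt hpos.le
  have hx2 : x ^ 2 * (K + 1) = K - 1 := by
    rw [hxsq, div_mul_cancel₀ _ (by linarith)]
  have hx0 : 0 < x := Real.sqrt_pos.2 hpos
  have hlt : x ^ 2 < 1 := by nlinarith
  have hne : 1 - x ^ 2 ≠ 0 := by linarith
  refine ⟨x, 2 * x * Real.sin η / (1 - x ^ 2), Real.cos η / Real.sin θ, hp, hx0, by nlinarith,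
    hη0, hη1, div_mul_cancel₀ _ sθ.ne', ?_, div_mul_cancel₀ _ hne⟩
  rw [← hθ, div_mul_eq_mul_div, div_mul_eq_mul_div, div_eq_iff sθ.ne']
  linear_combination (-(1 - x ^ 2)) * hK' - Real.sin θ * Real.sin η * hx2

end SL2RTilde


theorem theorem2p1 (p q : ℕ) (hp : 3 ≤ p) (hq : 2 * (p : ℝ) / ((p : ℝ) - 2) < (q : ℝ)) :
    ∃ (x₃ : ℝ) (A : ZMod p → SL2RTilde.Space) (S : ZMod p → Set SL2RTilde.Space)
      (P : Set SL2RTilde.Space) (r : ZMod p → (SL2RTilde.Space ≃ₜ SL2RTilde.Space)),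
      SL2RTilde.IsStandardRegularInfinitePrism p x₃ A S P ∧
      (∀ i, SL2RTilde.IsRotation (A i) (2 * Real.pi / q) (r i)) ∧
      (∀ i, r i '' S (i - 1) = S i) ∧
      SL2RTilde.IsTiling (SL2RTilde.orbitTiles (Subgroup.closure (Set.range r)) P) ∧
      (∀ Q ∈ SL2RTilde.orbitTiles (Subgroup.closure (Set.range r)) P,
        SL2RTilde.IsRegularInfinitePrism p Q) ∧
      SL2RTilde.IsMonohedral (SL2RTilde.orbitTiles (Subgroup.closure (Set.range r)) P) ∧
      SL2RTilde.IsFaceToFace (Subgroup.closure (Set.range r)) A S P := by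
  obtain ⟨hq3, x, sh, ch, h⟩ := SL2RTilde.exists_regularPolygon hp hq
  have : NeZero p := ⟨by omega⟩
  have hq2 : 2 ≤ q := by omega
  refine ⟨x, SL2RTilde.prismVertex h, SL2RTilde.prismSide sh ch, SL2RTilde.prismSolid sh ch p,
    fun k => SL2RTilde.rotAbout (SL2RTilde.vertexPt h k) (2 * (Real.pi / q)),
    SL2RTilde.isStandardRegularInfinitePrism h, fun i => ?_,
    SL2RTilde.rotAbout_image_prismSide h, SL2RTilde.isTiling hq2 h,
    SL2RTilde.isRegularInfinitePrism_of_mem h, SL2RTilde.isMonohedral h,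
    SL2RTilde.isFaceToFace hq2 h⟩
  rw [mul_div_assoc]
  exact SL2RTilde.isRotation_rotAbout _ _
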